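/- Write $\Delta=\partial_x^2+\partial_y^2+\partial_z^2$ and $\Delta^{(2)}=\partial_x^2\partial_y^2+\partial_y^2\partial_z^2+\partial_x^2\partial_z^2$ on $\mathbb R^3$, and set $$D_1=\tfrac{25}{6}\Big[\partial_t^2-\tfrac13\Delta\partial_t+\tfrac{5}{54}\Delta^{(2)}\Big],\qquad D_2=\tfrac{125}{18}\Big[\partial_t^3-\tfrac13\Delta\partial_t^2+\tfrac{25}{216}\Delta^{(2)}\partial_t-\tfrac{25}{432}\partial_x^2\partial_y^2\partial_z^2\Big],$$ $$D_3=\tfrac{625}{108}\Big[\partial_t^4-\tfrac{5}{18}\Delta\partial_t^3+\tfrac{5}{72}\Delta^{(2)}\partial_t^2\Big],\qquad D_4=\tfrac{3125}{1296}\Big[\partial_t^5-\tfrac16\Delta\partial_t^4\Big],\qquad D_5=\tfrac{3125}{7776}\,\partial_t^6,$$ and $D_j=0$ for $j\ge 6$. For $\varepsilon>0$ consider the equation $$\Big\{\partial_t-\tfrac{5}{18}\Delta+\varepsilon^2D_1+\varepsilon^4D_2+\varepsilon^6D_3+\varepsilon^8D_4+\varepsilon^{10}D_5\Big\}f=0,\qquad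 t>0. \tag{8}$$ (This is $\tfrac{3125}{7776}\varepsilon^{10}\det(L_6)f=0$, where $L_6$ has diagonal entries $\partial_t\pm\varepsilon^{-1}\partial_{x_i}+\varepsilon^{-2}$, $i=1,2,3$, and all off-diagonal entries $-\varepsilon^{-2}/5$.) Call a function on $\mathbb R^3$ admissible if it is smooth and bounded together with each of its derivatives. Call a function of $(t,x,y,z)$, $t\ge0$, admissible if it is continuous for $t\ge 0$, smooth for $t>0$, and each of its derivatives is bounded on every strip $0<t\le T$. Let $\varepsilon_0>0$, let $\varphi_0,\varphi_1,\dots$ and $g^\varepsilon$ ($0<\varepsilon<\varepsilon_0$) be admissible functions on $\mathbb R^3$, and suppose that $g^\varepsilon\sim\varphi_0+\varepsilon^2\varphi_1+\varepsilon^4\varphi_2+\cdots$ as $\varepsilon\to0^+$, uniformly on $\mathbb R^3$ together with all derivatives; that is, each derivative of $g^\varepsilon-\sum_{k=0}^{N}\varepsilon^{2k}\varphi_k$ is $O(\varepsilon^{2N+2})$ uniformly on $\mathbb R^3$, for every $N\ge 0$. A regular solution of (8) with initial data $g^\varepsilon$ is a family $(f^\varepsilon)_{0<\varepsilon<\varepsilon_0}$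 of admissible functions such that $f^\varepsilon$ satisfies (8) for $t>0$, $f^\varepsilon(0,\cdot)=g^\varepsilon$, and each derivative (in $t,x,y,z$) of $f^\varepsilon$ stays bounded on each strip $0<t\le T$, uniformly as $\varepsilon\to0^+$. Then: 1. There is a sequence of admissible functions $u_0,u_1,\dots$, unique for $t\ge0$, with $u_k(0,\cdot)=\varphi_k$ and, for $t>0$, $$\partial_tu_0=\tfrac{5}{18}\Delta u_0,\qquad \partial_tu_k=\tfrac{5}{18}\Delta u_k-\sum_{j=0}^{k-1}D_{k-j}u_j\quad(k\ge1).$$ 2. A regular solution of (8) with initial data $g^\varepsilon$ exists. 3. Every regular solution $f^\varepsilon$ of (8) with initial data $g^\varepsilon$ has the asymptotic expansion $f^\varepsilon\sim u_0+\varepsilon^2u_1+\varepsilon^4u_2+\cdots$ as $\varepsilon\to0^+$ (for every $N\ge0$ and $T>0$, each derivative of $f^\varepsilon-\sum_{k=0}^N\varepsilon^{2k}u_k$ is $O(\varepsilon^{2N+2})$ uniformly for $0<t\le T$ and $(x,y,z)\in\mathbb R^3$); and conversely, the coefficients of any such expansion of $f^\varepsilon$ with admissible coefficients are a solution of the system in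 1. -/

import Mathlib

open Set Filter Topology
open scoped ContDiff

noncomputable section

namespace RandomMotion

/-- Three-dimensional Euclidean space. -/
abbrev Space : Type := EuclideanSpace ℝ (Fin 3)

/-- The partial derivative in the `i`-th coordinate direction of a function on space. -/
def pd (i : Fin 3) (φ : Space → ℝ) : Space → ℝ :=
  fun x => lineDeriv ℝ φ x (EuclideanSpace.single i 1)

/-- The spatial derivative of multi-order `α`. -/
def pdMulti (α : Fin 3 → ℕ) (φ : Space → ℝ) : Space → ℝ :=
  (pd 0)^[α 0] ((pd 1)^[α 1] ((pd 2)^[α 2] φ))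

/-- `∂/∂t` for functions of time and space. -/
def dt (u : ℝ → Space → ℝ) : ℝ → Space → ℝ :=
  fun t x => deriv (fun s => u s x) t

/-- `∂/∂xᵢ` for functions of time and space. -/
def dx (i : Fin 3) (u : ℝ → Space → ℝ) : ℝ → Space → ℝ :=
  fun t => pd i (u t)

/-- The mixed derivative of order `m` in time and multi-order `α` in space. -/
def mixedDeriv (m : ℕ) (α : Fin 3 → ℕ) (u : ℝ → Space → ℝ) : ℝ → Space → ℝ :=
  dt^[m] (fun t => pdMulti α (u t))

/-- `Δ = ∂²/∂x² + ∂²/∂y² + ∂²/∂z²`. -/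
def lap (u : ℝ → Space → ℝ) : ℝ → Space → ℝ :=
  dx 0 (dx 0 u) + dx 1 (dx 1 u) + dx 2 (dx 2 u)

/-- `Δ⁽²⁾ = ∂⁴/∂x²∂y² + ∂⁴/∂y²∂z² + ∂⁴/∂x²∂z²`. -/
def lap2 (u : ℝ → Space → ℝ) : ℝ → Space → ℝ :=
  dx 0 (dx 0 (dx 1 (dx 1 u))) + dx 1 (dx 1 (dx 2 (dx 2 u))) + dx 0 (dx 0 (dx 2 (dx 2 u)))

/-- `∂⁶/∂x²∂y²∂z²`. -/
def lap3 (u : ℝ → Space → ℝ) : ℝ → Space → ℝ :=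
  dx 0 (dx 0 (dx 1 (dx 1 (dx 2 (dx 2 u)))))

/-- The coefficient operators of `ε², ε⁴, ε⁶, ε⁸, ε¹⁰` in the regularized equation
(there are no further ones). -/
def corr : ℕ → (ℝ → Space → ℝ) → ℝ → Space → ℝ
  | 1, u => (25 / 6 : ℝ) • (dt^[2] u - (1 / 3 : ℝ) • lap (dt u) + (5 / 54 : ℝ) • lap2 u)
  | 2, u => (125 / 18 : ℝ) • (dt^[3] u - (1 / 3 : ℝ) • lap (dt^[2] u)
      + (25 / 216 : ℝ) • lap2 (dt u) - (25 / 432 : ℝ) • lap3 u)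
  | 3, u => (625 / 108 : ℝ) • (dt^[4] u - (5 / 18 : ℝ) • lap (dt^[3] u)
      + (5 / 72 : ℝ) • lap2 (dt^[2] u))
  | 4, u => (3125 / 1296 : ℝ) • (dt^[5] u - (1 / 6 : ℝ) • lap (dt^[4] u))
  | 5, u => (3125 / 7776 : ℝ) • dt^[6] u
  | _, _ => 0

/-- The operator of the regularized equation: it is `(3125 / 7776) ε¹⁰ det L₆`, where `L₆` is the
operator matrix with diagonal entries `∂/∂t ± ε⁻¹ ∂/∂xᵢ + ε⁻²` (`i = 1, 2, 3`, both signs) and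
off-diagonal entries `-ε⁻² / 5`. -/
def regOp (ε : ℝ) (u : ℝ → Space → ℝ) : ℝ → Space → ℝ :=
  dt u - (5 / 18 : ℝ) • lap u + ∑ j ∈ Finset.Icc 1 5, ε ^ (2 * j) • corr j u

/-- Smooth functions on space, bounded together with each of their derivatives. -/
def SmoothBddData (φ : Space → ℝ) : Prop :=
  ContDiff ℝ ∞ φ ∧ ∀ α : Fin 3 → ℕ, ∃ C : ℝ, ∀ x, |pdMulti α φ x| ≤ C

/-- Functions that are continuous for `t ≥ 0` and smooth for `t > 0`, each derivative being bounded
on every strip `0 < t ≤ T`. Values at `t < 0` play no role. -/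
structure SmoothBdd (u : ℝ → Space → ℝ) : Prop where
  continuousOn : ContinuousOn (fun p : ℝ × Space => u p.1 p.2) (Ici 0 ×ˢ univ)
  contDiffOn : ContDiffOn ℝ ∞ (fun p : ℝ × Space => u p.1 p.2) (Ioi 0 ×ˢ univ)
  bounded : ∀ (T : ℝ) (m : ℕ) (α : Fin 3 → ℕ), ∃ C : ℝ,
    ∀ t ∈ Ioc 0 T, ∀ x, |mixedDeriv m α u t x| ≤ C

/-- `w ε = O(ε ^ p)` as `ε → 0+`, with all derivatives, uniformly on every strip `0 < t ≤ T`. -/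
def UniformBigO (w : ℝ → ℝ → Space → ℝ) (p : ℕ) : Prop :=
  ∀ (T : ℝ) (m : ℕ) (α : Fin 3 → ℕ), ∃ C : ℝ, ∀ᶠ ε in 𝓝[>] (0 : ℝ),
    ∀ t ∈ Ioc 0 T, ∀ x, |mixedDeriv m α (w ε) t x| ≤ C * ε ^ p

/-- `g ε ∼ φ₀ + ε² φ₁ + ε⁴ φ₂ + …` as `ε → 0+`, uniformly on space with all derivatives. -/
def HasDataExpansion (g : ℝ → Space → ℝ) (φ : ℕ → Space → ℝ) : Prop :=
  ∀ (N : ℕ) (α : Fin 3 → ℕ), ∃ C : ℝ, ∀ᶠ ε in 𝓝[>] (0 : ℝ), ∀ x,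
    |pdMulti α (g ε - ∑ k ∈ Finset.range (N + 1), ε ^ (2 * k) • φ k) x| ≤ C * ε ^ (2 * (N + 1))

/-- `f ε ∼ u₀ + ε² u₁ + ε⁴ u₂ + …` as `ε → 0+`, with all derivatives, uniformly on strips. -/
structure HasExpansion (f : ℝ → ℝ → Space → ℝ) (u : ℕ → ℝ → Space → ℝ) : Prop where
  coeff : ∀ k, SmoothBdd (u k)
  remainder : ∀ N : ℕ, UniformBigO
    (fun ε => f ε - ∑ k ∈ Finset.range (N + 1), ε ^ (2 * k) • u k) (2 * (N + 1))

/-- `f ε`, `0 < ε < ε₀`, is a regular family of solutions of the regularized equation with initial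
values `g ε`: each derivative stays bounded as `ε → 0+` (there is no initial layer). -/
structure IsRegularSolution (ε₀ : ℝ) (g : ℝ → Space → ℝ) (f : ℝ → ℝ → Space → ℝ) : Prop where
  smooth : ∀ ε ∈ Ioo 0 ε₀, SmoothBdd (f ε)
  equation : ∀ ε ∈ Ioo 0 ε₀, ∀ t > 0, ∀ x, regOp ε (f ε) t x = 0
  initial : ∀ ε ∈ Ioo 0 ε₀, ∀ x, f ε 0 x = g ε x
  regular : UniformBigO f 0

/-- The recursive system for the coefficients of the expansion, with initial values `φ k`. -/
structure SolvesHierarchy (φ : ℕ → Space → ℝ) (u : ℕ → ℝ → Space → ℝ) : Prop where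
  smooth : ∀ k, SmoothBdd (u k)
  initial : ∀ k x, u k 0 x = φ k x
  leading : ∀ t > 0, ∀ x, dt (u 0) t x = 5 / 18 * lap (u 0) t x
  higher : ∀ k ≥ 1, ∀ t > 0, ∀ x, dt (u k) t x =
    5 / 18 * lap (u k) t x - ∑ j ∈ Finset.range k, corr (k - j) (u j) t x

end RandomMotion

end

/-!
Functions on `t > 0` that are bounded on strips together with all their derivatives form a module
over the polynomials in `∂/∂t` and `∂/∂xᵢ`, on which differential operators with constant
coefficients act through their symbols. A function and its derivatives satisfy the same equations,
so that estimates in the supremum norm control all derivatives.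

The recursive system is solved by letting heat flow from the initial values and from the sources. By
Borel's construction its solution is the asymptotic expansion of a family with the given initial
values, which satisfies the regularized equation up to `O(ε ^ p)` for every `p`. The regularized
operator is, up to a factor, the determinant of the system of transport equations for a random
motion that at the rate `6 / 5 * ε⁻¹ ^ 2` chooses one of the six velocities `± ε⁻¹ eᵢ` with equal
probabilities. The total density of this motion satisfies a renewal equation, whose Neumann series
converges; estimates of its solution lose only finitely many powers of `ε`. The residual of the
Borel sum can therefore be removed by a correction which is `O(ε ^ p)` for every `p` as well.

The difference `d` of two regular solutions has zero initial values, and the heat operator maps it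
to `-∑ ε ^ (2 * j) D_j d`. If `d = O(ε ^ p)`, then this source is `O(ε ^ (p + 2))`, and so is `d` by
the maximum principle. Hence `d = O(ε ^ p)` for every `p`, and all regular solutions have the same
expansion.
-/

open Set Filter Topology
open scoped ContDiff
--BEGIN

noncomputable section

namespace RandomMotion

lemma isOpen_Ioi_prod_univ {X : Type*} [TopologicalSpace X] :
    IsOpen (Ioi (0 : ℝ) ×ˢ (univ : Set X)) :=
  isOpen_Ioi.prod isOpen_univ

lemma Ioi_prod_univ_mem_nhds {X : Type*} [TopologicalSpace X] {t : ℝ} (ht : 0 < t) (x : X) :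
    Ioi (0 : ℝ) ×ˢ (univ : Set X) ∈ 𝓝 (t, x) :=
  isOpen_Ioi_prod_univ.mem_nhds ⟨ht, mem_univ x⟩

variable {ι : Type*}

variable (ι) in
/-- Polynomials in the space derivatives, the symbols of the operators with constant coefficients
that act in space only. -/
abbrev SpaceSymbol : Type _ := MvPolynomial ι ℝ

variable (ι) in
/-- Polynomials in the time derivative with coefficients in `SpaceSymbol ι`, the symbols of all
operators with constant coefficients. -/
abbrev Symbol : Type _ := Polynomial (SpaceSymbol ι)

local notation "∂ₜ" => (Polynomial.X : Symbol ι)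

local notation "∂ₓ" => (MvPolynomial.X : ι → SpaceSymbol ι)

lemma Symbol.induction_mul {p : Symbol ι → Prop} (const : ∀ c : ℝ, p (c • 1))
    (add : ∀ P Q, p P → p Q → p (P + Q)) (mul_time : ∀ P, p P → p (P * ∂ₜ))
    (mul_space : ∀ P i, p P → p (P * Polynomial.C (∂ₓ i))) (P : Symbol ι) : p P := by
  have hspace : ∀ q : SpaceSymbol ι, p (Polynomial.C q) := by
    intro q
    induction q using MvPolynomial.induction_on with
    | C a =>
      have h : (Polynomial.C (MvPolynomial.C a) : Symbol ι) = a • 1 := by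
        rw [← mul_one (MvPolynomial.C a), ← MvPolynomial.smul_eq_C_mul, ← Polynomial.smul_C,
          Polynomial.C_1]
      exact h ▸ const a
    | add q r hq hr => exact map_add Polynomial.C q r ▸ add _ _ hq hr
    | mul_X q i hq => exact map_mul Polynomial.C q (∂ₓ i) ▸ mul_space _ i hq
  induction P using Polynomial.induction_on with
  | C q => exact hspace q
  | add P Q hP hQ => exact add _ _ hP hQ
  | monomial n q h => rw [pow_succ, ← mul_assoc]; exact mul_time _ h

lemma Symbol.C_smul {M : Type*} [AddCommGroup M] [Module (SpaceSymbol ι) M] [Module (Symbol ι) M]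
    [IsScalarTower (SpaceSymbol ι) (Symbol ι) M] (q : SpaceSymbol ι) (u : M) :
    (Polynomial.C q : Symbol ι) • u = q • u :=
  algebraMap_smul (Symbol ι) q u

/-- A real-linear map that commutes with the space derivatives, as a map that is linear over all
symbols in space. -/
def linearMapOfSpaceDeriv {M N : Type*} [AddCommGroup M] [AddCommGroup N] [Module ℝ M] [Module ℝ N]
    [Module (SpaceSymbol ι) M] [Module (SpaceSymbol ι) N]
    [IsScalarTower ℝ (SpaceSymbol ι) M] [IsScalarTower ℝ (SpaceSymbol ι) N] (f : M →ₗ[ℝ] N)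
    (hf : ∀ i u, f (∂ₓ i • u) = ∂ₓ i • f u) : M →ₗ[SpaceSymbol ι] N where
  toFun := f
  map_add' := map_add f
  map_smul' q u := by
    induction q using MvPolynomial.induction_on generalizing u with
    | C a =>
      have h : (MvPolynomial.C a : SpaceSymbol ι) = a • 1 := by
        rw [MvPolynomial.smul_eq_C_mul, mul_one]
      simp only [h, smul_assoc, one_smul, map_smul, RingHom.id_apply]
    | add p q hp hq => simp only [add_smul, map_add, hp, hq, RingHom.id_apply]
    | mul_X p i hp => rw [mul_smul, hp, hf, RingHom.id_apply, RingHom.id_apply, mul_smul]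

variable [Fintype ι]

local notation "𝔼" => EuclideanSpace ℝ ι

variable (ι) in
/-- The smooth functions on the half-space `t > 0`. They are extended by `0` to `t ≤ 0`, so that
two of them are equal if they agree for `t > 0`. -/
def smoothEvolutions : Submodule ℝ (ℝ → 𝔼 → ℝ) where
  carrier := {u | (∀ t ≤ 0, ∀ x, u t x = 0) ∧
    ContDiffOn ℝ ∞ (fun p : ℝ × 𝔼 => u p.1 p.2) (Ioi 0 ×ˢ univ)}
  add_mem' := fun {u v} hu hv => ⟨fun t ht x => by simp [hu.1 t ht x, hv.1 t ht x], hu.2.add hv.2⟩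
  zero_mem' := ⟨fun _ _ _ => rfl, contDiffOn_const⟩
  smul_mem' := fun c u hu => ⟨fun t ht x => by simp [hu.1 t ht x],
    ContDiffOn.smul (f := fun _ => c) contDiffOn_const hu.2⟩

variable (ι) in
/-- The type of smooth functions on the half-space `t > 0`. It is kept apart from the subtype
`smoothEvolutions ι`, because polynomials are to act on it by differentiation. -/
def Evolution : Type _ := smoothEvolutions ι

namespace Evolution

instance : AddCommGroup (Evolution ι) := inferInstanceAs (AddCommGroup (smoothEvolutions ι))
instance : Module ℝ (Evolution ι) := inferInstanceAs (Module ℝ (smoothEvolutions ι))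
instance : CoeFun (Evolution ι) (fun _ => ℝ → 𝔼 → ℝ) := ⟨fun u => u.1⟩

lemma apply_of_nonpos (u : Evolution ι) {t : ℝ} (ht : t ≤ 0) (x : 𝔼) : u t x = 0 :=
  (show u.1 ∈ smoothEvolutions ι from u.2).1 t ht x

lemma contDiffOn (u : Evolution ι) :
    ContDiffOn ℝ ∞ (fun p : ℝ × 𝔼 => u p.1 p.2) (Ioi 0 ×ˢ univ) :=
  (show u.1 ∈ smoothEvolutions ι from u.2).2

lemma contDiffAt (u : Evolution ι) {t : ℝ} (ht : 0 < t) (x : 𝔼) :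
    ContDiffAt ℝ ∞ (fun p : ℝ × 𝔼 => u p.1 p.2) (t, x) :=
  u.contDiffOn.contDiffAt (Ioi_prod_univ_mem_nhds ht x)

lemma hasFDerivAt_fderiv (u : Evolution ι) {t : ℝ} (ht : 0 < t) (x : 𝔼) :
    HasFDerivAt (fun p : ℝ × 𝔼 => u p.1 p.2)
      (fderiv ℝ (fun p : ℝ × 𝔼 => u p.1 p.2) (t, x)) (t, x) :=
  ((u.contDiffAt ht x).differentiableAt (by simp)).hasFDerivAt

lemma ext {u v : Evolution ι} (h : ∀ t > 0, ∀ x, u t x = v t x) : u = v := by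
  apply Subtype.ext
  funext t x
  rcases lt_or_ge 0 t with ht | ht
  · exact h t ht x
  · exact (u.apply_of_nonpos ht x).trans (v.apply_of_nonpos ht x).symm

@[simp] lemma add_apply (u v : Evolution ι) (t : ℝ) (x : 𝔼) : (u + v) t x = u t x + v t x := rfl
@[simp] lemma smul_apply (c : ℝ) (u : Evolution ι) (t : ℝ) (x : 𝔼) : (c • u) t x = c * u t x := rfl

/-- The evolution that agrees with `u` for `t > 0`. -/
def ofContDiffOn (u : ℝ → 𝔼 → ℝ)
    (hu : ContDiffOn ℝ ∞ (fun p : ℝ × 𝔼 => u p.1 p.2) (Ioi 0 ×ˢ univ)) : Evolution ι :=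
  ⟨fun t x => if 0 < t then u t x else 0, fun _ ht _ => if_neg ht.not_gt,
    hu.congr fun _ hp => if_pos hp.1⟩

lemma ofContDiffOn_apply {u : ℝ → 𝔼 → ℝ} (hu) {t : ℝ} (ht : 0 < t) (x : 𝔼) :
    ofContDiffOn u hu t x = u t x := if_pos ht

/-- The derivative in the direction `v` of space-time, as an operator on evolutions. -/
def dirDeriv (v : ℝ × 𝔼) : Module.End ℝ (Evolution ι) where
  toFun u := ofContDiffOn (fun t x => fderiv ℝ (fun p : ℝ × 𝔼 => u p.1 p.2) (t, x) v)
    ((u.contDiffOn.fderiv_of_isOpen isOpen_Ioi_prod_univ (m := ∞) (by simp)).clm_apply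
      contDiffOn_const)
  map_add' u w := ext fun t ht x => by
    simp only [ofContDiffOn_apply _ ht, add_apply]
    rw [((u.hasFDerivAt_fderiv ht x).fun_add (w.hasFDerivAt_fderiv ht x)).fderiv]
    rfl
  map_smul' c u := ext fun t ht x => by
    simp only [ofContDiffOn_apply _ ht, smul_apply, RingHom.id_apply]
    rw [((u.hasFDerivAt_fderiv ht x).const_mul c).fderiv]
    rfl

lemma dirDeriv_apply (v : ℝ × 𝔼) (u : Evolution ι) {t : ℝ} (ht : 0 < t) (x : 𝔼) :
    dirDeriv v u t x = fderiv ℝ (fun p : ℝ × 𝔼 => u p.1 p.2) (t, x) v :=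
  if_pos ht

lemma dirDeriv_dirDeriv_apply (v w : ℝ × 𝔼) (u : Evolution ι) {t : ℝ} (ht : 0 < t) (x : 𝔼) :
    dirDeriv v (dirDeriv w u) t x =
      fderiv ℝ (fderiv ℝ (fun p : ℝ × 𝔼 => u p.1 p.2)) (t, x) v w := by
  have hnear : (fun p : ℝ × 𝔼 => dirDeriv w u p.1 p.2) =ᶠ[𝓝 (t, x)]
      fun p => fderiv ℝ (fun p : ℝ × 𝔼 => u p.1 p.2) p w := by
    filter_upwards [Ioi_prod_univ_mem_nhds ht x] with p hp using dirDeriv_apply _ _ hp.1 _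
  have hdiff : DifferentiableAt ℝ (fderiv ℝ (fun p : ℝ × 𝔼 => u p.1 p.2)) (t, x) :=
    ((u.contDiffAt ht x).fderiv_right (m := 1)
      (WithTop.coe_le_coe.2 le_top)).differentiableAt one_ne_zero
  rw [dirDeriv_apply _ _ ht, hnear.fderiv_eq, fderiv_clm_apply hdiff (by fun_prop)]
  simp

lemma dirDeriv_comm (v w : ℝ × 𝔼) : Commute (dirDeriv v) (dirDeriv w) := by
  refine LinearMap.ext fun u => ext fun t ht x => ?_
  have hsymm : IsSymmSndFDerivAt ℝ (fun p : ℝ × 𝔼 => u p.1 p.2) (t, x) :=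
    (u.contDiffAt ht x).isSymmSndFDerivAt
      (minSmoothness_of_isRCLikeNormedField.trans_le (WithTop.coe_le_coe.2 le_top))
  rw [Module.End.mul_apply, Module.End.mul_apply, dirDeriv_dirDeriv_apply v w u ht,
    dirDeriv_dirDeriv_apply w v u ht]
  exact hsymm v w

/-- The unit vector of space-time in the `i`-th direction of space. -/
def spaceDir (i : ι) : ℝ × 𝔼 := (0, EuclideanSpace.basisFun ι ℝ i)

/-- The action of polynomials in the space derivatives on evolutions. `MvPolynomial.aeval` needs a
commutative target, here the algebra generated by the space derivatives. -/
def spaceAction : SpaceSymbol ι →ₐ[ℝ] Module.End ℝ (Evolution ι) :=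
  let spaceDerivs : Set (Module.End ℝ (Evolution ι)) := range fun i => dirDeriv (spaceDir i)
  haveI : IsMulCommutative (Algebra.adjoin ℝ spaceDerivs) :=
    Algebra.isMulCommutative_adjoin ℝ (by
      rintro _ ⟨i, rfl⟩ _ ⟨j, rfl⟩
      exact dirDeriv_comm _ _)
  letI : CommRing (Algebra.adjoin ℝ spaceDerivs) :=
    { (Algebra.adjoin ℝ spaceDerivs).toRing with mul_comm := mul_comm' }
  (Algebra.adjoin ℝ spaceDerivs).val.comp
    (MvPolynomial.aeval fun i => ⟨dirDeriv (spaceDir i), Algebra.subset_adjoin ⟨i, rfl⟩⟩)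

lemma spaceAction_X (i : ι) : spaceAction (∂ₓ i) = dirDeriv (spaceDir i) := by
  simp [spaceAction]

instance : Module (SpaceSymbol ι) (Evolution ι) := Module.compHom _ spaceAction.toRingHom

lemma spaceSymbol_smul_def (q : SpaceSymbol ι) (u : Evolution ι) : q • u = spaceAction q u := rfl

instance : IsScalarTower ℝ (SpaceSymbol ι) (Evolution ι) :=
  ⟨fun c q u => by simp [spaceSymbol_smul_def]⟩

lemma spaceDeriv_smul (i : ι) (u : Evolution ι) : ∂ₓ i • u = dirDeriv (spaceDir i) u := by
  rw [spaceSymbol_smul_def, spaceAction_X]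

/-- The time derivative, as a map that is linear over the symbols in space. -/
def timeDeriv : Module.End (SpaceSymbol ι) (Evolution ι) :=
  linearMapOfSpaceDeriv (dirDeriv (1, 0)) fun i u => by
    rw [spaceDeriv_smul, spaceDeriv_smul]
    exact LinearMap.congr_fun (dirDeriv_comm _ _) u

instance : Module (Symbol ι) (Evolution ι) :=
  Module.compHom _ (Polynomial.aeval (timeDeriv (ι := ι))).toRingHom

lemma symbol_smul_def (P : Symbol ι) (u : Evolution ι) :
    P • u = Polynomial.aeval timeDeriv P u := rfl

instance : IsScalarTower (SpaceSymbol ι) (Symbol ι) (Evolution ι) :=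
  ⟨fun c q u => by simp [symbol_smul_def]⟩

instance : IsScalarTower ℝ (Symbol ι) (Evolution ι) :=
  ⟨fun c P u => by rw [← smul_one_smul (SpaceSymbol ι) c P, smul_assoc, smul_assoc, one_smul]⟩

lemma timeDeriv_smul (u : Evolution ι) : ∂ₜ • u = dirDeriv (1, 0) u := by
  rw [symbol_smul_def, Polynomial.aeval_X]; rfl

end Evolution

/-- The linear functional on `EuclideanSpace ℝ ι` with the given coordinates. -/
def covector (v : ι → ℝ) : 𝔼 →L[ℝ] ℝ := ∑ i, v i • EuclideanSpace.proj i

lemma covector_apply (v : ι → ℝ) (y : 𝔼) : covector v y = ∑ i, v i * y i := by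
  simp [covector]

lemma covector_basisFun (v : ι → ℝ) (i : ι) : covector v (EuclideanSpace.basisFun ι ℝ i) = v i := by
  classical simp [covector_apply]

lemma eq_covector (L : 𝔼 →L[ℝ] ℝ) : L = covector fun i => L (EuclideanSpace.basisFun ι ℝ i) := by
  ext y
  conv_lhs => rw [← (EuclideanSpace.basisFun ι ℝ).sum_repr y]
  simp only [map_sum, map_smul, EuclideanSpace.basisFun_repr, covector_apply, smul_eq_mul, mul_comm]

lemma norm_covector_le (v : ι → ℝ) : ‖covector v‖ ≤ ∑ i, |v i| := by
  refine (norm_sum_le _ _).trans (Finset.sum_le_sum fun i _ => ?_)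
  rw [norm_smul, Real.norm_eq_abs]
  refine mul_le_of_le_one_right (abs_nonneg _) ?_
  refine ContinuousLinearMap.opNorm_le_bound _ zero_le_one fun y => ?_
  rw [one_mul]
  exact PiLp.norm_apply_le y i

namespace Evolution

lemma hasDerivAt_time (u : Evolution ι) {t : ℝ} (ht : 0 < t) (x : 𝔼) :
    HasDerivAt (fun s => u s x) ((∂ₜ • u : Evolution ι) t x) t := by
  rw [timeDeriv_smul, dirDeriv_apply _ _ ht]
  have h : HasDerivAt (fun s : ℝ => (s, x)) ((1, 0) : ℝ × 𝔼) t :=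
    (hasDerivAt_id t).prodMk (hasDerivAt_const t x)
  exact (u.hasFDerivAt_fderiv ht x).comp_hasDerivAt t h

lemma hasFDerivAt_space (u : Evolution ι) {t : ℝ} (ht : 0 < t) (x : 𝔼) :
    HasFDerivAt (u t) (covector fun i => (∂ₓ i • u : Evolution ι) t x) x := by
  have h : HasFDerivAt (fun y : 𝔼 => (t, y)) (ContinuousLinearMap.inr ℝ ℝ 𝔼) x :=
    (hasFDerivAt_const t x).prodMk (hasFDerivAt_id x)
  have hcomp := (u.hasFDerivAt_fderiv ht x).comp x h
  rw [eq_covector (ContinuousLinearMap.comp _ _)] at hcomp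
  simp only [spaceDeriv_smul, dirDeriv_apply _ _ ht, spaceDir]
  exact hcomp

end Evolution

/-- The bound `|u| ≤ C` on the strip `0 < t ≤ T`. -/
def StripBdd {X : Type*} (T C : ℝ) (u : ℝ → X → ℝ) : Prop := ∀ t ∈ Ioc 0 T, ∀ x, |u t x| ≤ C

namespace StripBdd

variable {X : Type*} {T C C' : ℝ} {u v : ℝ → X → ℝ}

lemma mono (h : StripBdd T C u) (hC : C ≤ C') : StripBdd T C' u := fun t ht x =>
  (h t ht x).trans hC

lemma mono_time {T' : ℝ} (h : StripBdd T C u) (hT : T' ≤ T) : StripBdd T' C u := fun t ht =>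
  h t ⟨ht.1, ht.2.trans hT⟩

lemma add (h : StripBdd T C u) (h' : StripBdd T C' v) : StripBdd T (C + C') (u + v) :=
  fun t ht x => (abs_add_le _ _).trans (add_le_add (h t ht x) (h' t ht x))

lemma smul (h : StripBdd T C u) (c : ℝ) : StripBdd T (|c| * C) (c • u) := fun t ht x => by
  rw [Pi.smul_apply, Pi.smul_apply, smul_eq_mul, abs_mul]
  exact mul_le_mul_of_nonneg_left (h t ht x) (abs_nonneg _)

lemma zero (hC : 0 ≤ C) : StripBdd T C (0 : ℝ → X → ℝ) := fun _ _ _ => by simpa using hC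

end StripBdd

variable (ι) in
/-- The evolutions that are bounded, together with all derivatives, on every strip `0 < t ≤ T`. -/
def bddEvolutions : Submodule (Symbol ι) (Evolution ι) where
  carrier := {u | ∀ (P : Symbol ι) (T : ℝ), ∃ C, StripBdd T C (P • u : Evolution ι)}
  add_mem' := fun {u v} hu hv P T => by
    obtain ⟨C, hC⟩ := hu P T
    obtain ⟨C', hC'⟩ := hv P T
    exact ⟨C + C', by rw [smul_add]; exact hC.add hC'⟩
  zero_mem' := fun P T => ⟨0, by rw [smul_zero]; exact StripBdd.zero le_rfl⟩
  smul_mem' := fun Q u hu P T => by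
    obtain ⟨C, hC⟩ := hu (P * Q) T
    exact ⟨C, by rwa [mul_smul] at hC⟩

variable (ι) in
/-- The type of evolutions that are bounded, together with all derivatives, on every strip
`0 < t ≤ T`. As for `Evolution ι`, values at `t ≤ 0` are `0`; the initial values are
`BddEvolution.trace`. -/
def BddEvolution : Type _ := bddEvolutions ι

namespace BddEvolution

instance : AddCommGroup (BddEvolution ι) := inferInstanceAs (AddCommGroup (bddEvolutions ι))
instance : Module ℝ (BddEvolution ι) := inferInstanceAs (Module ℝ (bddEvolutions ι))
instance : Module (SpaceSymbol ι) (BddEvolution ι) :=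
  inferInstanceAs (Module (SpaceSymbol ι) (bddEvolutions ι))
instance : Module (Symbol ι) (BddEvolution ι) :=
  inferInstanceAs (Module (Symbol ι) (bddEvolutions ι))
instance : IsScalarTower ℝ (SpaceSymbol ι) (BddEvolution ι) :=
  inferInstanceAs (IsScalarTower ℝ (SpaceSymbol ι) (bddEvolutions ι))
instance : IsScalarTower ℝ (Symbol ι) (BddEvolution ι) :=
  inferInstanceAs (IsScalarTower ℝ (Symbol ι) (bddEvolutions ι))
instance : IsScalarTower (SpaceSymbol ι) (Symbol ι) (BddEvolution ι) :=
  inferInstanceAs (IsScalarTower (SpaceSymbol ι) (Symbol ι) (bddEvolutions ι))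
instance : CoeFun (BddEvolution ι) (fun _ => ℝ → 𝔼 → ℝ) := ⟨fun u => u.1.1⟩

end BddEvolution

/-- A set of functions on the half-space `t > 0`, bounded on strips, that contains the first
derivatives of its members. Its members are then smooth and bounded on strips together with all
derivatives, so that integrals and series with parameters are shown to be bounded evolutions by
computing first derivatives only. -/
structure IsDerivClosed (S : Set (ℝ → 𝔼 → ℝ)) : Prop where
  zero : ∀ u ∈ S, ∀ t ≤ 0, ∀ x, u t x = 0
  bdd : ∀ u ∈ S, ∀ T, ∃ C, StripBdd T C u
  time : ∀ u ∈ S, ∃ v ∈ S, ∀ t > 0, ∀ x, HasDerivAt (fun s => u s x) (v t x) t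
  space : ∀ u ∈ S, ∃ v : ι → ℝ → 𝔼 → ℝ, (∀ i, v i ∈ S) ∧
    ∀ t > 0, ∀ x, HasFDerivAt (u t) (covector fun i => v i t x) x

namespace IsDerivClosed

variable {S : Set (ℝ → EuclideanSpace ℝ ι → ℝ)}

lemma continuousAt (hS : IsDerivClosed S) {u : ℝ → 𝔼 → ℝ} (hu : u ∈ S) {t : ℝ} (ht : 0 < t)
    (x : 𝔼) : ContinuousAt (fun p : ℝ × 𝔼 => u p.1 p.2) (t, x) := by
  obtain ⟨v, hv, hderiv⟩ := hS.time u hu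
  obtain ⟨_, -, hfderiv⟩ := hS.space u hu
  obtain ⟨C, hC⟩ := hS.bdd v hv (t + 1)
  have hspace : Tendsto (fun p : ℝ × 𝔼 => u t p.2) (𝓝 (t, x)) (𝓝 (u t x)) :=
    (hfderiv t ht x).continuousAt.tendsto.comp (continuous_snd.tendsto (t, x))
  have htime : Tendsto (fun p : ℝ × 𝔼 => u p.1 p.2 - u t p.2) (𝓝 (t, x)) (𝓝 0) := by
    have hbound : Tendsto (fun p : ℝ × 𝔼 => C * |p.1 - t|) (𝓝 (t, x)) (𝓝 0) := by
      have : Continuous fun p : ℝ × 𝔼 => C * |p.1 - t| := by fun_prop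
      simpa using this.tendsto (t, x)
    refine squeeze_zero_norm' ?_ hbound
    have hnear : ∀ᶠ p : ℝ × 𝔼 in 𝓝 (t, x), p.1 ∈ Ioo 0 (t + 1) :=
      (continuous_fst.tendsto (t, x)).eventually (Ioo_mem_nhds ht (lt_add_one t))
    filter_upwards [hnear] with p hp
    exact (convex_Ioo 0 (t + 1)).norm_image_sub_le_of_norm_hasDerivWithin_le
      (f := fun s => u s p.2) (f' := fun s => v s p.2)
      (fun s hs => (hderiv s hs.1 p.2).hasDerivWithinAt)
      (fun s hs => hC s ⟨hs.1, hs.2.le⟩ p.2) ⟨ht, lt_add_one t⟩ hp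
  simpa [ContinuousAt] using htime.add hspace

lemma hasFDerivAt (hS : IsDerivClosed S) {u v₀ : ℝ → 𝔼 → ℝ} {v : ι → ℝ → 𝔼 → ℝ}
    (hv₀ : v₀ ∈ S) (hv : ∀ i, v i ∈ S) (h₀ : ∀ t > 0, ∀ x, HasDerivAt (fun s => u s x) (v₀ t x) t)
    (h : ∀ t > 0, ∀ x, HasFDerivAt (u t) (covector fun i => v i t x) x) {t : ℝ} (ht : 0 < t)
    (x : 𝔼) : HasFDerivAt (fun p : ℝ × 𝔼 => u p.1 p.2)
      ((ContinuousLinearMap.toSpanSingleton ℝ (v₀ t x)).coprod (covector fun i => v i t x))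
      (t, x) := by
  have hnear := Ioi_prod_univ_mem_nhds ht x
  refine (hasStrictFDerivAt_uncurry_coprod (u := (t, x)) (f := u)
    (f₁ := fun t x => ContinuousLinearMap.toSpanSingleton ℝ (v₀ t x))
    (f₂ := fun t x => covector fun i => v i t x) ?_ ?_ ?_ ?_).hasFDerivAt
  · filter_upwards [hnear] with q hq using (h₀ q.1 hq.1 q.2).hasFDerivAt
  · filter_upwards [hnear] with q hq using h q.1 hq.1 q.2
  · exact (ContinuousLinearMap.toSpanSingletonCLE (𝕜 := ℝ) (E := ℝ)).continuous.continuousAt.comp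
      (hS.continuousAt hv₀ ht x)
  · exact tendsto_finsetSum _ fun i _ => (hS.continuousAt (hv i) ht x).smul tendsto_const_nhds

lemma contDiffOn (hS : IsDerivClosed S) {u : ℝ → 𝔼 → ℝ} (hu : u ∈ S) :
    ContDiffOn ℝ ∞ (fun p : ℝ × 𝔼 => u p.1 p.2) (Ioi 0 ×ˢ univ) := by
  rw [contDiffOn_infty]
  intro n
  induction n generalizing u with
  | zero =>
    exact contDiffOn_zero.2 fun p hp => (hS.continuousAt hu hp.1 p.2).continuousWithinAt
  | succ n ih =>
    obtain ⟨v₀, hv₀, h₀⟩ := hS.time u hu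
    obtain ⟨v, hv, h⟩ := hS.space u hu
    have hderiv : ∀ p ∈ Ioi (0 : ℝ) ×ˢ (univ : Set 𝔼),
        HasFDerivAt (fun p : ℝ × 𝔼 => u p.1 p.2) _ p := fun p hp =>
      hS.hasFDerivAt hv₀ hv h₀ h hp.1 p.2
    rw [Nat.cast_succ, contDiffOn_succ_iff_fderiv_of_isOpen isOpen_Ioi_prod_univ]
    refine ⟨fun p hp => (hderiv p hp).differentiableAt.differentiableWithinAt, by simp, ?_⟩
    refine ContDiffOn.congr ?_ fun p hp => (hderiv p hp).fderiv
    have hcoord (p : ℝ × 𝔼) : (ContinuousLinearMap.toSpanSingleton ℝ (v₀ p.1 p.2)).coprod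
        (covector fun i => v i p.1 p.2) = v₀ p.1 p.2 • ContinuousLinearMap.fst ℝ ℝ 𝔼 +
        ∑ i, v i p.1 p.2 • (EuclideanSpace.proj i : 𝔼 →L[ℝ] ℝ).comp
          (ContinuousLinearMap.snd ℝ ℝ 𝔼) := by
      ext <;> simp [covector]
    simp only [hcoord]
    exact ((ih hv₀).smul contDiffOn_const).add
      (ContDiffOn.sum fun i _ => (ih (hv i)).smul contDiffOn_const)

lemma timeDeriv_smul_mem (hS : IsDerivClosed S) {u : Evolution ι} (hu : u.1 ∈ S) :
    (∂ₜ • u : Evolution ι).1 ∈ S := by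
  obtain ⟨v, hv, h⟩ := hS.time u.1 hu
  convert hv using 1
  funext t x
  rcases lt_or_ge 0 t with ht | ht
  · exact (u.hasDerivAt_time ht x).unique (h t ht x)
  · rw [Evolution.apply_of_nonpos _ ht, hS.zero v hv t ht]

lemma spaceDeriv_smul_mem (hS : IsDerivClosed S) {u : Evolution ι} (hu : u.1 ∈ S) (i : ι) :
    (∂ₓ i • u : Evolution ι).1 ∈ S := by
  obtain ⟨v, hv, h⟩ := hS.space u.1 hu
  convert hv i using 1
  funext t x
  rcases lt_or_ge 0 t with ht | ht
  · have := congrArg (fun L : 𝔼 →L[ℝ] ℝ => L (EuclideanSpace.basisFun ι ℝ i))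
      ((u.hasFDerivAt_space ht x).unique (h t ht x))
    simpa only [covector_basisFun] using this
  · rw [Evolution.apply_of_nonpos _ ht, hS.zero _ (hv i) t ht]

lemma mem_bddEvolutions (hS : IsDerivClosed S) {u : Evolution ι} (hu : u.1 ∈ S) :
    u ∈ bddEvolutions ι := by
  intro P T
  induction P using Symbol.induction_mul generalizing u with
  | const c =>
    obtain ⟨C, hC⟩ := hS.bdd _ hu T
    exact ⟨_, by rw [smul_assoc, one_smul]; exact hC.smul c⟩
  | add P Q hP hQ =>
    obtain ⟨C, hC⟩ := hP hu
    obtain ⟨C', hC'⟩ := hQ hu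
    exact ⟨C + C', by rw [add_smul]; exact hC.add hC'⟩
  | mul_time P hP => simpa only [mul_smul] using hP (hS.timeDeriv_smul_mem hu)
  | mul_space P i hP =>
    simpa only [mul_smul, Symbol.C_smul] using hP (hS.spaceDeriv_smul_mem hu i)

/-- A member of a set that is closed under differentiation, as a bounded evolution. -/
def toBddEvolution (hS : IsDerivClosed S) {u : ℝ → 𝔼 → ℝ} (hu : u ∈ S) : BddEvolution ι :=
  ⟨⟨u, hS.zero u hu, hS.contDiffOn hu⟩, hS.mem_bddEvolutions hu⟩

end IsDerivClosed

namespace BddEvolution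

lemma ext {u v : BddEvolution ι} (h : ∀ t > 0, ∀ x, u t x = v t x) : u = v :=
  Subtype.ext (Evolution.ext h)

@[simp] lemma add_apply (u v : BddEvolution ι) (t : ℝ) (x : 𝔼) : (u + v) t x = u t x + v t x := rfl
@[simp] lemma sub_apply (u v : BddEvolution ι) (t : ℝ) (x : 𝔼) : (u - v) t x = u t x - v t x := rfl
@[simp] lemma zero_apply (t : ℝ) (x : 𝔼) : (0 : BddEvolution ι) t x = 0 := rfl
@[simp] lemma smul_apply (c : ℝ) (u : BddEvolution ι) (t : ℝ) (x : 𝔼) : (c • u) t x = c * u t x :=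
  rfl

/-- Evaluation at a point, as a linear functional on bounded evolutions. -/
def evalAt (t : ℝ) (x : 𝔼) : BddEvolution ι →ₗ[ℝ] ℝ where
  toFun u := u t x
  map_add' _ _ := rfl
  map_smul' _ _ := rfl

lemma sum_apply {κ : Type*} (s : Finset κ) (u : κ → BddEvolution ι) (t : ℝ) (x : 𝔼) :
    (∑ k ∈ s, u k) t x = ∑ k ∈ s, u k t x :=
  map_sum (evalAt t x) u s

lemma apply_of_nonpos (u : BddEvolution ι) {t : ℝ} (ht : t ≤ 0) (x : 𝔼) : u t x = 0 :=
  u.1.apply_of_nonpos ht x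

lemma exists_stripBdd (u : BddEvolution ι) (T : ℝ) : ∃ C, 0 ≤ C ∧ StripBdd T C u := by
  obtain ⟨C, hC⟩ := u.2 1 T
  rw [one_smul] at hC
  exact ⟨max C 0, le_max_right _ _, hC.mono (le_max_left _ _)⟩

/-- The derivative in space of a bounded evolution. -/
def grad (u : BddEvolution ι) (t : ℝ) (x : 𝔼) : 𝔼 →L[ℝ] ℝ := covector fun i => (∂ₓ i • u) t x

lemma hasDerivAt_time (u : BddEvolution ι) {t : ℝ} (ht : 0 < t) (x : 𝔼) :
    HasDerivAt (fun s => u s x) ((∂ₜ • u) t x) t :=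
  u.1.hasDerivAt_time ht x

lemma hasFDerivAt_space (u : BddEvolution ι) {t : ℝ} (ht : 0 < t) (x : 𝔼) :
    HasFDerivAt (u t) (u.grad t x) x :=
  u.1.hasFDerivAt_space ht x

variable (ι) in
lemma isDerivClosed_range : IsDerivClosed (range fun u : BddEvolution ι => (u : ℝ → 𝔼 → ℝ)) where
  zero := by rintro _ ⟨u, rfl⟩ t ht x; exact u.apply_of_nonpos ht x
  bdd := by rintro _ ⟨u, rfl⟩ T; exact (u.exists_stripBdd T).imp fun _ h => h.2
  time := by rintro _ ⟨u, rfl⟩; exact ⟨_, ⟨∂ₜ • u, rfl⟩, fun t ht x => u.hasDerivAt_time ht x⟩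
  space := by
    rintro _ ⟨u, rfl⟩
    exact ⟨_, fun i => ⟨∂ₓ i • u, rfl⟩, fun t ht x => u.hasFDerivAt_space ht x⟩

lemma hasFDerivAt (u : BddEvolution ι) {t : ℝ} (ht : 0 < t) (x : 𝔼) :
    HasFDerivAt (fun p : ℝ × 𝔼 => u p.1 p.2)
      ((ContinuousLinearMap.toSpanSingleton ℝ ((∂ₜ • u) t x)).coprod (u.grad t x)) (t, x) :=
  (isDerivClosed_range ι).hasFDerivAt ⟨∂ₜ • u, rfl⟩ (v := fun i => (∂ₓ i • u : BddEvolution ι))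
    (fun i => ⟨∂ₓ i • u, rfl⟩) (fun _ ht x => u.hasDerivAt_time ht x)
    (fun _ ht x => u.hasFDerivAt_space ht x) ht x

lemma exists_norm_grad_le (u : BddEvolution ι) (T : ℝ) :
    ∃ C, 0 ≤ C ∧ ∀ t ∈ Ioc 0 T, ∀ x, ‖u.grad t x‖ ≤ C := by
  choose C hC0 hC using fun i => (∂ₓ i • u).exists_stripBdd T
  exact ⟨∑ i, C i, Finset.sum_nonneg fun i _ => hC0 i, fun t ht x =>
    (norm_covector_le _).trans (Finset.sum_le_sum fun i _ => hC i t ht x)⟩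

lemma contDiffOn (u : BddEvolution ι) :
    ContDiffOn ℝ ∞ (fun p : ℝ × 𝔼 => u p.1 p.2) (Ioi 0 ×ˢ univ) :=
  u.1.contDiffOn

lemma continuousAt (u : BddEvolution ι) {t : ℝ} (ht : 0 < t) (x : 𝔼) :
    ContinuousAt (fun p : ℝ × 𝔼 => u p.1 p.2) (t, x) :=
  (u.1.contDiffAt ht x).continuousAt

lemma continuous_space (u : BddEvolution ι) (t : ℝ) : Continuous (u t) := by
  rcases lt_or_ge 0 t with ht | ht
  · exact continuous_iff_continuousAt.2 fun x => (u.hasFDerivAt_space ht x).continuousAt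
  · rw [show u t = fun _ => 0 from funext fun x => u.apply_of_nonpos ht x]
    exact continuous_const

lemma continuousOn_time (u : BddEvolution ι) (x : 𝔼) : ContinuousOn (fun s => u s x) (Ioi 0) :=
  fun _ ht => (u.hasDerivAt_time ht x).continuousAt.continuousWithinAt

end BddEvolution

open MeasureTheory

lemma BddEvolution.integrableOn_time (u : BddEvolution ι) (T : ℝ) (x : 𝔼) :
    IntegrableOn (fun s => u s x) (Ioc 0 T) := by
  obtain ⟨C, -, hC⟩ := u.exists_stripBdd T
  exact Integrable.of_bound (((u.continuousOn_time x).mono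
    Ioc_subset_Ioi_self).aestronglyMeasurable measurableSet_Ioc) C
    ((ae_restrict_iff' measurableSet_Ioc).2 (ae_of_all _ fun s hs => hC s hs x))

/-- The primitive in time that vanishes at `t = 0`. -/
def primitive {X : Type*} (u : ℝ → X → ℝ) : ℝ → X → ℝ := fun t x => ∫ s in Ioc 0 t, u s x

lemma abs_primitive_le {X : Type*} {u : ℝ → X → ℝ} {T C : ℝ} (hC : StripBdd T C u) {t : ℝ}
    (ht : t ∈ Ioc 0 T) (x : X) : |primitive u t x| ≤ C * t := by
  have := norm_setIntegral_le_of_norm_le_const (μ := volume) (s := Ioc 0 t) (C := C)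
    (f := fun s => u s x) (by simp) (fun s hs => hC s ⟨hs.1, hs.2.trans ht.2⟩ x)
  simpa [primitive, Measure.real, ht.1.le] using this

namespace BddEvolution

lemma hasDerivAt_primitive (u : BddEvolution ι) {t : ℝ} (ht : 0 < t) (x : 𝔼) :
    HasDerivAt (fun s => primitive u s x) (u t x) t := by
  have h := intervalIntegral.integral_hasDerivAt_right (f := fun s => u s x) (a := 0) (b := t)
    ((intervalIntegrable_iff_integrableOn_Ioc_of_le ht.le).2 (u.integrableOn_time t x))
    ((u.continuousOn_time x).stronglyMeasurableAtFilter isOpen_Ioi t ht)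
    (u.hasDerivAt_time ht x).continuousAt
  refine h.congr_of_eventuallyEq ?_
  filter_upwards [lt_mem_nhds ht] with s hs
  rw [primitive, intervalIntegral.integral_of_le hs.le]

lemma hasFDerivAt_primitive (u : BddEvolution ι) (t : ℝ) (x : 𝔼) :
    HasFDerivAt (primitive u t)
      (covector fun i => primitive (∂ₓ i • u : BddEvolution ι) t x) x := by
  obtain ⟨C, -, hC⟩ := u.exists_norm_grad_le t
  have hgrad (i : ι) : Integrable (fun s => (∂ₓ i • u) s x • (EuclideanSpace.proj i : 𝔼 →L[ℝ] ℝ))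
      (volume.restrict (Ioc 0 t)) := (integrableOn_time _ _ _).smul_const _
  have h := hasFDerivAt_integral_of_dominated_of_fderiv_le (𝕜 := ℝ)
    (μ := volume.restrict (Ioc 0 t)) (F := fun y s => u s y) (F' := fun y s => u.grad s y)
    (x₀ := x) (s := univ) (bound := fun _ => C) univ_mem
    (Eventually.of_forall fun y => (u.integrableOn_time t y).aestronglyMeasurable)
    (u.integrableOn_time t x)
    (Finset.aestronglyMeasurable_fun_sum _ fun i _ => (hgrad i).aestronglyMeasurable)
    ((ae_restrict_iff' measurableSet_Ioc).2 (ae_of_all _ fun s hs y _ => hC s hs y))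
    (integrable_const _)
    ((ae_restrict_iff' measurableSet_Ioc).2
      (ae_of_all _ fun s hs y _ => u.hasFDerivAt_space hs.1 y))
  refine h.congr_fderiv ?_
  simp only [grad, covector]
  rw [integral_finsetSum _ fun i _ => hgrad i]
  exact Finset.sum_congr rfl fun i _ => integral_smul_const _ _

variable (ι) in
lemma isDerivClosed_primitive :
    IsDerivClosed (range (fun u : BddEvolution ι => primitive u) ∪
      range fun u : BddEvolution ι => (u : ℝ → 𝔼 → ℝ)) where
  zero := by
    rintro _ (⟨u, rfl⟩ | hu) t ht x
    · simp [primitive, Ioc_eq_empty ht.not_gt]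
    · exact (isDerivClosed_range ι).zero _ hu t ht x
  bdd := by
    rintro _ (⟨u, rfl⟩ | hu) T
    · obtain ⟨C, hC0, hC⟩ := u.exists_stripBdd T
      exact ⟨C * T, fun t ht x => (abs_primitive_le hC ht x).trans
        (mul_le_mul_of_nonneg_left ht.2 hC0)⟩
    · exact (isDerivClosed_range ι).bdd _ hu T
  time := by
    rintro _ (⟨u, rfl⟩ | hu)
    · exact ⟨_, Or.inr ⟨u, rfl⟩, fun t ht x => u.hasDerivAt_primitive ht x⟩
    · exact ((isDerivClosed_range ι).time _ hu).imp fun _ h => ⟨Or.inr h.1, h.2⟩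
  space := by
    rintro _ (⟨u, rfl⟩ | hu)
    · exact ⟨_, fun i => Or.inl ⟨∂ₓ i • u, rfl⟩, fun t _ x => u.hasFDerivAt_primitive t x⟩
    · exact ((isDerivClosed_range ι).space _ hu).imp fun _ h => ⟨fun i => Or.inr (h.1 i), h.2⟩

lemma timeDeriv_smul_eq {u v : BddEvolution ι}
    (h : ∀ t > 0, ∀ x, HasDerivAt (fun s => u s x) (v t x) t) : ∂ₜ • u = v :=
  ext fun t ht x => (u.hasDerivAt_time ht x).unique (h t ht x)

lemma spaceDeriv_smul_eq {u : BddEvolution ι} {v : ι → BddEvolution ι}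
    (h : ∀ t > 0, ∀ x, HasFDerivAt (u t) (covector fun i => v i t x) x) (i : ι) :
    ∂ₓ i • u = v i :=
  ext fun t ht x => by
    have := congrArg (fun L : 𝔼 →L[ℝ] ℝ => L (EuclideanSpace.basisFun ι ℝ i))
      ((u.hasFDerivAt_space ht x).unique (h t ht x))
    simpa only [grad, covector_basisFun] using this

/-- The primitive in time that vanishes at `t = 0`, as an operator on bounded evolutions. -/
def timeInt : BddEvolution ι →ₗ[SpaceSymbol ι] BddEvolution ι :=
  linearMapOfSpaceDeriv
    { toFun := fun u => (isDerivClosed_primitive ι).toBddEvolution (Or.inl ⟨u, rfl⟩)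
      map_add' := fun u v => ext fun t _ x =>
        integral_add (u.integrableOn_time t x) (v.integrableOn_time t x)
      map_smul' := fun c _ => ext fun _ _ _ => integral_const_mul c _ }
    fun i u => (spaceDeriv_smul_eq
      (v := fun i => (isDerivClosed_primitive ι).toBddEvolution (Or.inl ⟨∂ₓ i • u, rfl⟩))
      (fun t _ x => u.hasFDerivAt_primitive t x) i).symm

lemma timeDeriv_smul_timeInt (u : BddEvolution ι) : ∂ₜ • timeInt u = u :=
  timeDeriv_smul_eq fun _ ht x => u.hasDerivAt_primitive ht x

lemma abs_timeInt_le {u : BddEvolution ι} {T C : ℝ} (hC : StripBdd T C u)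
    {t : ℝ} (ht : t ∈ Ioc 0 T) (x : 𝔼) : |timeInt u t x| ≤ C * t :=
  abs_primitive_le hC ht x

/-- The time derivative, as a map that is linear over the symbols in space. -/
def timeDeriv : Module.End (SpaceSymbol ι) (BddEvolution ι) where
  toFun u := ∂ₜ • u
  map_add' u v := smul_add _ u v
  map_smul' q u := by
    rw [← Symbol.C_smul, ← Symbol.C_smul, RingHom.id_apply, smul_comm]

/-- The initial value of a bounded evolution, extended to a function that is constant in time. -/
def trace : BddEvolution ι →ₗ[SpaceSymbol ι] BddEvolution ι :=
  LinearMap.id - timeInt ∘ₗ timeDeriv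

lemma trace_def (u : BddEvolution ι) : trace u = u - timeInt (∂ₜ • u) := rfl

lemma timeDeriv_smul_trace (u : BddEvolution ι) : ∂ₜ • trace u = 0 := by
  rw [trace_def, smul_sub, timeDeriv_smul_timeInt, sub_self]

lemma trace_timeInt (u : BddEvolution ι) : trace (timeInt u) = 0 := by
  rw [trace_def, timeDeriv_smul_timeInt, sub_self]

lemma trace_of_timeDeriv_smul_eq_zero {u : BddEvolution ι} (h : ∂ₜ • u = 0) : trace u = u := by
  rw [trace_def, h, map_zero, sub_zero]

lemma timeInt_timeDeriv_smul {u : BddEvolution ι} (h : trace u = 0) : timeInt (∂ₜ • u) = u :=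
  (sub_eq_zero.1 h).symm

lemma apply_eq_of_timeDeriv_smul_eq_zero {u : BddEvolution ι} (h : ∂ₜ • u = 0) {s t : ℝ}
    (hs : 0 < s) (ht : 0 < t) (x : 𝔼) : u s x = u t x := by
  have := (convex_Ioi (0 : ℝ)).norm_image_sub_le_of_norm_hasDerivWithin_le (C := 0)
    (f := fun s => u s x) (f' := fun s => (∂ₜ • u) s x)
    (fun s hs => (u.hasDerivAt_time hs x).hasDerivWithinAt) (fun s _ => by simp [h]) ht hs
  rwa [zero_mul, norm_le_zero_iff, sub_eq_zero] at this

lemma exists_abs_le_of_trace_eq_zero {u : BddEvolution ι} (h : trace u = 0) (T : ℝ) :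
    ∃ C, ∀ t ∈ Ioc 0 T, ∀ x, |u t x| ≤ C * t := by
  obtain ⟨C, -, hC⟩ := (∂ₜ • u).exists_stripBdd T
  refine ⟨C, fun t ht x => ?_⟩
  rw [← timeInt_timeDeriv_smul h]
  exact abs_timeInt_le hC ht x

lemma tendsto_zero_of_trace_eq_zero {u : BddEvolution ι} (h : trace u = 0) (x : 𝔼) :
    Tendsto (fun t => u t x) (𝓝[>] 0) (𝓝 0) := by
  obtain ⟨C, hC⟩ := exists_abs_le_of_trace_eq_zero h 1
  have hbound : Tendsto (fun t : ℝ => C * t) (𝓝[>] 0) (𝓝 0) := by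
    simpa using ((continuous_const_mul C).tendsto 0).mono_left nhdsWithin_le_nhds
  refine squeeze_zero_norm' ?_ hbound
  filter_upwards [Ioc_mem_nhdsGT (zero_lt_one' ℝ)] with t ht using hC t ht x

lemma tendsto_trace (u : BddEvolution ι) (x : 𝔼) {s : ℝ} (hs : 0 < s) :
    Tendsto (fun t => u t x) (𝓝[>] 0) (𝓝 (trace u s x)) := by
  have h := (tendsto_zero_of_trace_eq_zero (trace_timeInt (∂ₜ • u)) x).const_add (trace u s x)
  rw [add_zero] at h
  refine h.congr' ?_
  filter_upwards [self_mem_nhdsWithin] with t ht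
  rw [apply_eq_of_timeDeriv_smul_eq_zero (timeDeriv_smul_trace u) hs ht, trace_def, sub_apply,
    sub_add_cancel]

lemma trace_eq_of_tendsto {u v : BddEvolution ι}
    (h : ∀ x, Tendsto (fun t => u t x - v t x) (𝓝[>] 0) (𝓝 0)) : trace u = trace v := by
  rw [← sub_eq_zero, ← map_sub]
  exact ext fun t ht x => tendsto_nhds_unique (tendsto_trace (u - v) x ht) (h x)

end BddEvolution

/-- The function `u` in the frame that moves with velocity `v`, with the weight `exp (a t)`: this
turns the operator `∂/∂t + v·∇ + a` into the time derivative. -/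
def comoving {E : Type*} [AddCommGroup E] [Module ℝ E] (a : ℝ) (v : E) (u : ℝ → E → ℝ) :
    ℝ → E → ℝ :=
  fun t x => Real.exp (a * t) * u t (x + t • v)

lemma StripBdd.comoving {E : Type*} [AddCommGroup E] [Module ℝ E] (a : ℝ) (v : E)
    {u : ℝ → E → ℝ} {T C : ℝ} (h : StripBdd T C u) :
    StripBdd T (Real.exp (|a| * T) * C) (comoving a v u) := by
  intro t ht x
  rw [RandomMotion.comoving, abs_mul, Real.abs_exp]
  have hexp : a * t ≤ |a| * T := (mul_le_mul_of_nonneg_right (le_abs_self a) ht.1.le).trans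
    (mul_le_mul_of_nonneg_left ht.2 (abs_nonneg a))
  exact mul_le_mul (Real.exp_le_exp.2 hexp) (h t ht _) (abs_nonneg _) (Real.exp_nonneg _)

variable (a : ℝ) (v : EuclideanSpace ℝ ι)

/-- The symbol of the derivative in the direction `v` of space. -/
def spaceDirDeriv : SpaceSymbol ι := ∑ i, v i • ∂ₓ i

lemma spaceDirDeriv_neg : spaceDirDeriv (-v) = -spaceDirDeriv v := by
  simp [spaceDirDeriv]

lemma spaceDirDeriv_smul_basisFun (c : ℝ) (i : ι) :
    spaceDirDeriv (c • EuclideanSpace.basisFun ι ℝ i) = c • ∂ₓ i := by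
  classical
  rw [spaceDirDeriv, Finset.sum_eq_single i]
  · simp
  · intro j _ hj
    simp [hj]
  · simp

/-- The symbol of `∂/∂t + v·∇ + a`, which describes transport with velocity `v` and loss at the
rate `a`. -/
def transport : Symbol ι := ∂ₜ + Polynomial.C (spaceDirDeriv v + a • 1)

lemma transport_smul (u : BddEvolution ι) :
    transport a v • u = ∂ₜ • u + spaceDirDeriv v • u + a • u := by
  rw [transport, add_smul, Symbol.C_smul, add_smul, smul_assoc, one_smul, add_assoc]

namespace BddEvolution

lemma grad_apply (u : BddEvolution ι) (t : ℝ) (x : 𝔼) :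
    u.grad t x v = (spaceDirDeriv v • u) t x := by
  simp only [grad, covector_apply, spaceDirDeriv, Finset.sum_smul, sum_apply, smul_assoc,
    smul_apply, mul_comm]

lemma hasDerivAt_comoving (u : BddEvolution ι) {t : ℝ} (ht : 0 < t) (x : 𝔼) :
    HasDerivAt (fun s => comoving a v u s x)
      (comoving a v (transport a v • u : BddEvolution ι) t x) t := by
  have hpath : HasDerivAt (fun s : ℝ => (s, x + s • v)) ((1, v) : ℝ × 𝔼) t := by
    simpa using (hasDerivAt_id t).prodMk (((hasDerivAt_id t).smul_const v).const_add x)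
  have hu := HasFDerivAt.comp_hasDerivAt (l := fun p : ℝ × 𝔼 => u p.1 p.2) t
    (u.hasFDerivAt ht (x + t • v)) hpath
  have hexp : HasDerivAt (fun s => Real.exp (a * s)) (Real.exp (a * t) * a) t := by
    simpa using ((hasDerivAt_id t).const_mul a).exp
  refine (hexp.mul hu).congr_deriv ?_
  simp only [comoving, transport_smul, add_apply, smul_apply, ContinuousLinearMap.coprod_apply,
    grad_apply, ContinuousLinearMap.toSpanSingleton_apply, one_smul, Function.comp_apply]
  ring

lemma hasFDerivAt_comoving (u : BddEvolution ι) {t : ℝ} (ht : 0 < t) (x : 𝔼) :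
    HasFDerivAt (comoving a v u t)
      (covector fun i => comoving a v (∂ₓ i • u : BddEvolution ι) t x) x := by
  have hshift : HasFDerivAt (fun y : 𝔼 => y + t • v) (ContinuousLinearMap.id ℝ 𝔼) x :=
    (hasFDerivAt_id x).add_const _
  have h := ((u.hasFDerivAt_space ht (x + t • v)).comp x hshift).const_mul (Real.exp (a * t))
  refine h.congr_fderiv ?_
  ext y
  simp [grad, covector_apply, comoving, Finset.mul_sum, mul_assoc]

lemma isDerivClosed_comoving :
    IsDerivClosed (range fun u : BddEvolution ι => comoving a v u) where
  zero := by
    rintro _ ⟨u, rfl⟩ t ht x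
    simp only [comoving, u.apply_of_nonpos ht, mul_zero]
  bdd := by
    rintro _ ⟨u, rfl⟩ T
    obtain ⟨C, -, hC⟩ := u.exists_stripBdd T
    exact ⟨_, hC.comoving a v⟩
  time := by
    rintro _ ⟨u, rfl⟩
    exact ⟨_, ⟨_, rfl⟩, fun t ht x => u.hasDerivAt_comoving a v ht x⟩
  space := by
    rintro _ ⟨u, rfl⟩
    exact ⟨_, fun i => ⟨_, rfl⟩, fun t ht x => u.hasFDerivAt_comoving a v ht x⟩

/-- The passage to a moving frame, as an operator on bounded evolutions. -/
def shift : BddEvolution ι →ₗ[SpaceSymbol ι] BddEvolution ι :=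
  linearMapOfSpaceDeriv
    { toFun := fun u => (isDerivClosed_comoving a v).toBddEvolution ⟨u, rfl⟩
      map_add' := fun _ _ => ext fun _ _ _ => mul_add _ _ _
      map_smul' := fun _ _ => ext fun _ _ _ => mul_left_comm _ _ _ }
    fun i u => (spaceDeriv_smul_eq
      (v := fun i => (isDerivClosed_comoving a v).toBddEvolution ⟨∂ₓ i • u, rfl⟩)
      (fun _ ht x => u.hasFDerivAt_comoving a v ht x) i).symm

lemma shift_apply (u : BddEvolution ι) (t : ℝ) (x : 𝔼) :
    shift a v u t x = Real.exp (a * t) * u t (x + t • v) := rfl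

lemma timeDeriv_smul_shift (u : BddEvolution ι) :
    ∂ₜ • shift a v u = shift a v (transport a v • u) :=
  timeDeriv_smul_eq fun _ ht x => u.hasDerivAt_comoving a v ht x

lemma shift_neg_shift (u : BddEvolution ι) : shift (-a) (-v) (shift a v u) = u := by
  refine ext fun t _ x => ?_
  rw [shift_apply, shift_apply, ← mul_assoc, ← Real.exp_add, add_assoc, ← smul_add]
  simp

lemma trace_shift {u : BddEvolution ι} (h : trace u = 0) : trace (shift a v u) = 0 := by
  rw [← map_zero trace]
  refine trace_eq_of_tendsto fun x => ?_
  obtain ⟨C, hC⟩ := exists_abs_le_of_trace_eq_zero h 1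
  have hbound : Tendsto (fun t : ℝ => Real.exp (a * t) * (C * t)) (𝓝[>] 0) (𝓝 0) := by
    have : Continuous fun t : ℝ => Real.exp (a * t) * (C * t) := by fun_prop
    simpa using (this.tendsto 0).mono_left nhdsWithin_le_nhds
  refine squeeze_zero_norm' ?_ hbound
  filter_upwards [Ioc_mem_nhdsGT (zero_lt_one' ℝ)] with t ht
  rw [zero_apply, sub_zero, shift_apply, Real.norm_eq_abs, abs_mul, Real.abs_exp]
  gcongr
  exact hC t ht _

/-- The solution operator of `∂u/∂t + v·∇u + a u = f` with initial value `0`. -/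
def transportInv : BddEvolution ι →ₗ[SpaceSymbol ι] BddEvolution ι :=
  shift (-a) (-v) ∘ₗ timeInt ∘ₗ shift a v

lemma transportInv_def (u : BddEvolution ι) :
    transportInv a v u = shift (-a) (-v) (timeInt (shift a v u)) := rfl

lemma trace_transportInv (u : BddEvolution ι) : trace (transportInv a v u) = 0 :=
  trace_shift _ _ (trace_timeInt _)

lemma transport_smul_shift_neg (u : BddEvolution ι) :
    transport a v • shift (-a) (-v) u = shift (-a) (-v) (∂ₜ • u) := by
  simp only [transport_smul, timeDeriv_smul_shift, spaceDirDeriv_neg, neg_smul, map_add, map_neg,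
    map_smul, LinearMap.map_smul_of_tower]
  abel

lemma transport_smul_transportInv (u : BddEvolution ι) :
    transport a v • transportInv a v u = u := by
  rw [transportInv_def, transport_smul_shift_neg, timeDeriv_smul_timeInt, shift_neg_shift]

lemma transportInv_transport_smul {u : BddEvolution ι} (h : trace u = 0) :
    transportInv a v (transport a v • u) = u := by
  rw [transportInv_def, ← timeDeriv_smul_shift, timeInt_timeDeriv_smul (trace_shift _ _ h),
    shift_neg_shift]

lemma abs_transportInv_le_integral {u : BddEvolution ι} {T : ℝ} {m : ℝ → ℝ} (hm : Continuous m)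
    (h : ∀ s ∈ Ioc 0 T, ∀ y, |u s y| ≤ m s) {t : ℝ} (ht : t ∈ Ioc 0 T) (x : 𝔼) :
    |transportInv a v u t x| ≤ Real.exp (-a * t) * ∫ s in 0..t, Real.exp (a * s) * m s := by
  have hcont : Continuous fun s => Real.exp (a * s) * m s := by fun_prop
  rw [transportInv_def, shift_apply, abs_mul, Real.abs_exp,
    intervalIntegral.integral_of_le ht.1.le]
  gcongr
  rw [← Real.norm_eq_abs]
  refine norm_integral_le_of_norm_le (hcont.integrableOn_Ioc (μ := volume)) ?_
  refine (ae_restrict_iff' measurableSet_Ioc).2 (ae_of_all _ fun s hs => ?_)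
  rw [shift_apply, Real.norm_eq_abs, abs_mul, Real.abs_exp]
  gcongr
  exact h s ⟨hs.1, hs.2.trans ht.2⟩ _

variable {a} {v}

lemma abs_transportInv_le_of_affine {u : BddEvolution ι} {T r : ℝ}
    (h : ∀ s ∈ Ioc 0 T, ∀ y, |u s y| ≤ r * (1 + a * s)) {t : ℝ} (ht : t ∈ Ioc 0 T) (x : 𝔼) :
    |transportInv a v u t x| ≤ r * t := by
  have hderiv (s : ℝ) : HasDerivAt (fun s => r * s * Real.exp (a * s))
      (Real.exp (a * s) * (r * (1 + a * s))) s := by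
    have hlin : HasDerivAt (fun s => r * s) r s := by simpa using (hasDerivAt_id s).const_mul r
    have hexp : HasDerivAt (fun s => Real.exp (a * s)) (Real.exp (a * s) * a) s := by
      simpa using ((hasDerivAt_id s).const_mul a).exp
    exact (hlin.mul hexp).congr_deriv (by ring)
  have hcont : Continuous fun s => Real.exp (a * s) * (r * (1 + a * s)) := by fun_prop
  have hexp : Real.exp (-a * t) * Real.exp (a * t) = 1 := by
    rw [← Real.exp_add, neg_mul, neg_add_cancel, Real.exp_zero]
  refine (abs_transportInv_le_integral a v (by fun_prop) h ht x).trans_eq ?_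
  rw [intervalIntegral.integral_eq_sub_of_hasDerivAt (fun s _ => hderiv s)
    (hcont.intervalIntegrable 0 t)]
  linear_combination r * t * hexp

lemma abs_transportInv_le_linear (ha : 0 ≤ a) {u : BddEvolution ι} {T C : ℝ} (h : StripBdd T C u)
    {t : ℝ} (ht : t ∈ Ioc 0 T) (x : 𝔼) : |transportInv a v u t x| ≤ C * t :=
  abs_transportInv_le_of_affine (fun s hs y => (h s hs y).trans
    (le_mul_of_one_le_right ((abs_nonneg _).trans (h t ht x))
      (le_add_of_nonneg_right (mul_nonneg ha hs.1.le)))) ht x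

lemma abs_transportInv_le_contraction (ha : 0 < a) {u : BddEvolution ι} {T C : ℝ}
    (h : StripBdd T C u) {t : ℝ} (ht : t ∈ Ioc 0 T) (x : 𝔼) :
    |transportInv a v u t x| ≤ C * ((1 - Real.exp (-a * T)) / a) := by
  have hC : 0 ≤ C := (abs_nonneg _).trans (h t ht x)
  have hderiv (s : ℝ) :
      HasDerivAt (fun s => C / a * Real.exp (a * s)) (Real.exp (a * s) * C) s := by
    have hexp : HasDerivAt (fun s => Real.exp (a * s)) (Real.exp (a * s) * a) s := by
      simpa using ((hasDerivAt_id s).const_mul a).exp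
    exact (hexp.const_mul (C / a)).congr_deriv (by field_simp)
  have hcont : Continuous fun s => Real.exp (a * s) * C := by fun_prop
  have hexp : Real.exp (-a * t) * Real.exp (a * t) = 1 := by
    rw [← Real.exp_add, neg_mul, neg_add_cancel, Real.exp_zero]
  calc |transportInv a v u t x| ≤ Real.exp (-a * t) * ∫ s in 0..t, Real.exp (a * s) * C :=
        abs_transportInv_le_integral a v continuous_const h ht x
    _ = C * ((1 - Real.exp (-a * t)) / a) := by
        rw [intervalIntegral.integral_eq_sub_of_hasDerivAt (fun s _ => hderiv s)
          (hcont.intervalIntegrable 0 t), mul_zero, Real.exp_zero]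
        linear_combination C / a * hexp
    _ ≤ C * ((1 - Real.exp (-a * T)) / a) := by
        gcongr 2
        exact sub_le_sub_left (Real.exp_le_exp.2
          (mul_le_mul_of_nonpos_left ht.2 (neg_nonpos.2 ha.le))) _

end BddEvolution

section Gauss

variable {V : Type*} [NormedAddCommGroup V] [InnerProductSpace ℝ V] [FiniteDimensional ℝ V]
  [MeasurableSpace V] [BorelSpace V]

/-- The density of the standard Gaussian distribution. -/
def gauss (z : V) : ℝ :=
  (∫ w : V, Real.exp (-(1 / 2) * ‖w‖ ^ 2))⁻¹ * Real.exp (-(1 / 2) * ‖z‖ ^ 2)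

lemma integrable_rexp_neg_mul_sq_norm {b : ℝ} (hb : 0 < b) :
    Integrable fun z : V => Real.exp (-b * ‖z‖ ^ 2) := by
  have h := (GaussianFourier.integrable_cexp_neg_mul_sq_norm_add (V := V) (b := b)
    (by simpa using hb) 0 0).re
  refine h.congr (ae_of_all _ fun z => ?_)
  have hreal : -(b : ℂ) * (‖z‖ : ℂ) ^ 2 + 0 * (inner ℝ (0 : V) z : ℂ) =
      ((-b * ‖z‖ ^ 2 : ℝ) : ℂ) := by
    push_cast; ring
  simp only [hreal]
  exact Complex.exp_ofReal_re _

variable (V) in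
lemma integral_rexp_neg_half_mul_sq_norm_pos : 0 < ∫ w : V, Real.exp (-(1 / 2) * ‖w‖ ^ 2) := by
  rw [GaussianFourier.integral_rexp_neg_mul_sq_norm (by norm_num)]
  positivity

lemma gauss_nonneg (z : V) : 0 ≤ gauss z :=
  mul_nonneg (inv_nonneg.2 (integral_rexp_neg_half_mul_sq_norm_pos V).le) (Real.exp_nonneg _)

lemma continuous_gauss : Continuous (gauss : V → ℝ) := by unfold gauss; fun_prop

lemma integrable_gauss : Integrable (gauss : V → ℝ) :=
  (integrable_rexp_neg_mul_sq_norm (by norm_num)).const_mul _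

variable (V) in
lemma integral_gauss : ∫ z : V, gauss z = 1 := by
  simp only [gauss]
  rw [integral_const_mul, inv_mul_cancel₀ (integral_rexp_neg_half_mul_sq_norm_pos V).ne']

lemma integrable_norm_mul_gauss : Integrable fun z : V => ‖z‖ * gauss z := by
  have hcont : Continuous (gauss : V → ℝ) := continuous_gauss
  refine Integrable.mono' ((integrable_rexp_neg_mul_sq_norm (b := 1 / 4) (by norm_num)).const_mul
    (∫ w : V, Real.exp (-(1 / 2) * ‖w‖ ^ 2))⁻¹) (by fun_prop) (ae_of_all _ fun z => ?_)
  rw [Real.norm_of_nonneg (mul_nonneg (norm_nonneg z) (gauss_nonneg z)), gauss, mul_left_comm]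
  refine mul_le_mul_of_nonneg_left ?_
    (inv_nonneg.2 (integral_rexp_neg_half_mul_sq_norm_pos V).le)
  have hnorm : ‖z‖ ≤ Real.exp (1 / 4 * ‖z‖ ^ 2) := by
    nlinarith [Real.add_one_le_exp (1 / 4 * ‖z‖ ^ 2), sq_nonneg (1 - ‖z‖ / 2)]
  calc ‖z‖ * Real.exp (-(1 / 2) * ‖z‖ ^ 2)
      ≤ Real.exp (1 / 4 * ‖z‖ ^ 2) * Real.exp (-(1 / 2) * ‖z‖ ^ 2) := by gcongr
    _ = Real.exp (-(1 / 4) * ‖z‖ ^ 2) := by rw [← Real.exp_add]; ring_nf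

lemma hasFDerivAt_gauss (z : V) : HasFDerivAt gauss (-gauss z • innerSL ℝ z) z := by
  have h := (((hasStrictFDerivAt_norm_sq z).hasFDerivAt.const_mul (-(1 / 2) : ℝ)).exp).const_mul
    (∫ w : V, Real.exp (-(1 / 2) * ‖w‖ ^ 2))⁻¹
  refine HasFDerivAt.congr_fderiv h ?_
  ext y
  simp only [gauss, one_div, neg_mul, neg_smul, neg_apply, smul_apply,
    innerSL_apply_apply, nsmul_eq_mul, Nat.cast_ofNat,
    smul_eq_mul]
  ring

lemma integrable_mul_gauss {φ : V → ℝ} (hφ : Continuous φ) {C : ℝ} (hC : ∀ x, |φ x| ≤ C) :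
    Integrable fun z => φ z * gauss z :=
  integrable_gauss.bdd_mul (c := C) hφ.aestronglyMeasurable (ae_of_all _ hC)

/-- The mean of `φ` with respect to the Gaussian distribution with mean `x` and standard
deviation `σ` in every direction. -/
def gaussMean (φ : V → ℝ) (σ : ℝ) (x : V) : ℝ := ∫ z, φ (x + σ • z) * gauss z

lemma abs_gaussMean_le {φ : V → ℝ} {C : ℝ} (hC : ∀ x, |φ x| ≤ C) (σ : ℝ) (x : V) :
    |gaussMean φ σ x| ≤ C := by
  have := norm_integral_le_of_norm_le (f := fun z => φ (x + σ • z) * gauss z)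
    (integrable_gauss.const_mul C) (ae_of_all _ fun z => by
      rw [norm_mul, Real.norm_of_nonneg (gauss_nonneg z)]
      exact mul_le_mul_of_nonneg_right (hC _) (gauss_nonneg z))
  rwa [integral_const_mul, integral_gauss, mul_one] at this

end Gauss

variable (ι) in
/-- The symbol of the Laplacian. -/
def laplacian : SpaceSymbol ι := ∑ i, ∂ₓ i ^ 2

namespace BddEvolution

lemma exists_abs_le (u : BddEvolution ι) (t : ℝ) : ∃ C, ∀ x, |u t x| ≤ C := by
  obtain ⟨C, hC0, hC⟩ := u.exists_stripBdd t
  refine ⟨C, fun x => ?_⟩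
  rcases lt_or_ge 0 t with ht | ht
  · exact hC t ⟨ht, le_rfl⟩ x
  · rwa [u.apply_of_nonpos ht, abs_zero]

lemma integrable_gaussMean (u : BddEvolution ι) (t σ : ℝ) (x : 𝔼) :
    Integrable fun z => u t (x + σ • z) * gauss z := by
  obtain ⟨C, hC⟩ := u.exists_abs_le t
  exact integrable_mul_gauss ((u.continuous_space t).comp (by fun_prop)) fun z => hC _

lemma integrable_mul_coord_mul_gauss (u : BddEvolution ι) (t σ : ℝ) (x : 𝔼) (i : ι) :
    Integrable fun z : 𝔼 => u t (x + σ • z) * (z i * gauss z) := by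
  obtain ⟨C, hC⟩ := u.exists_abs_le t
  have hgauss : Continuous (gauss : 𝔼 → ℝ) := continuous_gauss
  have hu : Continuous (u t) := u.continuous_space t
  have hcont : Continuous fun z : 𝔼 => u t (x + σ • z) * (z i * gauss z) := by fun_prop
  refine (integrable_norm_mul_gauss.const_mul C).mono' hcont.aestronglyMeasurable
    (ae_of_all _ fun z => ?_)
  rw [norm_mul, norm_mul, Real.norm_of_nonneg (gauss_nonneg z)]
  exact mul_le_mul (hC _) (mul_le_mul_of_nonneg_right (PiLp.norm_apply_le z i) (gauss_nonneg z))
    (mul_nonneg (norm_nonneg _) (gauss_nonneg z)) ((abs_nonneg _).trans (hC x))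

lemma gaussMean_add (u v : BddEvolution ι) (t σ : ℝ) (x : 𝔼) :
    gaussMean ((u + v) t) σ x = gaussMean (u t) σ x + gaussMean (v t) σ x := by
  simp only [gaussMean, add_apply, add_mul]
  exact integral_add (u.integrable_gaussMean t σ x) (v.integrable_gaussMean t σ x)

lemma gaussMean_smul (c : ℝ) (u : BddEvolution ι) (t σ : ℝ) (x : 𝔼) :
    gaussMean ((c • u) t) σ x = c * gaussMean (u t) σ x := by
  simp only [gaussMean, smul_apply, mul_assoc]
  exact integral_const_mul _ _

lemma gaussMean_sum {κ : Type*} (s : Finset κ) (u : κ → BddEvolution ι) (t σ : ℝ) (x : 𝔼) :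
    gaussMean ((∑ k ∈ s, u k) t) σ x = ∑ k ∈ s, gaussMean (u k t) σ x := by
  simp only [gaussMean, sum_apply, Finset.sum_mul]
  exact integral_finsetSum _ fun k _ => (u k).integrable_gaussMean t σ x

lemma abs_gaussMean_sub_le {u : BddEvolution ι} {C t : ℝ} (ht : 0 < t)
    (h : ∀ x, ‖u.grad t x‖ ≤ C) (σ : ℝ) (x : 𝔼) :
    |gaussMean (u t) σ x - u t x| ≤ C * |σ| * ∫ z : 𝔼, ‖z‖ * gauss z := by
  have hsub : gaussMean (u t) σ x - u t x = ∫ z, (u t (x + σ • z) - u t x) * gauss z := by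
    simp only [sub_mul]
    rw [integral_sub (u.integrable_gaussMean t σ x) (integrable_gauss.const_mul _),
      integral_const_mul, integral_gauss, mul_one]
    rfl
  rw [hsub, ← Real.norm_eq_abs, ← integral_const_mul]
  refine norm_integral_le_of_norm_le (integrable_norm_mul_gauss.const_mul _)
    (ae_of_all _ fun z => ?_)
  rw [norm_mul, Real.norm_of_nonneg (gauss_nonneg z), ← mul_assoc]
  refine mul_le_mul_of_nonneg_right ?_ (gauss_nonneg z)
  have := convex_univ.norm_image_sub_le_of_norm_hasFDerivWithin_le (f := u t)
    (fun y _ => (u.hasFDerivAt_space ht y).hasFDerivWithinAt) (fun y _ => h y) (mem_univ x)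
    (mem_univ (x + σ • z))
  rwa [add_sub_cancel_left, norm_smul, Real.norm_eq_abs σ, ← mul_assoc] at this

lemma hasFDerivAt_gaussMean (u : BddEvolution ι) {t : ℝ} (ht : 0 < t) (σ : ℝ) (x : 𝔼) :
    HasFDerivAt (gaussMean (u t) σ) (covector fun i => gaussMean ((∂ₓ i • u) t) σ x) x := by
  obtain ⟨C, -, hC⟩ := u.exists_norm_grad_le t
  have hgrad : (fun z => gauss z • u.grad t (x + σ • z)) = fun z => ∑ i,
      ((∂ₓ i • u) t (x + σ • z) * gauss z) • (EuclideanSpace.proj i : 𝔼 →L[ℝ] ℝ) := by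
    simp only [grad, covector, Finset.smul_sum, smul_smul, mul_comm (gauss _)]
  have hint (i : ι) : Integrable fun z =>
      ((∂ₓ i • u) t (x + σ • z) * gauss z) • (EuclideanSpace.proj i : 𝔼 →L[ℝ] ℝ) :=
    (integrable_gaussMean _ _ _ _).smul_const _
  have h := hasFDerivAt_integral_of_dominated_of_fderiv_le (𝕜 := ℝ) (μ := volume)
    (F := fun y z => u t (y + σ • z) * gauss z) (F' := fun y z => gauss z • u.grad t (y + σ • z))
    (x₀ := x) (s := univ) (bound := fun z => C * gauss z) univ_mem
    (Eventually.of_forall fun y => (u.integrable_gaussMean t σ y).aestronglyMeasurable)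
    (u.integrable_gaussMean t σ x)
    (hgrad ▸ Finset.aestronglyMeasurable_fun_sum _ fun i _ => (hint i).aestronglyMeasurable)
    (ae_of_all _ fun z y _ => ?_) (integrable_gauss.const_mul C) (ae_of_all _ fun z y _ => ?_)
  · refine HasFDerivAt.congr_fderiv h ?_
    rw [hgrad, integral_finsetSum _ fun i _ => hint i]
    exact Finset.sum_congr rfl fun i _ => integral_smul_const _ _
  · rw [norm_smul, Real.norm_of_nonneg (gauss_nonneg z), mul_comm]
    exact mul_le_mul_of_nonneg_right (hC t ⟨ht, le_rfl⟩ _) (gauss_nonneg z)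
  · have htrans : HasFDerivAt (fun y : 𝔼 => y + σ • z) (ContinuousLinearMap.id ℝ 𝔼) y :=
      (hasFDerivAt_id y).add_const _
    exact ((u.hasFDerivAt_space ht _).comp y htrans).mul_const (gauss z)

lemma integral_mul_coord_mul_gauss (u : BddEvolution ι) {t : ℝ} (ht : 0 < t) (σ : ℝ) (x : 𝔼)
    (i : ι) :
    ∫ z : 𝔼, u t (x + σ • z) * (z i * gauss z) = σ * gaussMean ((∂ₓ i • u) t) σ x := by
  set e : 𝔼 := EuclideanSpace.basisFun ι ℝ i
  have hu (z : 𝔼) : HasFDerivAt (fun z => u t (x + σ • z)) (σ • u.grad t (x + σ • z)) z := by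
    have haffine : HasFDerivAt (fun z : 𝔼 => x + σ • z) (σ • ContinuousLinearMap.id ℝ 𝔼) z :=
      ((hasFDerivAt_id z).const_smul σ).const_add _
    refine ((u.hasFDerivAt_space ht _).comp z haffine).congr_fderiv ?_
    ext y
    simp
  have hfderiv_u (z : 𝔼) :
      fderiv ℝ (fun z => u t (x + σ • z)) z e = σ * (∂ₓ i • u) t (x + σ • z) := by
    rw [(hu z).fderiv, _root_.smul_apply, grad, covector_basisFun, smul_eq_mul]
  have hfderiv_gauss (z : 𝔼) : fderiv ℝ gauss z e = -(z i * gauss z) := by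
    classical
    rw [(hasFDerivAt_gauss z).fderiv]
    simp [e, EuclideanSpace.inner_single_right, mul_comm]
  have hparts := integral_mul_fderiv_eq_neg_fderiv_mul_of_integrable (μ := volume) (𝕜 := ℝ)
    (f := fun z => u t (x + σ • z)) (g := gauss) (v := e)
    (by simpa only [hfderiv_u, mul_assoc] using (integrable_gaussMean _ _ _ _).const_mul σ)
    (by
      simp only [hfderiv_gauss, mul_neg]
      exact (u.integrable_mul_coord_mul_gauss t σ x i).neg)
    (u.integrable_gaussMean t σ x)
    (fun z _ => (hu z).differentiableAt) (fun z _ => (hasFDerivAt_gauss z).differentiableAt)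
  simpa only [gaussMean, hfderiv_u, hfderiv_gauss, mul_neg, mul_assoc, integral_neg,
    integral_const_mul, neg_inj] using hparts

lemma grad_mul_gauss_eq_sum (u : BddEvolution ι) (t σ : ℝ) (x z : 𝔼) :
    u.grad t (x + σ • z) z * gauss z =
      ∑ i, (∂ₓ i • u) t (x + σ • z) * (z i * gauss z) := by
  simp only [grad, covector_apply, Finset.sum_mul, mul_assoc]

lemma integrable_grad_mul_gauss (u : BddEvolution ι) (t σ : ℝ) (x : 𝔼) :
    Integrable fun z => u.grad t (x + σ • z) z * gauss z := by
  simp only [grad_mul_gauss_eq_sum]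
  exact integrable_finsetSum _ fun i _ => integrable_mul_coord_mul_gauss _ _ _ _ i

lemma integral_grad_mul_gauss (u : BddEvolution ι) {t : ℝ} (ht : 0 < t) (σ : ℝ) (x : 𝔼) :
    ∫ z, u.grad t (x + σ • z) z * gauss z = σ * gaussMean ((laplacian ι • u) t) σ x := by
  simp only [grad_mul_gauss_eq_sum]
  rw [integral_finsetSum _ fun i _ => integrable_mul_coord_mul_gauss _ _ _ _ i, laplacian,
    Finset.sum_smul, gaussMean_sum, Finset.mul_sum]
  refine Finset.sum_congr rfl fun i _ => ?_
  rw [integral_mul_coord_mul_gauss _ ht, ← mul_smul, ← pow_two]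

lemma hasDerivAt_along_line (u : BddEvolution ι) {σ : ℝ → ℝ} {σ' t : ℝ} (ht : 0 < t)
    (hσ : HasDerivAt σ σ' t) (x z : 𝔼) :
    HasDerivAt (fun s => u s (x + σ s • z))
      ((∂ₜ • u) t (x + σ t • z) + σ' * u.grad t (x + σ t • z) z) t := by
  have hcurve : HasDerivAt (fun s => (s, x + σ s • z)) ((1, σ' • z) : ℝ × 𝔼) t :=
    (hasDerivAt_id t).prodMk ((hσ.smul_const z).const_add x)
  have h := HasFDerivAt.comp_hasDerivAt (l := fun p : ℝ × 𝔼 => u p.1 p.2) t (u.hasFDerivAt ht _)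
    hcurve
  refine h.congr_deriv ?_
  simp

lemma norm_lineDeriv_mul_gauss_le (u : BddEvolution ι) {T C₀ C₁ : ℝ}
    (hC₀ : StripBdd T C₀ (∂ₜ • u : BddEvolution ι))
    (hC₁ : ∀ t ∈ Ioc 0 T, ∀ x, ‖u.grad t x‖ ≤ C₁) {t : ℝ}
    (ht : t ∈ Ioc 0 T) {b B : ℝ} (hb : |b| ≤ B) (x z : 𝔼) :
    ‖((∂ₜ • u) t x + b * u.grad t x z) * gauss z‖ ≤
      C₀ * gauss z + B * C₁ * (‖z‖ * gauss z) := by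
  have hgrad := (u.grad t x).le_of_opNorm_le (hC₁ t ht x) z
  calc ‖((∂ₜ • u) t x + b * u.grad t x z) * gauss z‖
      = |(∂ₜ • u) t x + b * u.grad t x z| * gauss z := by
        rw [norm_mul, Real.norm_of_nonneg (gauss_nonneg z), Real.norm_eq_abs]
    _ ≤ (C₀ + B * (C₁ * ‖z‖)) * gauss z := by
        refine mul_le_mul_of_nonneg_right ((abs_add_le _ _).trans ?_) (gauss_nonneg z)
        rw [abs_mul]
        exact add_le_add (hC₀ t ht x) (mul_le_mul hb hgrad (abs_nonneg _)
          ((abs_nonneg b).trans hb))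
    _ = C₀ * gauss z + B * C₁ * (‖z‖ * gauss z) := by ring

lemma hasDerivAt_gaussMean (u : BddEvolution ι) {σ σ' : ℝ → ℝ} {t : ℝ} (ht : 0 < t)
    (hσ : ∀ᶠ s in 𝓝 t, HasDerivAt σ (σ' s) s) (hσ' : ContinuousAt σ' t) (x : 𝔼) :
    HasDerivAt (fun s => gaussMean (u s) (σ s) x)
      (gaussMean ((∂ₜ • u + (σ t * σ' t) • laplacian ι • u) t) (σ t) x) t := by
  set F' : ℝ → 𝔼 → ℝ := fun s z => ((∂ₜ • u) s (x + σ s • z) +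
    σ' s * u.grad s (x + σ s • z) z) * gauss z with hF'
  have hsplit (s : ℝ) : F' s = (fun z => (∂ₜ • u) s (x + σ s • z) * gauss z) +
      fun z => σ' s * (u.grad s (x + σ s • z) z * gauss z) := by
    funext z
    simp only [hF', add_mul, mul_assoc, Pi.add_apply]
  have hint₁ : Integrable fun z => (∂ₜ • u) t (x + σ t • z) * gauss z :=
    integrable_gaussMean _ _ _ _
  have hint₂ : Integrable fun z => σ' t * (u.grad t (x + σ t • z) z * gauss z) :=
    (u.integrable_grad_mul_gauss t (σ t) x).const_mul _
  obtain ⟨C₀, -, hC₀⟩ := (∂ₜ • u).exists_stripBdd (t + 1)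
  obtain ⟨C₁, -, hC₁⟩ := u.exists_norm_grad_le (t + 1)
  have hnear : {s | s ∈ Ioo 0 (t + 1) ∧ HasDerivAt σ (σ' s) s ∧ |σ' s| < |σ' t| + 1} ∈ 𝓝 t :=
    inter_mem (Ioo_mem_nhds ht (lt_add_one t))
      (inter_mem hσ (hσ'.abs.eventually (gt_mem_nhds (lt_add_one _))))
  have h := (hasDerivAt_integral_of_dominated_loc_of_deriv_le (μ := volume)
    (F := fun s z => u s (x + σ s • z) * gauss z) (F' := F') (x₀ := t)
    (bound := fun z => C₀ * gauss z + (|σ' t| + 1) * C₁ * (‖z‖ * gauss z)) hnear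
    (Eventually.of_forall fun s => (u.integrable_gaussMean s _ x).aestronglyMeasurable)
    (u.integrable_gaussMean t _ x) (hsplit t ▸ (hint₁.add hint₂).aestronglyMeasurable)
    (ae_of_all _ fun z s hs =>
      u.norm_lineDeriv_mul_gauss_le hC₀ hC₁ ⟨hs.1.1, hs.1.2.le⟩ hs.2.2.le _ z)
    ((integrable_gauss.const_mul _).add (integrable_norm_mul_gauss.const_mul _))
    (ae_of_all _ fun z s hs =>
      (u.hasDerivAt_along_line hs.1.1 hs.2.1 x z).mul_const (gauss z))).2
  refine h.congr_deriv ?_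
  rw [hsplit, integral_add' hint₁ hint₂, integral_const_mul, u.integral_grad_mul_gauss ht,
    gaussMean_add, gaussMean_smul, ← mul_assoc, mul_comm (σ' t)]
  rfl

lemma hasDerivAt_gaussMean_sqrt (u : BddEvolution ι) {p q t : ℝ} (ht : 0 < t)
    (hpos : 0 < p + q * t) (x : 𝔼) :
    HasDerivAt (fun s => gaussMean (u s) √(p + q * s) x)
      (gaussMean ((∂ₜ • u + (q / 2) • laplacian ι • u) t) √(p + q * t) x) t := by
  have hcont : Continuous fun s => p + q * s := by fun_prop
  have haffine (s : ℝ) : HasDerivAt (fun s => p + q * s) q s := by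
    simpa using ((hasDerivAt_id s).const_mul q).const_add p
  have hderiv : ∀ᶠ s in 𝓝 t, HasDerivAt (fun s => √(p + q * s)) (q / (2 * √(p + q * s))) s := by
    filter_upwards [hcont.continuousAt.eventually (lt_mem_nhds hpos)] with s hs
    exact (haffine s).sqrt hs.ne'
  have hcoeff : √(p + q * t) * (q / (2 * √(p + q * t))) = q / 2 := by
    have := (Real.sqrt_pos.2 hpos).ne'
    field_simp
  rw [← hcoeff]
  refine u.hasDerivAt_gaussMean ht hderiv ?_ x
  exact continuousAt_const.div (by fun_prop)
    (mul_ne_zero two_ne_zero (Real.sqrt_pos.2 hpos).ne')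

end BddEvolution

variable (ι) in
/-- The symbol of the heat equation with diffusion constant `D`. -/
def heatSymbol (D : ℝ) : Symbol ι := ∂ₜ - Polynomial.C (D • laplacian ι)

lemma heatSymbol_smul (D : ℝ) (u : BddEvolution ι) :
    heatSymbol ι D • u = ∂ₜ • u - D • laplacian ι • u := by
  rw [heatSymbol, sub_smul, Symbol.C_smul, smul_assoc]

/-- The function whose value at time `t` is obtained from `u t` by letting heat flow for the time
`t`, with diffusion constant `D`. -/
def heatFlow (D : ℝ) (u : ℝ → 𝔼 → ℝ) : ℝ → 𝔼 → ℝ := fun t x => gaussMean (u t) √(2 * D * t) x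

namespace BddEvolution

variable {D : ℝ}

lemma hasDerivAt_heatFlow (hD : 0 < D) (u : BddEvolution ι) {t : ℝ} (ht : 0 < t) (x : 𝔼) :
    HasDerivAt (fun s => heatFlow D u s x)
      (heatFlow D (∂ₜ • u + D • laplacian ι • u : BddEvolution ι) t x) t := by
  have h := u.hasDerivAt_gaussMean_sqrt (p := 0) (q := 2 * D) ht (by positivity) x
  rw [mul_div_cancel_left₀ D two_ne_zero] at h
  simpa only [heatFlow, zero_add] using h

variable (ι) in
lemma isDerivClosed_heatFlow (hD : 0 < D) :
    IsDerivClosed (range fun u : BddEvolution ι => heatFlow D u) where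
  zero := by
    rintro _ ⟨u, rfl⟩ t ht x
    simp [heatFlow, gaussMean, u.apply_of_nonpos ht]
  bdd := by
    rintro _ ⟨u, rfl⟩ T
    obtain ⟨C, -, hC⟩ := u.exists_stripBdd T
    exact ⟨C, fun t ht x => abs_gaussMean_le (hC t ht) _ x⟩
  time := by
    rintro _ ⟨u, rfl⟩
    exact ⟨_, ⟨_, rfl⟩, fun t ht x => hasDerivAt_heatFlow hD u ht x⟩
  space := by
    rintro _ ⟨u, rfl⟩
    exact ⟨_, fun i => ⟨∂ₓ i • u, rfl⟩, fun t ht x => u.hasFDerivAt_gaussMean ht _ x⟩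

/-- `heatFlow D` as an operator on bounded evolutions. -/
def heat (hD : 0 < D) : BddEvolution ι →ₗ[SpaceSymbol ι] BddEvolution ι :=
  linearMapOfSpaceDeriv
    { toFun := fun u => (isDerivClosed_heatFlow ι hD).toBddEvolution ⟨u, rfl⟩
      map_add' := fun u v => ext fun t _ x => gaussMean_add u v t _ x
      map_smul' := fun c u => ext fun t _ x => gaussMean_smul c u t _ x }
    fun i u => (spaceDeriv_smul_eq
      (v := fun i => (isDerivClosed_heatFlow ι hD).toBddEvolution ⟨∂ₓ i • u, rfl⟩)
      (fun _ ht x => u.hasFDerivAt_gaussMean ht _ x) i).symm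

lemma timeDeriv_smul_heat (hD : 0 < D) (u : BddEvolution ι) :
    ∂ₜ • heat hD u = heat hD (∂ₜ • u + D • laplacian ι • u) :=
  timeDeriv_smul_eq fun _ ht x => hasDerivAt_heatFlow hD u ht x

lemma heatSymbol_smul_heat (hD : 0 < D) (u : BddEvolution ι) :
    heatSymbol ι D • heat hD u = heat hD (∂ₜ • u) := by
  rw [heatSymbol_smul, timeDeriv_smul_heat, map_add, LinearMap.map_smul_of_tower _ D,
    (heat hD).map_smul (laplacian ι), add_sub_cancel_right]

lemma trace_heat (hD : 0 < D) (u : BddEvolution ι) : trace (heat hD u) = trace u := by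
  refine trace_eq_of_tendsto fun x => ?_
  obtain ⟨C, -, hC⟩ := u.exists_norm_grad_le 1
  have hbound : Tendsto (fun t : ℝ => C * |√(2 * D * t)| * ∫ z : 𝔼, ‖z‖ * gauss z)
      (𝓝[>] 0) (𝓝 0) := by
    have : Continuous fun t : ℝ => C * |√(2 * D * t)| * ∫ z : 𝔼, ‖z‖ * gauss z := by fun_prop
    simpa using (this.tendsto 0).mono_left nhdsWithin_le_nhds
  refine squeeze_zero_norm' ?_ hbound
  filter_upwards [Ioc_mem_nhdsGT (zero_lt_one' ℝ)] with t ht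
  exact abs_gaussMean_sub_le ht.1 (hC t ht) _ x

/-- The curve along which the maximum principle is proved: the state at time `s`, followed by heat
flow for the remaining time `t - s`. It joins `0` to `u t x` if `u` has zero initial values. -/
def heatPath (D : ℝ) (u : BddEvolution ι) (t : ℝ) (x : 𝔼) (s : ℝ) : ℝ :=
  gaussMean (u s) √(2 * D * (t - s)) x

lemma hasDerivAt_heatPath (hD : 0 < D) (u : BddEvolution ι) {s t : ℝ} (hs : 0 < s) (hst : s < t)
    (x : 𝔼) :
    HasDerivAt (heatPath D u t x) (heatPath D (heatSymbol ι D • u) t x s) s := by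
  have hwidth (s : ℝ) : 2 * D * (t - s) = 2 * D * t + -(2 * D) * s := by ring
  have hpos : 0 < 2 * D * (t - s) := mul_pos (by positivity) (sub_pos.2 hst)
  have h := u.hasDerivAt_gaussMean_sqrt hs (hwidth s ▸ hpos) x
  rw [neg_div, mul_div_cancel_left₀ D two_ne_zero, neg_smul, ← sub_eq_add_neg,
    ← heatSymbol_smul] at h
  rw [show heatPath D u t x = fun s => gaussMean (u s) √(2 * D * t + -(2 * D) * s) x from
    funext fun s => by rw [heatPath, hwidth], heatPath, hwidth]
  exact h

lemma abs_heatPath_sub_le (hD : 0 < D) {u : BddEvolution ι} {T A : ℝ}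
    (hA : StripBdd T A (heatSymbol ι D • u : BddEvolution ι)) {s₁ s₂ : ℝ} (h₁ : s₁ ∈ Ioo 0 T)
    (h₂ : s₂ ∈ Ioo 0 T) (x : 𝔼) :
    |heatPath D u T x s₂ - heatPath D u T x s₁| ≤ A * |s₂ - s₁| :=
  (convex_Ioo 0 T).norm_image_sub_le_of_norm_hasDerivWithin_le
    (fun _ hs => (hasDerivAt_heatPath hD u hs.1 hs.2 x).hasDerivWithinAt)
    (fun s hs => abs_gaussMean_le (hA s ⟨hs.1, hs.2.le⟩) _ x) h₁ h₂

lemma tendsto_heatPath_nhdsGT {u : BddEvolution ι} (hu : trace u = 0) {t : ℝ} (ht : 0 < t)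
    (x : 𝔼) : Tendsto (heatPath D u t x) (𝓝[>] 0) (𝓝 0) := by
  obtain ⟨C, hC⟩ := exists_abs_le_of_trace_eq_zero hu t
  have hbound : Tendsto (fun s : ℝ => C * s) (𝓝[>] 0) (𝓝 0) := by
    simpa using ((continuous_const_mul C).tendsto 0).mono_left nhdsWithin_le_nhds
  refine squeeze_zero_norm' ?_ hbound
  filter_upwards [Ioc_mem_nhdsGT ht] with s hs using abs_gaussMean_le (hC s hs) _ x

lemma tendsto_heatPath_nhdsLT (u : BddEvolution ι) {t : ℝ} (ht : 0 < t) (x : 𝔼) :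
    Tendsto (heatPath D u t x) (𝓝[<] t) (𝓝 (u t x)) := by
  obtain ⟨C, -, hC⟩ := u.exists_norm_grad_le t
  have hbound : Tendsto (fun s => C * |√(2 * D * (t - s))| * ∫ z : 𝔼, ‖z‖ * gauss z)
      (𝓝[<] t) (𝓝 0) := by
    have : Continuous fun s => C * |√(2 * D * (t - s))| * ∫ z : 𝔼, ‖z‖ * gauss z := by fun_prop
    simpa using (this.tendsto t).mono_left nhdsWithin_le_nhds
  have hdiff : Tendsto (fun s => heatPath D u t x s - u s x) (𝓝[<] t) (𝓝 0) := by
    refine squeeze_zero_norm' ?_ hbound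
    filter_upwards [Ioo_mem_nhdsLT ht] with s hs
    exact abs_gaussMean_sub_le hs.1 (hC s ⟨hs.1, hs.2.le⟩) _ x
  have hu : Tendsto (fun s => u s x) (𝓝[<] t) (𝓝 (u t x)) :=
    (u.hasDerivAt_time ht x).continuousAt.tendsto.mono_left nhdsWithin_le_nhds
  simpa using hdiff.add hu

lemma abs_le_of_stripBdd_heatSymbol_smul (hD : 0 < D) {u : BddEvolution ι} (hu : trace u = 0)
    {T A : ℝ} (hA : StripBdd T A (heatSymbol ι D • u : BddEvolution ι)) {t : ℝ} (ht : t ∈ Ioc 0 T)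
    (x : 𝔼) : |u t x| ≤ A * t := by
  have hA' : StripBdd t A (heatSymbol ι D • u : BddEvolution ι) := hA.mono_time ht.2
  have hpath : ∀ s₂ ∈ Ioo 0 t, |heatPath D u t x s₂| ≤ A * s₂ := fun s₂ hs₂ => by
    have hleft : Tendsto (fun s₁ => |heatPath D u t x s₂ - heatPath D u t x s₁|) (𝓝[>] 0)
        (𝓝 |heatPath D u t x s₂|) := by
      simpa using ((tendsto_heatPath_nhdsGT hu ht.1 x).const_sub (heatPath D u t x s₂)).abs
    have hright : Tendsto (fun s₁ => A * |s₂ - s₁|) (𝓝[>] 0) (𝓝 (A * s₂)) := by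
      have : Continuous fun s₁ => A * |s₂ - s₁| := by fun_prop
      simpa [abs_of_pos hs₂.1] using (this.tendsto 0).mono_left nhdsWithin_le_nhds
    refine le_of_tendsto_of_tendsto hleft hright ?_
    filter_upwards [Ioo_mem_nhdsGT ht.1] with s₁ hs₁ using abs_heatPath_sub_le hD hA' hs₁ hs₂ x
  have hlin : Tendsto (fun s => A * s) (𝓝[<] t) (𝓝 (A * t)) :=
    ((continuous_const_mul A).tendsto t).mono_left nhdsWithin_le_nhds
  refine le_of_tendsto_of_tendsto (tendsto_heatPath_nhdsLT (D := D) u ht.1 x).abs hlin ?_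
  filter_upwards [Ioo_mem_nhdsLT ht.1] with s hs using hpath s hs

end BddEvolution

/-- The monomial of order `α` in the space derivatives. -/
def spaceMonomial (α : ι → ℕ) : SpaceSymbol ι := ∏ i, ∂ₓ i ^ α i

/-- The symbol of the mixed derivative of order `m` in time and `α` in space. -/
def symbolMonomial (m : ℕ) (α : ι → ℕ) : Symbol ι := ∂ₜ ^ m * Polynomial.C (spaceMonomial α)

lemma Symbol.induction_monomial {p : Symbol ι → Prop} (add : ∀ P Q, p P → p Q → p (P + Q))
    (monomial : ∀ (c : ℝ) m α, p (c • symbolMonomial m α)) (P : Symbol ι) : p P := by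
  induction P using Polynomial.induction_on' with
  | add P Q hP hQ => exact add _ _ hP hQ
  | monomial m q =>
    induction q using MvPolynomial.induction_on' with
    | add q r hq hr => exact map_add (Polynomial.monomial m) q r ▸ add _ _ hq hr
    | monomial s c =>
      have h : Polynomial.monomial m (MvPolynomial.monomial s c) = c • symbolMonomial m s := by
        rw [MvPolynomial.monomial_eq, ← MvPolynomial.smul_eq_C_mul, ← Polynomial.smul_monomial,
          Finsupp.prod_fintype _ _ fun _ => pow_zero _, symbolMonomial, spaceMonomial, mul_comm,
          Polynomial.C_mul_X_pow_eq_monomial]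
      exact h ▸ monomial c m s

lemma mem_bddEvolutions_of_symbolMonomial {u : Evolution ι}
    (h : ∀ T m (α : ι → ℕ), ∃ C, StripBdd T C (symbolMonomial m α • u : Evolution ι)) :
    u ∈ bddEvolutions ι := by
  intro P T
  induction P using Symbol.induction_monomial with
  | add P Q hP hQ =>
    obtain ⟨C, hC⟩ := hP
    obtain ⟨C', hC'⟩ := hQ
    exact ⟨C + C', by rw [add_smul]; exact hC.add hC'⟩
  | monomial c m α =>
    obtain ⟨C, hC⟩ := h T m α
    exact ⟨_, by rw [smul_assoc]; exact hC.smul c⟩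

/-- Equality of two functions of time and space for `t > 0`. -/
def EqForPos {X : Type*} (u v : ℝ → X → ℝ) : Prop := ∀ t > 0, ∀ x, u t x = v t x

namespace EqForPos

lemma stripBdd_iff {X : Type*} {u v : ℝ → X → ℝ} (h : EqForPos u v) {T C : ℝ} :
    StripBdd T C u ↔ StripBdd T C v :=
  forall₂_congr fun t ht => forall_congr' fun x => by rw [h t ht.1 x]

lemma add {X : Type*} {u u' v v' : ℝ → X → ℝ} (h : EqForPos u v) (h' : EqForPos u' v') :
    EqForPos (u + u') (v + v') :=
  fun t ht x => congrArg₂ (· + ·) (h t ht x) (h' t ht x)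

lemma sub {X : Type*} {u u' v v' : ℝ → X → ℝ} (h : EqForPos u v) (h' : EqForPos u' v') :
    EqForPos (u - u') (v - v') :=
  fun t ht x => congrArg₂ (· - ·) (h t ht x) (h' t ht x)

lemma smul {X : Type*} {u v : ℝ → X → ℝ} (h : EqForPos u v) (c : ℝ) :
    EqForPos (c • u) (c • v) :=
  fun t ht x => congrArg (c * ·) (h t ht x)

lemma sum {κ : Type*} {s : Finset κ} {u : κ → ℝ → 𝔼 → ℝ} {v : κ → Evolution ι}
    (h : ∀ k ∈ s, EqForPos (u k) (v k)) :
    EqForPos (∑ k ∈ s, u k) (∑ k ∈ s, v k : Evolution ι) := by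
  induction s using Finset.cons_induction with
  | empty => exact fun _ _ _ => rfl
  | cons k s hk ih =>
    rw [Finset.sum_cons, Finset.sum_cons]
    exact (h k (Finset.mem_cons_self k s)).add (ih fun j hj => h j (Finset.mem_cons_of_mem hj))

lemma sum_bddEvolution {κ : Type*} {s : Finset κ} {u : κ → ℝ → 𝔼 → ℝ} {v : κ → BddEvolution ι}
    (h : ∀ k ∈ s, EqForPos (u k) (v k)) :
    EqForPos (∑ k ∈ s, u k) (∑ k ∈ s, v k : BddEvolution ι) := by
  have hcoe : (∑ k ∈ s, v k : BddEvolution ι).1 = ∑ k ∈ s, (v k).1 :=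
    map_sum (bddEvolutions ι).subtype v s
  rw [hcoe]
  exact sum h

lemma bddEvolution_unique {u : ℝ → 𝔼 → ℝ} {v w : BddEvolution ι} (hv : EqForPos u v)
    (hw : EqForPos u w) : v = w :=
  BddEvolution.ext fun t ht x => (hv t ht x).symm.trans (hw t ht x)

end EqForPos

namespace BddEvolution

lemma exists_abs_sub_trace_le (u : BddEvolution ι) (T : ℝ) :
    ∃ C, ∀ t ∈ Ioc 0 T, ∀ x, |u t x - trace u t x| ≤ C * t :=
  exists_abs_le_of_trace_eq_zero (u := u - trace u)
    (by rw [map_sub, trace_of_timeDeriv_smul_eq_zero (timeDeriv_smul_trace u), sub_self]) T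

/-- The function that agrees with `u` for `t > 0` and with `φ` for `t ≤ 0`. -/
def extend (u : BddEvolution ι) (φ : 𝔼 → ℝ) : ℝ → 𝔼 → ℝ := fun t x => if 0 < t then u t x else φ x

lemma eqForPos_extend (u : BddEvolution ι) (φ : 𝔼 → ℝ) : EqForPos (u.extend φ) u :=
  fun _ ht _ => if_pos ht

lemma extend_zero (u : BddEvolution ι) (φ : 𝔼 → ℝ) (x : 𝔼) : u.extend φ 0 x = φ x :=
  if_neg (lt_irrefl _)

lemma tendsto_extend_sub {u : BddEvolution ι} {φ : 𝔼 → ℝ} (h : EqForPos (fun _ => φ) (trace u))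
    (x : 𝔼) : Tendsto (fun p : ℝ × 𝔼 => u.extend φ p.1 p.2 - φ p.2)
      (𝓝[Ici 0 ×ˢ univ] (0, x)) (𝓝 0) := by
  obtain ⟨C, hC⟩ := u.exists_abs_sub_trace_le 1
  have hbound : Tendsto (fun p : ℝ × 𝔼 => C * p.1) (𝓝[Ici 0 ×ˢ univ] (0, x)) (𝓝 0) := by
    have : Continuous fun p : ℝ × 𝔼 => C * p.1 := by fun_prop
    simpa using (this.tendsto (0, x)).mono_left nhdsWithin_le_nhds
  refine squeeze_zero_norm' ?_ hbound
  have hlt : ∀ᶠ p : ℝ × 𝔼 in 𝓝[Ici 0 ×ˢ univ] (0, x), p.1 < 1 :=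
    nhdsWithin_le_nhds ((continuous_fst.tendsto (0, x)).eventually_lt_const one_pos)
  filter_upwards [hlt, self_mem_nhdsWithin] with p hp hp'
  rcases (show 0 ≤ p.1 from hp'.1).eq_or_lt with h0 | h0
  · rw [← h0, extend_zero, sub_self, norm_zero, mul_zero]
  · rw [u.eqForPos_extend φ _ h0, show φ p.2 = _ from h p.1 h0 p.2]
    exact hC p.1 ⟨h0, hp.le⟩ p.2

lemma continuousOn_extend {u : BddEvolution ι} {φ : 𝔼 → ℝ}
    (h : EqForPos (fun _ => φ) (trace u)) :
    ContinuousOn (fun p : ℝ × 𝔼 => u.extend φ p.1 p.2) (Ici 0 ×ˢ univ) := by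
  rintro ⟨t, x⟩ hp
  rcases (show 0 ≤ t from hp.1).eq_or_lt with rfl | ht
  · have hφ : Continuous φ := by
      rw [show φ = trace u 1 from funext fun x => h 1 one_pos x]
      exact continuous_space _ _
    have hdata : Tendsto (fun p : ℝ × 𝔼 => φ p.2) (𝓝[Ici 0 ×ˢ univ] (0, x)) (𝓝 (φ x)) :=
      ((hφ.comp continuous_snd).tendsto (0, x)).mono_left nhdsWithin_le_nhds
    simpa [ContinuousWithinAt, extend_zero] using (tendsto_extend_sub h x).add hdata
  · refine ContinuousAt.continuousWithinAt ((u.continuousAt ht x).congr ?_)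
    filter_upwards [Ioi_prod_univ_mem_nhds ht x] with p hp
    exact (u.eqForPos_extend φ _ hp.1 _).symm

lemma eqForPos_trace_of_continuousOn {u : ℝ → 𝔼 → ℝ} {v : BddEvolution ι}
    (hu : ContinuousOn (fun p : ℝ × 𝔼 => u p.1 p.2) (Ici 0 ×ˢ univ)) (h : EqForPos u v) :
    EqForPos (fun _ => u 0) (trace v) := by
  intro t ht x
  refine tendsto_nhds_unique ?_ (tendsto_trace v x ht)
  have hcont : ContinuousWithinAt (fun s => u s x) (Ici 0) 0 :=
    (hu (0, x) ⟨self_mem_Ici, mem_univ x⟩).comp (f := fun s : ℝ => (s, x))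
      (by fun_prop) fun s hs => ⟨hs, mem_univ x⟩
  refine (hcont.tendsto.mono_left (nhdsWithin_mono _ Ioi_subset_Ici_self)).congr' ?_
  filter_upwards [self_mem_nhdsWithin] with s hs using h s hs x

end BddEvolution

/-- The `n`-th partial sum of the expansion `a 0 + ε² a 1 + ε⁴ a 2 + …`. -/
def partialSum {M : Type*} [AddCommMonoid M] [Module ℝ M] (a : ℕ → M) (n : ℕ) (ε : ℝ) : M :=
  ∑ k ∈ Finset.range n, ε ^ (2 * k) • a k

section Dim3

open Polynomial

/-- The symbol of `lap2`. -/
def lap2Symbol : SpaceSymbol (Fin 3) :=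
  MvPolynomial.X 0 ^ 2 * MvPolynomial.X 1 ^ 2 + MvPolynomial.X 1 ^ 2 * MvPolynomial.X 2 ^ 2 +
    MvPolynomial.X 0 ^ 2 * MvPolynomial.X 2 ^ 2

/-- The symbol of `lap3`. -/
def lap3Symbol : SpaceSymbol (Fin 3) :=
  MvPolynomial.X 0 ^ 2 * MvPolynomial.X 1 ^ 2 * MvPolynomial.X 2 ^ 2

/-- The symbols of the coefficients of `1, ε², ε⁴, …` in the regularized equation: the heat
operator, followed by the operators `corr`. -/
def regCoeff : ℕ → Symbol (Fin 3)
  | 0 => heatSymbol (Fin 3) (5 / 18)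
  | 1 => (25 / 6 : ℝ) • (X ^ 2 - (1 / 3 : ℝ) • (C (laplacian (Fin 3)) * X)
      + (5 / 54 : ℝ) • C lap2Symbol)
  | 2 => (125 / 18 : ℝ) • (X ^ 3 - (1 / 3 : ℝ) • (C (laplacian (Fin 3)) * X ^ 2)
      + (25 / 216 : ℝ) • (C lap2Symbol * X) - (25 / 432 : ℝ) • C lap3Symbol)
  | 3 => (625 / 108 : ℝ) • (X ^ 4 - (5 / 18 : ℝ) • (C (laplacian (Fin 3)) * X ^ 3)
      + (5 / 72 : ℝ) • (C lap2Symbol * X ^ 2))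
  | 4 => (3125 / 1296 : ℝ) • (X ^ 5 - (1 / 6 : ℝ) • (C (laplacian (Fin 3)) * X ^ 4))
  | 5 => (3125 / 7776 : ℝ) • X ^ 6
  | _ => 0

lemma regCoeff_of_six_le : ∀ {j : ℕ}, 6 ≤ j → regCoeff j = 0
  | _ + 6, _ => rfl

lemma iterate_pd (i : Fin 3) (n : ℕ) (u : ℝ → Space → ℝ) :
    (fun t => (pd i)^[n] (u t)) = (dx i)^[n] u := by
  induction n with
  | zero => rfl
  | succ n ih =>
    rw [Function.iterate_succ_apply', ← ih]
    funext t
    rw [Function.iterate_succ_apply']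
    rfl

lemma pdMulti_eq_iterate_dx (α : Fin 3 → ℕ) (u : ℝ → Space → ℝ) :
    (fun t => pdMulti α (u t)) = (dx 0)^[α 0] ((dx 1)^[α 1] ((dx 2)^[α 2] u)) := by
  simp only [← iterate_pd]
  rfl

namespace EqForPos

variable {u : ℝ → Space → ℝ} {v : Evolution (Fin 3)}

lemma dt (h : EqForPos u v) :
    EqForPos (dt u) ((X : Symbol (Fin 3)) • v : Evolution (Fin 3)) := fun t ht x => by
  rw [← (v.hasDerivAt_time ht x).deriv]
  refine Filter.EventuallyEq.deriv_eq ?_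
  filter_upwards [lt_mem_nhds ht] with s hs using h s hs x

lemma dx (h : EqForPos u v) (i : Fin 3) :
    EqForPos (dx i u) ((MvPolynomial.X i : SpaceSymbol (Fin 3)) • v : Evolution (Fin 3)) :=
  fun t ht x => by
  rw [RandomMotion.dx, pd, funext (h t ht), ← EuclideanSpace.basisFun_apply,
    ((v.hasFDerivAt_space ht x).hasLineDerivAt _).lineDeriv, covector_basisFun]

lemma iterate_dt (h : EqForPos u v) (n : ℕ) :
    EqForPos (RandomMotion.dt^[n] u) ((X ^ n : Symbol (Fin 3)) • v : Evolution (Fin 3)) := by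
  induction n with
  | zero => simpa using h
  | succ n ih => rw [Function.iterate_succ_apply', pow_succ', mul_smul]; exact ih.dt

lemma iterate_dx (h : EqForPos u v) (i : Fin 3) (n : ℕ) :
    EqForPos ((RandomMotion.dx i)^[n] u)
      ((MvPolynomial.X i ^ n : SpaceSymbol (Fin 3)) • v : Evolution (Fin 3)) := by
  induction n with
  | zero => simpa using h
  | succ n ih => rw [Function.iterate_succ_apply', pow_succ', mul_smul]; exact ih.dx i

lemma mixedDeriv (h : EqForPos u v) (m : ℕ) (α : Fin 3 → ℕ) :
    EqForPos (mixedDeriv m α u) (symbolMonomial m α • v : Evolution (Fin 3)) := by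
  rw [RandomMotion.mixedDeriv, pdMulti_eq_iterate_dx, symbolMonomial, mul_smul, Symbol.C_smul,
    spaceMonomial, Fin.prod_univ_three, mul_smul, mul_smul]
  exact (((h.iterate_dx _ _).iterate_dx _ _).iterate_dx _ _).iterate_dt _

lemma lap (h : EqForPos u v) : EqForPos (lap u) (laplacian (Fin 3) • v : Evolution (Fin 3)) := by
  rw [laplacian, Fin.sum_univ_three]
  simp only [add_smul, pow_two, mul_smul]
  exact (((h.dx _).dx _).add ((h.dx _).dx _)).add ((h.dx _).dx _)

lemma lap2 (h : EqForPos u v) : EqForPos (lap2 u) (lap2Symbol • v : Evolution (Fin 3)) := by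
  simp only [lap2Symbol, add_smul, pow_two, mul_smul]
  exact (((((h.dx _).dx _).dx _).dx _).add ((((h.dx _).dx _).dx _).dx _)).add
    ((((h.dx _).dx _).dx _).dx _)

lemma lap3 (h : EqForPos u v) : EqForPos (lap3 u) (lap3Symbol • v : Evolution (Fin 3)) := by
  simp only [lap3Symbol, pow_two, mul_smul]
  exact (((((h.dx _).dx _).dx _).dx _).dx _).dx _

lemma corr (h : EqForPos u v) {j : ℕ} (hj : 1 ≤ j) :
    EqForPos (corr j u) (regCoeff j • v : Evolution (Fin 3)) := by
  match j with
  | 1 =>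
    simp only [regCoeff, smul_assoc, add_smul, sub_smul, mul_smul, Symbol.C_smul]
    exact (((h.iterate_dt 2).sub (h.dt.lap.smul _)).add (h.lap2.smul _)).smul _
  | 2 =>
    simp only [regCoeff, smul_assoc, add_smul, sub_smul, mul_smul, Symbol.C_smul]
    exact ((((h.iterate_dt 3).sub ((h.iterate_dt 2).lap.smul _)).add (h.dt.lap2.smul _)).sub
      (h.lap3.smul _)).smul _
  | 3 =>
    simp only [regCoeff, smul_assoc, add_smul, sub_smul, mul_smul, Symbol.C_smul]
    exact (((h.iterate_dt 4).sub ((h.iterate_dt 3).lap.smul _)).add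
      ((h.iterate_dt 2).lap2.smul _)).smul _
  | 4 =>
    simp only [regCoeff, smul_assoc, sub_smul, mul_smul, Symbol.C_smul]
    exact ((h.iterate_dt 5).sub ((h.iterate_dt 4).lap.smul _)).smul _
  | 5 =>
    simp only [regCoeff, smul_assoc]
    exact (h.iterate_dt 6).smul _
  | n + 6 =>
    rw [regCoeff_of_six_le (by lia), zero_smul]
    exact fun _ _ _ => rfl

lemma heat (h : EqForPos u v) : EqForPos (RandomMotion.dt u - (5 / 18 : ℝ) • RandomMotion.lap u)
    (regCoeff 0 • v : Evolution (Fin 3)) := by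
  rw [regCoeff, heatSymbol, sub_smul, Symbol.C_smul, smul_assoc]
  exact h.dt.sub (h.lap.smul _)

lemma regOp (h : EqForPos u v) (ε : ℝ) :
    EqForPos (regOp ε u) (partialSum regCoeff 6 ε • v : Evolution (Fin 3)) := by
  have hcorr : EqForPos (∑ j ∈ Finset.Icc 1 5, ε ^ (2 * j) • RandomMotion.corr j u)
      (∑ j ∈ Finset.Icc 1 5, ε ^ (2 * j) • regCoeff j • v : Evolution (Fin 3)) :=
    .sum fun j hj => (h.corr (Finset.mem_Icc.1 hj).1).smul _
  rw [partialSum, Finset.range_eq_Ico, Finset.sum_eq_sum_Ico_succ_bot (by lia), mul_zero, pow_zero,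
    one_smul, add_smul, Finset.sum_smul]
  simp only [smul_assoc]
  exact h.heat.add hcorr

end EqForPos

lemma mixedDeriv_succ_const (m : ℕ) (α : Fin 3 → ℕ) (φ : Space → ℝ) :
    mixedDeriv (m + 1) α (fun _ => φ) = 0 := by
  have hconst (ψ : Space → ℝ) : dt (fun _ => ψ) = 0 := by
    funext t x
    exact deriv_const t (ψ x)
  rw [mixedDeriv, Function.iterate_succ_apply, hconst]
  exact Function.iterate_fixed (hconst 0) m

lemma SmoothBddData.smoothBdd_const {φ : Space → ℝ} (hφ : SmoothBddData φ) :
    SmoothBdd fun _ => φ where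
  continuousOn := (hφ.1.continuous.comp continuous_snd).continuousOn
  contDiffOn := (hφ.1.comp contDiff_snd).contDiffOn
  bounded _ m α := by
    cases m with
    | zero =>
      obtain ⟨C, hC⟩ := hφ.2 α
      exact ⟨C, fun t _ x => hC x⟩
    | succ m => exact ⟨0, fun t _ x => by simp [mixedDeriv_succ_const]⟩

lemma SmoothBdd.exists_eqForPos {u : ℝ → Space → ℝ} (hu : SmoothBdd u) :
    ∃ v : BddEvolution (Fin 3), EqForPos u v := by
  have h : EqForPos u (Evolution.ofContDiffOn u hu.contDiffOn) :=
    fun t ht x => (Evolution.ofContDiffOn_apply _ ht x).symm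
  refine ⟨⟨_, mem_bddEvolutions_of_symbolMonomial fun T m α => ?_⟩, h⟩
  obtain ⟨C, hC⟩ := hu.bounded T m α
  exact ⟨C, (h.mixedDeriv m α).stripBdd_iff.1 hC⟩

lemma smoothBdd_extend {v : BddEvolution (Fin 3)} {φ : Space → ℝ}
    (h : EqForPos (fun _ => φ) (BddEvolution.trace v)) : SmoothBdd (v.extend φ) where
  continuousOn := BddEvolution.continuousOn_extend h
  contDiffOn := v.contDiffOn.congr fun _ hp => v.eqForPos_extend φ _ hp.1 _
  bounded T m α := by
    obtain ⟨C, -, hC⟩ := (symbolMonomial m α • v).exists_stripBdd T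
    exact ⟨C, (EqForPos.mixedDeriv (v := v.1) (v.eqForPos_extend φ) m α).stripBdd_iff.2 hC⟩

lemma timeDeriv_smul_of_eqForPos_const {φ : Space → ℝ} {v : BddEvolution (Fin 3)}
    (h : EqForPos (fun _ => φ) v) : (X : Symbol (Fin 3)) • v = 0 :=
  BddEvolution.ext fun t ht x =>
    (EqForPos.dt (v := v.1) h t ht x).symm.trans (deriv_const t (φ x))

end Dim3

section Series

variable {κ : Type*}

/-- The families of bounded evolutions that lie in `S` together with all their derivatives. -/
def withDerivs (S : Submodule ℝ (κ → BddEvolution ι)) :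
    Submodule (Symbol ι) (κ → BddEvolution ι) where
  carrier := {v | ∀ P : Symbol ι, P • v ∈ S}
  add_mem' := fun {v w} hv hw P => smul_add P v w ▸ add_mem (hv P) (hw P)
  zero_mem' := fun P => (smul_zero P : P • (0 : κ → BddEvolution ι) = 0).symm ▸ zero_mem _
  smul_mem' := fun Q v hv P => mul_smul P Q v ▸ hv (P * Q)

/-- The families of bounded evolutions that are bounded on every strip by summable constants. -/
def summableBdd (κ ι : Type*) [Fintype ι] : Submodule ℝ (κ → BddEvolution ι) where
  carrier := {v | ∀ T, ∃ M : κ → ℝ, Summable M ∧ ∀ n, StripBdd T (M n) (v n)}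
  add_mem' := fun {v w} hv hw T => by
    obtain ⟨M, hM, h⟩ := hv T
    obtain ⟨M', hM', h'⟩ := hw T
    exact ⟨_, hM.add hM', fun n => (h n).add (h' n)⟩
  zero_mem' := fun _ => ⟨0, summable_zero, fun _ => StripBdd.zero le_rfl⟩
  smul_mem' := fun r v hv T => by
    obtain ⟨M, hM, h⟩ := hv T
    exact ⟨_, hM.mul_left |r|, fun n => (h n).smul r⟩

lemma mem_summableBdd_of_succ {v : ℕ → BddEvolution ι}
    (h : (fun n => v (n + 1)) ∈ summableBdd ℕ ι) : v ∈ summableBdd ℕ ι := fun T => by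
  obtain ⟨M, hM, hb⟩ := h T
  obtain ⟨C, -, hC⟩ := (v 0).exists_stripBdd T
  refine ⟨fun n => Nat.casesOn n C M, (summable_nat_add_iff 1).1 hM, fun n => ?_⟩
  cases n with
  | zero => exact hC
  | succ n => exact hb n

lemma summable_of_mem_summableBdd {v : κ → BddEvolution ι} (h : v ∈ summableBdd κ ι) (t : ℝ)
    (x : 𝔼) : Summable fun n => v n t x := by
  rcases le_or_gt t 0 with ht | ht
  · simp [(v _).apply_of_nonpos ht, summable_zero]
  · obtain ⟨M, hM, hb⟩ := h t
    exact hM.of_norm_bounded fun n => hb n t ⟨ht, le_rfl⟩ x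

/-- The families of bounded evolutions that can be summed and differentiated term by term. -/
def summableFamilies (κ ι : Type*) [Fintype ι] : Submodule (Symbol ι) (κ → BddEvolution ι) :=
  withDerivs (summableBdd κ ι)

namespace summableFamilies

lemma coe_mem_summableBdd (v : summableFamilies κ ι) : (v : κ → BddEvolution ι) ∈ summableBdd κ ι :=
  one_smul (Symbol ι) (v : κ → BddEvolution ι) ▸ v.property 1

lemma summable (v : summableFamilies κ ι) (t : ℝ) (x : 𝔼) : Summable fun n => v.1 n t x :=
  summable_of_mem_summableBdd (coe_mem_summableBdd v) t x

lemma hasDerivAt_tsum (v : summableFamilies κ ι) {t : ℝ} (ht : 0 < t) (x : 𝔼) :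
    HasDerivAt (fun s => ∑' n, v.1 n s x) (∑' n, (∂ₜ • v).1 n t x) t := by
  obtain ⟨M, hM, hb⟩ := coe_mem_summableBdd (∂ₜ • v) (t + 1)
  exact hasDerivAt_tsum_of_isPreconnected (t := Ioo 0 (t + 1)) hM isOpen_Ioo isPreconnected_Ioo
    (fun n s hs => (v.1 n).hasDerivAt_time hs.1 x) (fun n s hs => hb n s ⟨hs.1, hs.2.le⟩ x)
    ⟨ht, lt_add_one t⟩ (summable v t x) ⟨ht, lt_add_one t⟩

lemma hasFDerivAt_tsum (v : summableFamilies κ ι) {t : ℝ} (ht : 0 < t) (x : 𝔼) :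
    HasFDerivAt (fun y => ∑' n, v.1 n t y)
      (covector fun i => ∑' n, (Polynomial.C (∂ₓ i) • v).1 n t x) x := by
  have hv (n : κ) (i : ι) : (Polynomial.C (∂ₓ i) • v).1 n = ∂ₓ i • v.1 n :=
    Symbol.C_smul (∂ₓ i) (v.1 n)
  choose M hM hb using fun i => coe_mem_summableBdd (Polynomial.C (∂ₓ i) • v) t
  have hsum := _root_.hasFDerivAt_tsum (f := fun n => v.1 n t) (f' := fun n => (v.1 n).grad t)
    (summable_sum fun i _ => hM i) (fun n y => (v.1 n).hasFDerivAt_space ht y)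
    (fun n y => (norm_covector_le _).trans (Finset.sum_le_sum fun i _ => by
      have := hb i n t ⟨ht, le_rfl⟩ y
      rwa [hv] at this))
    (summable v t 0) x
  refine hsum.congr_fderiv ?_
  simp only [BddEvolution.grad, covector, ← hv]
  rw [Summable.tsum_finsetSum fun i _ =>
    (summable (Polynomial.C (∂ₓ i) • v) t x).smul_const _]
  exact Finset.sum_congr rfl fun i _ =>
    (summable (Polynomial.C (∂ₓ i) • v) t x).tsum_smul_const _

variable (κ ι) in
lemma isDerivClosed_tsum : IsDerivClosed
    (range fun (v : summableFamilies κ ι) (t : ℝ) (x : 𝔼) => ∑' n, v.1 n t x) where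
  zero := by
    rintro _ ⟨v, rfl⟩ t ht x
    simp [BddEvolution.apply_of_nonpos _ ht]
  bdd := by
    rintro _ ⟨v, rfl⟩ T
    obtain ⟨M, hM, hb⟩ := coe_mem_summableBdd v T
    exact ⟨∑' n, M n, fun t ht x =>
      tsum_of_norm_bounded (f := fun n => v.1 n t x) hM.hasSum fun n => hb n t ht x⟩
  time := by
    rintro _ ⟨v, rfl⟩
    exact ⟨_, ⟨∂ₜ • v, rfl⟩, fun t ht x => hasDerivAt_tsum v ht x⟩
  space := by
    rintro _ ⟨v, rfl⟩
    exact ⟨_, fun i => ⟨Polynomial.C (∂ₓ i) • v, rfl⟩, fun t ht x => hasFDerivAt_tsum v ht x⟩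

/-- The sum of a family of bounded evolutions that can be differentiated term by term. -/
def series (v : summableFamilies κ ι) : BddEvolution ι :=
  (isDerivClosed_tsum ι κ).toBddEvolution ⟨v, rfl⟩

lemma series_apply (v : summableFamilies κ ι) (t : ℝ) (x : 𝔼) :
    series v t x = ∑' n, v.1 n t x := rfl

lemma hasSum_series (v : summableFamilies κ ι) (t : ℝ) (x : 𝔼) :
    HasSum (fun n => v.1 n t x) (series v t x) := (summable v t x).hasSum

lemma smul_series (P : Symbol ι) : ∀ v : summableFamilies κ ι,
    P • series v = series (P • v) := by
  induction P using Symbol.induction_mul with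
  | const c =>
    intro v
    refine BddEvolution.ext fun t _ x => ?_
    rw [smul_assoc, one_smul, smul_assoc, one_smul]
    exact tsum_mul_left.symm
  | add P Q hP hQ =>
    intro v
    refine BddEvolution.ext fun t _ x => ?_
    rw [add_smul, add_smul, hP, hQ]
    exact ((summable (P • v) t x).tsum_add (summable (Q • v) t x)).symm
  | mul_time P hP =>
    intro v
    rw [mul_smul, mul_smul, ← hP]
    exact congrArg _ (BddEvolution.timeDeriv_smul_eq fun t ht x => hasDerivAt_tsum v ht x)
  | mul_space P i hP =>
    intro v
    rw [mul_smul, mul_smul, ← hP, Symbol.C_smul]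
    exact congrArg _ (BddEvolution.spaceDeriv_smul_eq
      (v := fun i => series (Polynomial.C (∂ₓ i) • v))
      (fun t ht x => hasFDerivAt_tsum v ht x) i)

lemma exists_stripBdd_series_sub (v : summableFamilies ℕ ι) (T : ℝ) :
    ∃ B : ℕ → ℝ, Tendsto B atTop (𝓝 0) ∧
      ∀ N, StripBdd T (B N) (series v - ∑ n ∈ Finset.range N, v.1 n) := by
  obtain ⟨M, hM, hb⟩ := coe_mem_summableBdd v T
  refine ⟨fun N => ∑' n, M (n + N), tendsto_sum_nat_add M, fun N t ht x => ?_⟩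
  have htail : (series v - ∑ n ∈ Finset.range N, v.1 n) t x = ∑' n, v.1 (n + N) t x := by
    rw [BddEvolution.sub_apply, BddEvolution.sum_apply, series_apply, sub_eq_iff_eq_add',
      (summable v t x).sum_add_tsum_nat_add]
  rw [htail]
  exact tsum_of_norm_bounded (f := fun n => v.1 (n + N) t x)
    ((summable_nat_add_iff N).2 hM).hasSum fun n => hb (n + N) t ht x

end summableFamilies

end Series

/-- A space of families of bounded evolutions, with bounds on the evolutions but not on their
derivatives, that is stable under multiplication by the rates `a` and the velocities `w` and under
the solution operators of the transport equations with these rates and velocities. -/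
structure IsTransportStable {κ : Type*} (a : κ → ℝ) (w : κ → 𝔼)
    (S : Submodule ℝ (κ → BddEvolution ι)) : Prop where
  rate : ∀ v ∈ S, (fun k => a k • v k) ∈ S
  velocity : ∀ i, ∀ v ∈ S, (fun k => w k i • v k) ∈ S
  inv : ∀ v ∈ S, (fun k => BddEvolution.transportInv (a k) (w k) (v k)) ∈ S

namespace BddEvolution

lemma smul_transportInv (a : ℝ) (w : 𝔼) (P : Symbol ι) (u : BddEvolution ι) :
    P • transportInv a w u = P.divX • u -
      ∑ i, w i • (P.divX * Polynomial.C (∂ₓ i)) • transportInv a w u -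
      a • P.divX • transportInv a w u + transportInv a w (P.coeff 0 • u) := by
  have htime : ∂ₜ • transportInv a w u =
      u - spaceDirDeriv w • transportInv a w u - a • transportInv a w u := by
    conv_rhs => enter [1, 1]; rw [← transport_smul_transportInv a w u]
    rw [transport_smul]
    abel
  have hdir : P.divX • spaceDirDeriv w • transportInv a w u =
      ∑ i, w i • (P.divX * Polynomial.C (∂ₓ i)) • transportInv a w u := by
    simp only [spaceDirDeriv, Finset.sum_smul, Finset.smul_sum, mul_smul, Symbol.C_smul,
      smul_assoc, smul_comm P.divX]
  conv_lhs => rw [← P.divX_mul_X_add]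
  rw [add_smul, mul_smul, htime, smul_sub, smul_sub, hdir, Symbol.C_smul,
    ← (transportInv a w).map_smul, smul_comm P.divX a]

end BddEvolution

namespace IsTransportStable

variable {κ : Type*} {a : κ → ℝ} {w : κ → EuclideanSpace ℝ ι}
  {S : Submodule ℝ (κ → BddEvolution ι)} {v : κ → BddEvolution ι}

lemma smul_transportInv_mem_of_natDegree_le (h : IsTransportStable a w S) {m : ℕ}
    (hv : ∀ P : Symbol ι, P.natDegree ≤ m → P • v ∈ S) {n : ℕ} (hn : n ≤ m + 1) :
    ∀ P : Symbol ι, P.natDegree ≤ n →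
      (P • fun k => BddEvolution.transportInv (a k) (w k) (v k)) ∈ S := by
  have hconst (q : SpaceSymbol ι) :
      (fun k => BddEvolution.transportInv (a k) (w k) (q • v k)) ∈ S := by
    have := h.inv _ (hv (Polynomial.C q) (by simp))
    simpa only [Pi.smul_apply, Symbol.C_smul] using this
  induction n with
  | zero =>
    intro P hP
    rw [Polynomial.eq_C_of_natDegree_le_zero hP]
    convert hconst (P.coeff 0) using 1
    funext k
    rw [Pi.smul_apply, Symbol.C_smul, map_smul]
  | succ n ih =>
    intro P hP
    have hdiv : P.divX.natDegree ≤ n := by rw [Polynomial.natDegree_divX_eq_natDegree_tsub_one]; lia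
    have hspace (i : ι) : (P.divX * Polynomial.C (∂ₓ i)).natDegree ≤ n :=
      (Polynomial.natDegree_mul_C_le _ _).trans hdiv
    have hmem := add_mem (sub_mem (sub_mem (hv P.divX (hdiv.trans (by lia)))
      (sum_mem fun i (_ : i ∈ Finset.univ) => h.velocity i _ (ih (by lia) _ (hspace i))))
      (h.rate _ (ih (by lia) _ hdiv))) (hconst (P.coeff 0))
    convert hmem using 1
    funext k
    simpa only [Pi.smul_apply, Pi.add_apply, Pi.sub_apply, Finset.sum_apply] using
      BddEvolution.smul_transportInv (a k) (w k) P (v k)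

lemma transportInv_mem_withDerivs (h : IsTransportStable a w S) (hv : v ∈ withDerivs S) :
    (fun k => BddEvolution.transportInv (a k) (w k) (v k)) ∈ withDerivs S := fun P =>
  h.smul_transportInv_mem_of_natDegree_le (fun P _ => hv P) (Nat.le_succ _) P le_rfl

end IsTransportStable

namespace BddEvolution

lemma isTransportStable_summableBdd {κ : Type*} {a : ℝ} (ha : 0 ≤ a) (w : 𝔼) :
    IsTransportStable (fun _ => a) (fun _ => w) (summableBdd κ ι) where
  rate _ hv := Submodule.smul_mem _ a hv
  velocity i _ hv := Submodule.smul_mem _ (w i) hv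
  inv v hv T := by
    obtain ⟨M, hM, h⟩ := hv T
    refine ⟨_, hM.mul_right T, fun k t ht x => ?_⟩
    have hC : 0 ≤ M k := (abs_nonneg _).trans (h k t ht x)
    exact (abs_transportInv_le_linear ha (h k) ht x).trans (mul_le_mul_of_nonneg_left ht.2 hC)

section Renewal

variable {J : Type*} [Fintype J]

/-- The integral operator of the renewal equation of a random motion that jumps at the rate `a` and
chooses its new velocity to be `w j` with probability `p j`. -/
def jumpOp (a : ℝ) (p : J → ℝ) (w : J → 𝔼) : BddEvolution ι →ₗ[SpaceSymbol ι] BddEvolution ι :=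
  a • ∑ j, p j • transportInv a (w j)

variable {a : ℝ} {p : J → ℝ} {w : J → EuclideanSpace ℝ ι}

lemma jumpOp_eq (u : BddEvolution ι) :
    jumpOp a p w u = a • ∑ j, p j • transportInv a (w j) u := by
  simp only [jumpOp, LinearMap.smul_apply, LinearMap.sum_apply]

lemma smul_jumpOp (P : Symbol ι) (u : BddEvolution ι) :
    P • jumpOp a p w u = a • ∑ j, p j • P • transportInv a (w j) u := by
  simp only [jumpOp_eq, Finset.smul_sum, smul_comm P]

lemma abs_jumpOp_le (ha : 0 ≤ a) (hp : p ∈ stdSimplex ℝ J) {u : BddEvolution ι} {t B : ℝ} {x : 𝔼}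
    (h : ∀ j, |transportInv a (w j) u t x| ≤ B) : |jumpOp a p w u t x| ≤ a * B := by
  rw [jumpOp_eq, smul_apply, abs_mul, abs_of_nonneg ha]
  refine mul_le_mul_of_nonneg_left ?_ ha
  calc |(∑ j, p j • transportInv a (w j) u) t x|
      ≤ ∑ j, p j * |transportInv a (w j) u t x| := by
        rw [sum_apply]
        refine (Finset.abs_sum_le_sum_abs _ _).trans_eq (Finset.sum_congr rfl fun j _ => ?_)
        rw [smul_apply, abs_mul, abs_of_nonneg (hp.1 j)]
    _ ≤ ∑ j, p j * B :=
        Finset.sum_le_sum fun j _ => mul_le_mul_of_nonneg_left (h j) (hp.1 j)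
    _ = B := by rw [← Finset.sum_mul, hp.2, one_mul]

lemma abs_jumpOp_le_of_affine (ha : 0 ≤ a) (hp : p ∈ stdSimplex ℝ J) {u : BddEvolution ι} {T r : ℝ}
    (h : ∀ s ∈ Ioc 0 T, ∀ y, |u s y| ≤ r * (1 + a * s)) {t : ℝ} (ht : t ∈ Ioc 0 T) (x : 𝔼) :
    |jumpOp a p w u t x| ≤ r * (a * t) :=
  (abs_jumpOp_le ha hp fun _ => abs_transportInv_le_of_affine h ht x).trans_eq (by ring)

lemma stripBdd_jumpOp (ha : 0 < a) (hp : p ∈ stdSimplex ℝ J) {u : BddEvolution ι} {T C : ℝ}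
    (h : StripBdd T C u) : StripBdd T ((1 - Real.exp (-a * T)) * C) (jumpOp a p w u) :=
  fun _ ht x => (abs_jumpOp_le ha.le hp fun _ => abs_transportInv_le_contraction ha h ht x).trans_eq
    (by field_simp)

lemma iterate_jumpOp_mem_summableBdd (ha : 0 < a) (hp : p ∈ stdSimplex ℝ J) (R : BddEvolution ι) :
    (fun n => (jumpOp a p w)^[n] R) ∈ summableBdd ℕ ι := fun T => by
  obtain ⟨C, -, hC⟩ := R.exists_stripBdd T
  rcases le_or_gt T 0 with hT | hT
  · exact ⟨0, summable_zero, fun n t ht => absurd (ht.1.trans_le ht.2) hT.not_gt⟩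
  set q := 1 - Real.exp (-a * T) with hq
  have hq0 : 0 ≤ q := sub_nonneg.2 (Real.exp_le_one_iff.2 (by nlinarith [mul_pos ha hT]))
  have hq1 : q < 1 := sub_lt_self _ (Real.exp_pos _)
  refine ⟨fun n => q ^ n * C, (summable_geometric_of_lt_one hq0 hq1).mul_right C, fun n => ?_⟩
  induction n with
  | zero => simpa using hC
  | succ n ih =>
    have := stripBdd_jumpOp (w := w) ha hp ih
    rwa [← hq, ← mul_assoc, ← pow_succ', ← Function.iterate_succ_apply' (jumpOp a p w)] at this

lemma iterate_jumpOp_mem_summableFamilies (ha : 0 < a) (hp : p ∈ stdSimplex ℝ J)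
    (R : BddEvolution ι) : (fun n => (jumpOp a p w)^[n] R) ∈ summableFamilies ℕ ι := by
  have hstable (j : J) := isTransportStable_summableBdd (κ := ℕ) ha.le (w j)
  suffices h : ∀ m, ∀ P : Symbol ι, P.natDegree ≤ m →
      (P • fun n => (jumpOp a p w)^[n] R) ∈ summableBdd ℕ ι from fun P => h _ P le_rfl
  intro m
  induction m with
  | zero =>
    intro P hP
    rw [Polynomial.eq_C_of_natDegree_le_zero hP]
    convert iterate_jumpOp_mem_summableBdd (w := w) ha hp (P.coeff 0 • R) using 1
    funext n
    rw [Pi.smul_apply, Symbol.C_smul, ← Module.End.pow_apply, ← Module.End.pow_apply, map_smul]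
  | succ m ih =>
    intro P hP
    refine mem_summableBdd_of_succ ?_
    have hmem := Submodule.smul_mem _ a (sum_mem fun j (_ : j ∈ Finset.univ) =>
      Submodule.smul_mem _ (p j)
        ((hstable j).smul_transportInv_mem_of_natDegree_le ih le_rfl P hP))
    convert hmem using 1
    funext n
    simp only [Pi.smul_apply, Finset.sum_apply, Function.iterate_succ_apply', smul_jumpOp]

/-- The solution of the renewal equation with source `R`, as a Neumann series. -/
def renewal (ha : 0 < a) (hp : p ∈ stdSimplex ℝ J) (w : J → 𝔼) (R : BddEvolution ι) :
    BddEvolution ι :=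
  summableFamilies.series ⟨_, iterate_jumpOp_mem_summableFamilies (w := w) ha hp R⟩

lemma tendsto_renewal (ha : 0 < a) (hp : p ∈ stdSimplex ℝ J) (R : BddEvolution ι) (t : ℝ)
    (x : 𝔼) : Tendsto (fun N => (∑ n ∈ Finset.range N, (jumpOp a p w)^[n] R) t x) atTop
      (𝓝 (renewal ha hp w R t x)) := by
  have := (summableFamilies.hasSum_series
    ⟨_, iterate_jumpOp_mem_summableFamilies (w := w) ha hp R⟩ t x).tendsto_sum_nat
  simpa only [sum_apply, renewal] using this

lemma sum_range_succ_iterate_jumpOp (R : BddEvolution ι) (N : ℕ) :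
    ∑ n ∈ Finset.range (N + 1), (jumpOp a p w)^[n] R =
      R + jumpOp a p w (∑ n ∈ Finset.range N, (jumpOp a p w)^[n] R) := by
  rw [Finset.sum_range_succ', map_sum, add_comm]
  simp only [Function.iterate_succ_apply', Function.iterate_zero, id_eq]

lemma renewal_eq (ha : 0 < a) (hp : p ∈ stdSimplex ℝ J) (R : BddEvolution ι) :
    renewal ha hp w R = R + jumpOp a p w (renewal ha hp w R) := by
  set S := renewal ha hp w R
  set s : ℕ → BddEvolution ι := fun N => ∑ n ∈ Finset.range N, (jumpOp a p w)^[n] R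
  refine ext fun t ht x => ?_
  obtain ⟨B, hB, hbound⟩ := summableFamilies.exists_stripBdd_series_sub
    ⟨_, iterate_jumpOp_mem_summableFamilies (w := w) ha hp R⟩ t
  have hlim : Tendsto (fun N => s (N + 1) t x) atTop (𝓝 (S t x)) :=
    (tendsto_add_atTop_iff_nat 1).2 (tendsto_renewal ha hp R t x)
  have hjump : Tendsto (fun N => jumpOp a p w (s N) t x) atTop (𝓝 (jumpOp a p w S t x)) := by
    rw [tendsto_iff_norm_sub_tendsto_zero]
    refine squeeze_zero (fun _ => norm_nonneg _) (fun N => ?_)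
      (by simpa only [mul_zero] using hB.const_mul (1 - Real.exp (-a * t)))
    rw [norm_sub_rev, ← sub_apply, ← map_sub]
    exact stripBdd_jumpOp ha hp (hbound N) t ⟨ht, le_rfl⟩ x
  refine tendsto_nhds_unique hlim ((hjump.const_add (R t x)).congr fun N => ?_)
  rw [← add_apply, ← sum_range_succ_iterate_jumpOp]

lemma smul_renewal (ha : 0 < a) (hp : p ∈ stdSimplex ℝ J) (R : BddEvolution ι)
    (q : SpaceSymbol ι) : q • renewal ha hp w R = renewal ha hp w (q • R) := by
  rw [← Symbol.C_smul, renewal, summableFamilies.smul_series]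
  refine congrArg _ (Subtype.ext (funext fun n => ?_))
  change Polynomial.C q • (jumpOp a p w)^[n] R = (jumpOp a p w)^[n] (q • R)
  rw [Symbol.C_smul, ← Module.End.pow_apply, ← Module.End.pow_apply, map_smul]

lemma abs_renewal_le (ha : 0 < a) (hp : p ∈ stdSimplex ℝ J) {R : BddEvolution ι} {T r : ℝ}
    (hR : StripBdd T r R) {t : ℝ} (ht : t ∈ Ioc 0 T) (x : 𝔼) :
    |renewal ha hp w R t x| ≤ r * (1 + a * t) := by
  have hpartial (N : ℕ) : ∀ s ∈ Ioc 0 T, ∀ y,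
      |(∑ n ∈ Finset.range N, (jumpOp a p w)^[n] R) s y| ≤ r * (1 + a * s) := by
    induction N with
    | zero =>
      intro s hs y
      have hr : 0 ≤ r := (abs_nonneg _).trans (hR s hs y)
      have := hs.1
      rw [Finset.sum_range_zero, zero_apply, abs_zero]
      positivity
    | succ N ih =>
      intro s hs y
      rw [sum_range_succ_iterate_jumpOp, add_apply, mul_add, mul_one]
      exact (abs_add_le _ _).trans
        (add_le_add (hR s hs y) (abs_jumpOp_le_of_affine ha.le hp ih hs y))
  exact le_of_tendsto (tendsto_renewal ha hp R t x).abs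
    (Eventually.of_forall fun N => hpartial N t ht x)

end Renewal

lemma transport_smul_transportInv_comm {a b : ℝ} {v w : 𝔼} {u : BddEvolution ι}
    (hu : trace u = 0) :
    transport b w • transportInv a v u = transportInv a v (transport b w • u) := by
  have htrace : trace (transport b w • transportInv a v u) = 0 := by
    have hdecomp : transport b w • transportInv a v u =
        u + (spaceDirDeriv w + b • 1 - (spaceDirDeriv v + a • 1)) • transportInv a v u := by
      conv_rhs => enter [1]; rw [← transport_smul_transportInv a v u]
      rw [← Symbol.C_smul, ← add_smul, transport, transport, map_sub]
      congr 1
      ring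
    rw [hdecomp, map_add, map_smul, hu, trace_transportInv, smul_zero, add_zero]
  rw [← transportInv_transport_smul a v htrace, smul_comm, transport_smul_transportInv]

lemma commute_transportInv (a b : ℝ) (v w : 𝔼) :
    Commute (transportInv a v : Module.End (SpaceSymbol ι) (BddEvolution ι))
      (transportInv b w) := by
  refine LinearMap.ext fun u => ?_
  rw [Module.End.mul_apply, Module.End.mul_apply,
    ← transportInv_transport_smul b w (trace_transportInv a v (transportInv b w u)),
    transport_smul_transportInv_comm (trace_transportInv b w u), transport_smul_transportInv]

end BddEvolution

section Telegraph

variable {J : Type*}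

namespace BddEvolution

variable (a : ℝ) (w : J → EuclideanSpace ℝ ι)

lemma pairwise_commute_transportInv (s : Set J) : s.Pairwise (Function.onFun Commute fun j =>
    (transportInv a (w j) : Module.End (SpaceSymbol ι) (BddEvolution ι))) :=
  fun _ _ _ _ _ => commute_transportInv _ _ _ _

/-- The product of the solution operators of several transport equations. -/
def transportInvProd (s : Finset J) : Module.End (SpaceSymbol ι) (BddEvolution ι) :=
  s.noncommProd (fun j => transportInv a (w j)) (pairwise_commute_transportInv a w s)

lemma transportInvProd_empty (u : BddEvolution ι) : transportInvProd a w ∅ u = u := by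
  rw [transportInvProd, Finset.noncommProd_empty, Module.End.one_apply]

lemma transportInvProd_insert [DecidableEq J] {s : Finset J} {j : J} (hj : j ∉ s)
    (u : BddEvolution ι) :
    transportInvProd a w (insert j s) u = transportInv a (w j) (transportInvProd a w s u) := by
  rw [transportInvProd, Finset.noncommProd_insert_of_notMem _ _ _ _ hj, Module.End.mul_apply,
    transportInvProd]

lemma trace_transportInvProd {s : Finset J} {j : J} (hj : j ∈ s) (u : BddEvolution ι) :
    trace (transportInvProd a w s u) = 0 := by
  classical
  rw [← Finset.insert_erase hj, transportInvProd_insert a w (Finset.notMem_erase j s),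
    trace_transportInv]

lemma prod_transport_smul_transportInvProd (s : Finset J) (u : BddEvolution ι) :
    (∏ j ∈ s, transport a (w j)) • transportInvProd a w s u = u := by
  classical
  induction s using Finset.induction_on with
  | empty => rw [transportInvProd_empty, Finset.prod_empty, one_smul]
  | insert j s hj ih =>
    rw [Finset.prod_insert hj, transportInvProd_insert a w hj, mul_comm, mul_smul,
      transport_smul_transportInv, ih]

lemma prod_erase_transport_smul_transportInvProd [DecidableEq J] {s : Finset J} {j : J} (hj : j ∈ s)
    (u : BddEvolution ι) :
    (∏ k ∈ s.erase j, transport a (w k)) • transportInvProd a w s u = transportInv a (w j) u := by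
  have hsplit : transportInvProd a w s u =
      transportInvProd a w (s.erase j) (transportInv a (w j) u) := by
    rw [transportInvProd, ← Finset.noncommProd_erase_mul s hj _
      (pairwise_commute_transportInv a w s), Module.End.mul_apply, transportInvProd]
  rw [hsplit, prod_transport_smul_transportInvProd]

end BddEvolution

variable [Fintype J] [DecidableEq J]

/-- The symbol of the equation for the density of a random motion that jumps at the rate `a` and
chooses its new velocity to be `w j` with probability `p j`. It is the determinant of the matrix
with entries `δ j k * transport a (w j) - a * p k`. -/
def telegraphSymbol (a : ℝ) (p : J → ℝ) (w : J → 𝔼) : Symbol ι :=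
  ∏ j, transport a (w j) - a • ∑ j, p j • ∏ k ∈ Finset.univ.erase j, transport a (w k)

namespace BddEvolution

lemma telegraphSymbol_smul_transportInvProd (a : ℝ) (p : J → ℝ) (w : J → 𝔼) (u : BddEvolution ι) :
    telegraphSymbol a p w • transportInvProd a w Finset.univ u = u - jumpOp a p w u := by
  simp only [telegraphSymbol, sub_smul, smul_assoc, Finset.sum_smul, jumpOp_eq,
    prod_transport_smul_transportInvProd,
    prod_erase_transport_smul_transportInvProd a w (Finset.mem_univ _)]

lemma telegraphSymbol_smul_transportInvProd_renewal {a : ℝ} (ha : 0 < a) {p : J → ℝ}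
    (hp : p ∈ stdSimplex ℝ J) (w : J → 𝔼) (R : BddEvolution ι) :
    telegraphSymbol a p w • transportInvProd a w Finset.univ (renewal ha hp w R) = R := by
  rw [telegraphSymbol_smul_transportInvProd]
  exact sub_eq_of_eq_add (renewal_eq ha hp R)

end BddEvolution

end Telegraph

/-- The unit vectors in the directions of the coordinate axes, in both orientations. -/
def axisDirection (j : ι × Bool) : 𝔼 := (cond j.2 1 (-1) : ℝ) • EuclideanSpace.basisFun ι ℝ j.1

lemma eval_eval_transport_axisDirection (a c : ℝ) (j : ι × Bool) (τ : SpaceSymbol ι) (ξ : ι → ℝ) :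
    MvPolynomial.eval ξ ((transport a (c • axisDirection j)).eval τ) =
      MvPolynomial.eval ξ τ + (c * cond j.2 1 (-1) * ξ j.1 + a) := by
  simp [transport, axisDirection, smul_smul, spaceDirDeriv_smul_basisFun, MvPolynomial.smul_eval]

lemma partialSum_regCoeff_eq_telegraphSymbol {ε : ℝ} (hε : ε ≠ 0) :
    partialSum regCoeff 6 ε = (3125 / 7776 * ε ^ 10) •
      telegraphSymbol (6 / 5 * ε⁻¹ ^ 2) (fun _ : Fin 3 × Bool => 1 / 6)
        (fun j => ε⁻¹ • axisDirection j) := by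
  refine Polynomial.funext fun τ => MvPolynomial.funext fun ξ => ?_
  simp only [telegraphSymbol, ← Finset.filter_ne', Finset.prod_filter, Fintype.sum_prod_type,
    Fintype.prod_prod_type, Fin.sum_univ_three, Fin.prod_univ_three, Fintype.sum_bool,
    Fintype.prod_bool]
  simp only [partialSum, regCoeff, heatSymbol, laplacian, Fin.sum_univ_three, Fin.isValue, smul_add,
    map_add, one_div, map_pow, lap2Symbol, map_mul, lap3Symbol, Finset.sum_range_succ,
    Finset.range_one, Finset.sum_singleton, mul_zero, pow_zero, one_smul, mul_one, Nat.reduceMul,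
    Polynomial.eval_add, Polynomial.eval_sub, Polynomial.eval_X, Polynomial.eval_C,
    Polynomial.eval_smul, Polynomial.eval_pow, Polynomial.eval_mul, map_sub, MvPolynomial.smul_eval,
    MvPolynomial.eval_X, inv_pow, ne_eq, not_true_eq_false, ↓reduceIte, Prod.mk.injEq,
    Bool.false_eq_true, and_false, not_false_eq_true, one_mul, one_ne_zero, and_true, and_self,
    Fin.reduceEq, Bool.true_eq_false, zero_ne_one, eval_eval_transport_axisDirection, cond_true,
    cond_false, mul_neg, neg_mul]
  set σ := MvPolynomial.eval ξ τ
  field_simp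
  ring

/-- The families of bounded evolutions that are `O(ε ^ p)` as `ε → 0+`, uniformly on strips. -/
def supBigO (ι : Type*) [Fintype ι] (p : ℕ) : Submodule ℝ (ℝ → BddEvolution ι) where
  carrier := {v | ∀ T, ∃ C, ∀ᶠ ε in 𝓝[>] (0 : ℝ), StripBdd T (C * ε ^ p) (v ε)}
  add_mem' := fun {v w} hv hw T => by
    obtain ⟨C, hC⟩ := hv T
    obtain ⟨C', hC'⟩ := hw T
    exact ⟨C + C', by filter_upwards [hC, hC'] with ε h h' using add_mul C C' _ ▸ h.add h'⟩
  zero_mem' := fun _ => ⟨0, Eventually.of_forall fun _ => StripBdd.zero (zero_mul _).ge⟩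
  smul_mem' := fun r v hv T => by
    obtain ⟨C, hC⟩ := hv T
    exact ⟨|r| * C, by filter_upwards [hC] with ε h using mul_assoc |r| C _ ▸ h.smul r⟩

section supBigO

variable {p q : ℕ} {v w : ℝ → BddEvolution ι}

lemma mem_supBigO_congr (h : v =ᶠ[𝓝[>] 0] w) : v ∈ supBigO ι p ↔ w ∈ supBigO ι p :=
  forall_congr' fun T => exists_congr fun C => eventually_congr <| h.mono fun ε hε => by rw [hε]

lemma exists_nonneg_of_mem_supBigO (h : v ∈ supBigO ι p) (T : ℝ) :
    ∃ C, 0 ≤ C ∧ ∀ᶠ ε in 𝓝[>] (0 : ℝ), StripBdd T (C * ε ^ p) (v ε) := by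
  obtain ⟨C, hC⟩ := h T
  refine ⟨max C 0, le_max_right _ _, ?_⟩
  filter_upwards [hC, self_mem_nhdsWithin] with ε h hε
  exact h.mono (mul_le_mul_of_nonneg_right (le_max_left _ _) (pow_nonneg (le_of_lt hε) p))

lemma supBigO_antitone : Antitone (supBigO ι) := fun q p hqp v hv T => by
  obtain ⟨C, hC0, hC⟩ := exists_nonneg_of_mem_supBigO hv T
  refine ⟨C, ?_⟩
  filter_upwards [hC, Ioo_mem_nhdsGT one_pos] with ε h hε
  exact h.mono (mul_le_mul_of_nonneg_left (pow_le_pow_of_le_one hε.1.le hε.2.le hqp) hC0)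

lemma const_mem_supBigO (u : BddEvolution ι) : (fun _ => u) ∈ supBigO ι 0 := fun T => by
  obtain ⟨C, -, hC⟩ := u.exists_stripBdd T
  exact ⟨C, Eventually.of_forall fun ε => by rwa [pow_zero, mul_one]⟩

lemma pow_smul_mem_supBigO (k : ℕ) (hv : v ∈ supBigO ι p) :
    (fun ε => ε ^ k • v ε) ∈ supBigO ι (p + k) := fun T => by
  obtain ⟨C, hC⟩ := hv T
  refine ⟨C, ?_⟩
  filter_upwards [hC, self_mem_nhdsWithin] with ε h hε
  refine (h.smul (ε ^ k)).mono (le_of_eq ?_)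
  rw [abs_of_pos (pow_pos hε k), pow_add]
  ring

lemma inv_pow_smul_mem_supBigO {k : ℕ} (hv : v ∈ supBigO ι (p + k)) :
    (fun ε => ε⁻¹ ^ k • v ε) ∈ supBigO ι p := fun T => by
  obtain ⟨C, hC⟩ := hv T
  refine ⟨C, ?_⟩
  filter_upwards [hC, self_mem_nhdsWithin] with ε h (hε : 0 < ε)
  refine (h.smul (ε⁻¹ ^ k)).mono (le_of_eq ?_)
  rw [abs_of_pos (by positivity), pow_add, inv_pow]
  field_simp

end supBigO

/-- The families of bounded evolutions that are `O(ε ^ p)` as `ε → 0+` for every `p`, uniformly on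
strips. -/
def negligible (ι : Type*) [Fintype ι] : Submodule ℝ (ℝ → BddEvolution ι) := ⨅ p, supBigO ι p

section negligible

variable {v w : ℝ → BddEvolution ι}

lemma mem_negligible : v ∈ negligible ι ↔ ∀ p, v ∈ supBigO ι p := Submodule.mem_iInf _

lemma mem_negligible_congr (h : v =ᶠ[𝓝[>] 0] w) : v ∈ negligible ι ↔ w ∈ negligible ι := by
  simp only [mem_negligible, mem_supBigO_congr h]

lemma inv_pow_smul_mem_negligible (k : ℕ) (hv : v ∈ negligible ι) :
    (fun ε => ε⁻¹ ^ k • v ε) ∈ negligible ι :=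
  mem_negligible.2 fun p => inv_pow_smul_mem_supBigO (mem_negligible.1 hv (p + k))

lemma isTransportStable_negligible {α : ℝ} (hα : 0 ≤ α) (w : 𝔼) :
    IsTransportStable (fun ε => α * ε⁻¹ ^ 2) (fun ε => ε⁻¹ • w) (negligible ι) where
  rate v hv := by
    simpa only [Pi.smul_def, smul_smul] using
      Submodule.smul_mem _ α (inv_pow_smul_mem_negligible 2 hv)
  velocity i v hv := by
    simpa only [Pi.smul_def, smul_smul, pow_one, PiLp.smul_apply, smul_eq_mul, mul_comm (w i)] using
      Submodule.smul_mem _ (w i) (inv_pow_smul_mem_negligible 1 hv)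
  inv v hv := mem_negligible.2 fun p T => by
    obtain ⟨C, hC0, hC⟩ := exists_nonneg_of_mem_supBigO (mem_negligible.1 hv p) T
    refine ⟨C * T, ?_⟩
    filter_upwards [hC, self_mem_nhdsWithin] with ε h (hε : 0 < ε) t ht x
    refine (BddEvolution.abs_transportInv_le_linear (by positivity) h ht x).trans ?_
    rw [mul_right_comm]
    have := ht.2
    gcongr

end negligible

section Renewal

variable {J : Type*} {α : ℝ} {p : J → ℝ} {w : J → EuclideanSpace ℝ ι} {R S : ℝ → BddEvolution ι}

lemma transportInvProd_mem_withDerivs_negligible (hα : 0 ≤ α) (w : J → 𝔼) (s : Finset J)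
    (hS : S ∈ withDerivs (negligible ι)) :
    (fun ε => BddEvolution.transportInvProd (α * ε⁻¹ ^ 2) (fun j => ε⁻¹ • w j) s (S ε)) ∈
      withDerivs (negligible ι) := by
  classical
  induction s using Finset.induction_on with
  | empty => simpa only [BddEvolution.transportInvProd_empty] using hS
  | insert j s hj ih =>
    simpa only [BddEvolution.transportInvProd_insert _ _ hj] using
      (isTransportStable_negligible hα (w j)).transportInv_mem_withDerivs ih

variable [Fintype J]

lemma renewal_mem_negligible (hα : 0 < α) (hp : p ∈ stdSimplex ℝ J)
    (hS : ∀ ε (hε : 0 < ε), S ε = BddEvolution.renewal (a := α * ε⁻¹ ^ 2) (by positivity) hp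
      (fun j => ε⁻¹ • w j) (R ε)) (hR : R ∈ negligible ι) : S ∈ negligible ι :=
  mem_negligible.2 fun k T => by
    obtain ⟨C, hC0, hC⟩ := exists_nonneg_of_mem_supBigO (mem_negligible.1 hR (k + 2)) T
    refine ⟨C * (1 + α * T), ?_⟩
    filter_upwards [hC, Ioo_mem_nhdsGT one_pos] with ε h hε t ht x
    have hε0 : 0 < ε := hε.1
    have hε2 : ε ^ 2 ≤ 1 := pow_le_one₀ hε0.le hε.2.le
    rw [hS ε hε0]
    calc |BddEvolution.renewal _ hp (fun j => ε⁻¹ • w j) (R ε) t x|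
        ≤ C * ε ^ (k + 2) * (1 + α * ε⁻¹ ^ 2 * t) := BddEvolution.abs_renewal_le _ hp h ht x
      _ = C * ε ^ k * (ε ^ 2 + α * t) := by rw [pow_add]; field_simp
      _ ≤ C * ε ^ k * (1 + α * T) := by have := ht.2; gcongr
      _ = C * (1 + α * T) * ε ^ k := by ring

lemma renewal_mem_withDerivs_negligible (hα : 0 < α) (hp : p ∈ stdSimplex ℝ J)
    (hS : ∀ ε (hε : 0 < ε), S ε = BddEvolution.renewal (a := α * ε⁻¹ ^ 2) (by positivity) hp
      (fun j => ε⁻¹ • w j) (R ε)) (hR : R ∈ withDerivs (negligible ι)) :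
    S ∈ withDerivs (negligible ι) := by
  have hstable (j : J) := isTransportStable_negligible hα.le (w j)
  suffices h : ∀ m, ∀ P : Symbol ι, P.natDegree ≤ m → P • S ∈ negligible ι from
    fun P => h _ P le_rfl
  intro m
  induction m with
  | zero =>
    intro P hP
    rw [Polynomial.eq_C_of_natDegree_le_zero hP]
    refine renewal_mem_negligible (w := w) hα hp (fun ε hε => ?_) (hR (Polynomial.C (P.coeff 0)))
    rw [Pi.smul_apply, Pi.smul_apply, Symbol.C_smul, Symbol.C_smul, hS ε hε,
      BddEvolution.smul_renewal]
  | succ m ih =>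
    intro P hP
    have hmem := add_mem (hR P) ((isTransportStable_negligible hα.le 0).rate _
      (sum_mem fun j (_ : j ∈ Finset.univ) => Submodule.smul_mem _ (p j)
        ((hstable j).smul_transportInv_mem_of_natDegree_le ih le_rfl P hP)))
    refine (mem_negligible_congr ?_).1 hmem
    filter_upwards [self_mem_nhdsWithin] with ε (hε : 0 < ε)
    have hrenewal : S ε = R ε + BddEvolution.jumpOp (α * ε⁻¹ ^ 2) p (fun j => ε⁻¹ • w j) (S ε) := by
      rw [hS ε hε]
      exact BddEvolution.renewal_eq _ hp _
    rw [Pi.smul_apply _ S, hrenewal, smul_add, BddEvolution.smul_jumpOp]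
    simp only [Pi.add_apply, Finset.sum_apply, Pi.smul_apply]

lemma exists_telegraphSymbol_smul_eq [DecidableEq J] (hα : 0 < α) (hp : p ∈ stdSimplex ℝ J)
    (w : J → 𝔼) (hR : R ∈ withDerivs (negligible ι)) :
    ∃ v ∈ withDerivs (negligible ι), ∀ ε > 0, (BddEvolution.trace (v ε) = 0 ∧
      telegraphSymbol (α * ε⁻¹ ^ 2) p (fun j => ε⁻¹ • w j) • v ε = R ε) := by
  obtain ⟨j, -⟩ : ∃ j, p j ≠ 0 := by
    simpa using Finset.exists_ne_zero_of_sum_ne_zero (hp.2.trans_ne one_ne_zero)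
  let S : ℝ → BddEvolution ι := fun ε => if hε : 0 < ε then
    BddEvolution.renewal (a := α * ε⁻¹ ^ 2) (by positivity) hp (fun j => ε⁻¹ • w j) (R ε) else 0
  have hS (ε : ℝ) (hε : 0 < ε) : S ε = BddEvolution.renewal (a := α * ε⁻¹ ^ 2) (by positivity) hp
      (fun j => ε⁻¹ • w j) (R ε) := dif_pos hε
  refine ⟨_, transportInvProd_mem_withDerivs_negligible hα.le w Finset.univ
    (renewal_mem_withDerivs_negligible hα hp hS hR), fun ε hε =>
    ⟨BddEvolution.trace_transportInvProd _ _ (Finset.mem_univ j) _, ?_⟩⟩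
  rw [hS ε hε]
  exact BddEvolution.telegraphSymbol_smul_transportInvProd_renewal _ hp _ (R ε)

end Renewal

lemma exists_partialSum_regCoeff_smul_eq {R : ℝ → BddEvolution (Fin 3)}
    (hR : R ∈ withDerivs (negligible (Fin 3))) :
    ∃ v ∈ withDerivs (negligible (Fin 3)), ∀ ε > 0,
      (BddEvolution.trace (v ε) = 0 ∧ partialSum regCoeff 6 ε • v ε = R ε) := by
  have hp : (fun _ : Fin 3 × Bool => (1 / 6 : ℝ)) ∈ stdSimplex ℝ (Fin 3 × Bool) :=
    ⟨fun _ => by norm_num, by simp⟩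
  have hR' : (fun ε => (7776 / 3125 * ε⁻¹ ^ 10) • R ε) ∈ withDerivs (negligible (Fin 3)) :=
    fun P => by
      simpa only [Pi.smul_def, smul_smul, smul_comm P] using
        Submodule.smul_mem _ (7776 / 3125 : ℝ) (inv_pow_smul_mem_negligible 10 (hR P))
  obtain ⟨v, hv, hvR⟩ := exists_telegraphSymbol_smul_eq (α := 6 / 5) (by norm_num) hp
    axisDirection hR'
  refine ⟨v, hv, fun ε hε => ⟨(hvR ε hε).1, ?_⟩⟩
  have hscalar : 3125 / 7776 * ε ^ 10 * (7776 / 3125 * ε⁻¹ ^ 10) = 1 := by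
    have := hε.ne'
    field_simp
  rw [partialSum_regCoeff_eq_telegraphSymbol hε.ne', smul_assoc, (hvR ε hε).2, smul_smul, hscalar,
    one_smul]

/-- The families of bounded evolutions that are `O(ε ^ p)` as `ε → 0+` together with all their
derivatives, uniformly on strips. -/
def bigO (ι : Type*) [Fintype ι] (p : ℕ) : Submodule (Symbol ι) (ℝ → BddEvolution ι) :=
  withDerivs (supBigO ι p)

section bigO

variable {p : ℕ} {v w : ℝ → BddEvolution ι}

lemma mem_bigO_congr (h : v =ᶠ[𝓝[>] 0] w) : v ∈ bigO ι p ↔ w ∈ bigO ι p :=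
  forall_congr' fun P => mem_supBigO_congr (h.fun_comp (P • ·))

lemma mem_withDerivs_negligible : v ∈ withDerivs (negligible ι) ↔ ∀ p, v ∈ bigO ι p :=
  ⟨fun h p P => mem_negligible.1 (h P) p, fun h P => mem_negligible.2 fun p => h p P⟩

lemma bigO_antitone : Antitone (bigO ι) := fun _ _ h _ hv P => supBigO_antitone h (hv P)

lemma const_mem_bigO (u : BddEvolution ι) : (fun _ => u) ∈ bigO ι 0 :=
  fun P => const_mem_supBigO (P • u)

lemma pow_smul_mem_bigO (k : ℕ) (hv : v ∈ bigO ι p) : (fun ε => ε ^ k • v ε) ∈ bigO ι (p + k) :=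
  fun P => by
    simpa only [Pi.smul_def, smul_comm P] using pow_smul_mem_supBigO k (hv P)

lemma mem_bigO_of_symbolMonomial (h : ∀ m (α : ι → ℕ), symbolMonomial m α • v ∈ supBigO ι p) :
    v ∈ bigO ι p := fun P => by
  induction P using Symbol.induction_monomial with
  | add P Q hP hQ => rw [add_smul]; exact add_mem hP hQ
  | monomial c m α => rw [smul_assoc]; exact Submodule.smul_mem _ c (h m α)

lemma timeInt_mem_supBigO (hv : v ∈ supBigO ι p) :
    (fun ε => BddEvolution.timeInt (v ε)) ∈ supBigO ι p := fun T => by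
  obtain ⟨C, hC0, hC⟩ := exists_nonneg_of_mem_supBigO hv T
  refine ⟨C * T, ?_⟩
  filter_upwards [hC, self_mem_nhdsWithin] with ε h (hε : 0 < ε) t ht x
  refine (BddEvolution.abs_timeInt_le h ht x).trans ?_
  rw [mul_right_comm]
  have := ht.2
  gcongr

lemma timeInt_mem_bigO (hv : v ∈ bigO ι p) :
    (fun ε => BddEvolution.timeInt (v ε)) ∈ bigO ι p := fun P => by
  induction P using Polynomial.induction_on' with
  | add P Q hP hQ => rw [add_smul]; exact add_mem hP hQ
  | monomial m q =>
    rw [← Polynomial.C_mul_X_pow_eq_monomial]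
    cases m with
    | zero =>
      simpa only [Pi.smul_def, pow_zero, mul_one, Symbol.C_smul, map_smul] using
        timeInt_mem_supBigO (hv (Polynomial.C q))
    | succ m =>
      simpa only [Pi.smul_def, pow_succ, ← mul_assoc, mul_smul _ ∂ₜ,
        BddEvolution.timeDeriv_smul_timeInt] using hv (Polynomial.C q * ∂ₜ ^ m)

lemma trace_mem_bigO (hv : v ∈ bigO ι p) : (fun ε => BddEvolution.trace (v ε)) ∈ bigO ι p :=
  sub_mem hv (timeInt_mem_bigO (Submodule.smul_mem _ ∂ₜ hv))

end bigO

section partialSum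

lemma partialSum_sub_partialSum {M : Type*} [AddCommGroup M] [Module ℝ M] (a : ℕ → M) {N K : ℕ}
    (h : N ≤ K) (ε : ℝ) :
    partialSum a K ε - partialSum a N ε = ∑ k ∈ Finset.Ico N K, ε ^ (2 * k) • a k :=
  (Finset.sum_Ico_eq_sub _ h).symm

lemma partialSum_sub_partialSum_mem_bigO (u : ℕ → BddEvolution ι) {N K : ℕ} (h : N ≤ K) :
    partialSum u K - partialSum u N ∈ bigO ι (2 * N) := by
  have hsum : partialSum u K - partialSum u N =
      ∑ k ∈ Finset.Ico N K, fun ε : ℝ => ε ^ (2 * k) • u k :=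
    funext fun ε => by rw [Pi.sub_apply, partialSum_sub_partialSum u h, Finset.sum_apply]
  rw [hsum]
  exact sum_mem fun k hk => bigO_antitone (by have := (Finset.mem_Ico.1 hk).1; lia)
    (pow_smul_mem_bigO (2 * k) (const_mem_bigO (u k)))

lemma partialSum_sub_smul_mem_bigO (b : ℕ → Symbol ι) {N K p : ℕ} (h : N ≤ K)
    {v : ℝ → BddEvolution ι} (hv : v ∈ bigO ι p) :
    (fun ε => (partialSum b K ε - partialSum b N ε) • v ε) ∈ bigO ι (p + 2 * N) := by
  have hsum : (fun ε => (partialSum b K ε - partialSum b N ε) • v ε) =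
      ∑ k ∈ Finset.Ico N K, fun ε : ℝ => ε ^ (2 * k) • (b k • v) ε :=
    funext fun ε => by
      simp only [partialSum_sub_partialSum b h, Finset.sum_smul, smul_assoc, Finset.sum_apply,
        Pi.smul_apply]
  rw [hsum]
  exact sum_mem fun k hk => bigO_antitone (by have := (Finset.mem_Ico.1 hk).1; lia)
    (pow_smul_mem_bigO (2 * k) (Submodule.smul_mem _ (b k) hv))

lemma partialSum_smul_mem_bigO (b : ℕ → Symbol ι) (n : ℕ) {p : ℕ} {v : ℝ → BddEvolution ι}
    (hv : v ∈ bigO ι p) : (fun ε => partialSum b n ε • v ε) ∈ bigO ι p := by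
  simpa only [partialSum, Finset.range_zero, Finset.sum_empty, sub_zero, mul_zero, add_zero] using
    partialSum_sub_smul_mem_bigO b n.zero_le hv

lemma partialSum_eq_of_le {M : Type*} [AddCommMonoid M] [Module ℝ M] {a : ℕ → M} {n K : ℕ}
    (ha : ∀ i ≥ n, a i = 0) (h : n ≤ K) (ε : ℝ) : partialSum a n ε = partialSum a K ε :=
  Finset.sum_subset (Finset.range_subset_range.2 h) fun i _ hi => by
    rw [ha i (not_lt.1 fun hlt => hi (Finset.mem_range.2 hlt)), smul_zero]

end partialSum

/-- The system of equations for the coefficients `u` of a formal solution `u 0 + ε² u 1 + …` of the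
equation with the symbol `b 0 + ε² b 1 + …`. -/
def IsHierarchy (b : ℕ → Symbol ι) (u : ℕ → BddEvolution ι) : Prop :=
  ∀ k, ∑ j ∈ Finset.range (k + 1), b (k - j) • u j = 0

namespace IsHierarchy

variable {b : ℕ → Symbol ι} {u v : ℕ → BddEvolution ι} {n : ℕ}

lemma sum_partialSum_smul (hu : IsHierarchy b u) (N : ℕ) (ε : ℝ) :
    ∑ j ∈ Finset.range N, partialSum b (N - j) ε • ε ^ (2 * j) • u j = 0 := by
  have hterm (j i : ℕ) : (ε ^ (2 * i) • b i) • ε ^ (2 * j) • u j =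
      ε ^ (2 * (j + i)) • b i • u j := by
    rw [smul_assoc, smul_comm (b i), smul_smul, ← pow_add, ← mul_add, add_comm i]
  calc ∑ j ∈ Finset.range N, partialSum b (N - j) ε • ε ^ (2 * j) • u j
      = ∑ j ∈ Finset.range N, ∑ i ∈ Finset.range (N - j), ε ^ (2 * (j + i)) • b i • u j := by
        simp only [partialSum, Finset.sum_smul, hterm]
    _ = ∑ k ∈ Finset.range N, ∑ j ∈ Finset.range (k + 1),
          ε ^ (2 * (j + (k - j))) • b (k - j) • u j :=
        (Finset.sum_range_diag_flip N fun j i => ε ^ (2 * (j + i)) • b i • u j).symm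
    _ = ∑ k ∈ Finset.range N, ε ^ (2 * k) • ∑ j ∈ Finset.range (k + 1), b (k - j) • u j := by
        refine Finset.sum_congr rfl fun k _ => ?_
        rw [Finset.smul_sum]
        refine Finset.sum_congr rfl fun j hj => ?_
        rw [Nat.add_sub_cancel' (Finset.mem_range_succ_iff.1 hj)]
    _ = 0 := Finset.sum_eq_zero fun k _ => by rw [hu k, smul_zero]

lemma partialSum_smul_partialSum_mem_bigO (hu : IsHierarchy b u) (hb : ∀ i ≥ n, b i = 0) (N : ℕ) :
    (fun ε => partialSum b n ε • partialSum u N ε) ∈ bigO ι (2 * N) := by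
  have hsum : (fun ε => partialSum b n ε • partialSum u N ε) = ∑ j ∈ Finset.range N, fun ε =>
      (partialSum b (max n N) ε - partialSum b (N - j) ε) • ε ^ (2 * j) • u j := by
    funext ε
    simp only [Finset.sum_apply, sub_smul, Finset.sum_sub_distrib]
    rw [hu.sum_partialSum_smul, sub_zero, partialSum_eq_of_le hb (le_max_left n N),
      ← Finset.smul_sum]
    rfl
  rw [hsum]
  refine sum_mem fun j hj => ?_
  have hjN := Finset.mem_range.1 hj
  exact bigO_antitone (by lia) (partialSum_sub_smul_mem_bigO b (by lia)
    (pow_smul_mem_bigO (2 * j) (const_mem_bigO (u j))))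

end IsHierarchy

section Hierarchy

variable {D : ℝ} {b : ℕ → Symbol ι} {u v : ℕ → BddEvolution ι}

variable (ι) in
/-- The symbol into which `∂ₜ` is transformed by `heat`. -/
def heatShift (D : ℝ) : Symbol ι := ∂ₜ + Polynomial.C (D • laplacian ι)

lemma smul_heat (hD : 0 < D) (P : Symbol ι) (u : BddEvolution ι) :
    P • BddEvolution.heat hD u = BddEvolution.heat hD (P.comp (heatShift ι D) • u) := by
  induction P using Symbol.induction_mul generalizing u with
  | const c =>
    rw [Polynomial.smul_comp, Polynomial.one_comp, smul_assoc, smul_assoc, one_smul, one_smul,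
      LinearMap.map_smul_of_tower _ c]
  | add P Q hP hQ => rw [add_smul, hP, hQ, Polynomial.add_comp, add_smul, map_add]
  | mul_time P hP =>
    rw [mul_smul, BddEvolution.timeDeriv_smul_heat, hP, Polynomial.mul_comp, mul_smul,
      Polynomial.X_comp, heatShift, add_smul, Symbol.C_smul, smul_assoc]
  | mul_space i P hP =>
    rw [mul_smul, Symbol.C_smul, ← map_smul, hP, Polynomial.mul_comp, mul_smul, Polynomial.C_comp,
      Symbol.C_smul]

/-- The solution `hier` of the hierarchy, before the application of `heat`. -/
def hierProfile (D : ℝ) (b : ℕ → Symbol ι) (Φ : ℕ → BddEvolution ι) (k : ℕ) : BddEvolution ι :=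
  Φ k - BddEvolution.timeInt
    (∑ j : Fin k, (b (k - j)).comp (heatShift ι D) • hierProfile D b Φ j)

/-- The solution of the hierarchy with initial values `Φ`, for `b 0 = heatSymbol ι D`. -/
def hier (hD : 0 < D) (b : ℕ → Symbol ι) (Φ : ℕ → BddEvolution ι) (k : ℕ) : BddEvolution ι :=
  BddEvolution.heat hD (hierProfile D b Φ k)

lemma isHierarchy_hier (hD : 0 < D) (hb : b 0 = heatSymbol ι D) {Φ : ℕ → BddEvolution ι}
    (hΦ : ∀ k, ∂ₜ • Φ k = 0) : IsHierarchy b (hier hD b Φ) := fun k => by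
  rw [Finset.sum_range_succ, Nat.sub_self, hb, hier, BddEvolution.heatSymbol_smul_heat, hierProfile,
    smul_sub, hΦ, BddEvolution.timeDeriv_smul_timeInt, zero_sub, map_neg, map_sum,
    Finset.sum_range, add_neg_eq_zero]
  exact Finset.sum_congr rfl fun j _ => smul_heat hD _ _

lemma trace_hier (hD : 0 < D) {Φ : ℕ → BddEvolution ι} (hΦ : ∀ k, ∂ₜ • Φ k = 0) (k : ℕ) :
    BddEvolution.trace (hier hD b Φ k) = Φ k := by
  rw [hier, BddEvolution.trace_heat, hierProfile, map_sub, BddEvolution.trace_timeInt, sub_zero,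
    BddEvolution.trace_of_timeDeriv_smul_eq_zero (hΦ k)]

lemma eq_zero_of_heatSymbol_smul_eq_zero (hD : 0 < D) {u : BddEvolution ι}
    (h : heatSymbol ι D • u = 0) (h0 : BddEvolution.trace u = 0) : u = 0 :=
  BddEvolution.ext fun t ht x => by
    have hu := BddEvolution.abs_le_of_stripBdd_heatSymbol_smul hD h0 (T := t) (A := 0)
      (h ▸ StripBdd.zero le_rfl) ⟨ht, le_rfl⟩ x
    simpa using hu

lemma IsHierarchy.unique (hD : 0 < D) (hb : b 0 = heatSymbol ι D) (hu : IsHierarchy b u)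
    (hv : IsHierarchy b v) (h : ∀ k, BddEvolution.trace (u k) = BddEvolution.trace (v k)) :
    u = v := by
  funext k
  induction k using Nat.strong_induction_on with
  | _ k ih =>
    refine sub_eq_zero.1 (eq_zero_of_heatSymbol_smul_eq_zero hD ?_ (by rw [map_sub, h, sub_self]))
    have hsum : ∑ j ∈ Finset.range k, b (k - j) • u j = ∑ j ∈ Finset.range k, b (k - j) • v j :=
      Finset.sum_congr rfl fun j hj => by rw [ih j (Finset.mem_range.1 hj)]
    have heq := (hu k).trans (hv k).symm
    rw [Finset.sum_range_succ, Finset.sum_range_succ, hsum, Nat.sub_self, hb, add_right_inj] at heq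
    rw [smul_sub, heq, sub_self]

end Hierarchy

/-- `F ε ∼ u 0 + ε² u 1 + ε⁴ u 2 + …` as `ε → 0+`, with all derivatives, uniformly on strips. -/
def HasBddExpansion (F : ℝ → BddEvolution ι) (u : ℕ → BddEvolution ι) : Prop :=
  ∀ N, F - partialSum u N ∈ bigO ι (2 * N)

section Borel

variable {u : ℕ → BddEvolution ι} {M : ℕ → ℝ}

lemma exists_tendsto_atTop_mul_sum_le_one (M : ℕ → ℝ) : ∃ n : ℝ → ℕ,
    Tendsto n (𝓝[>] 0) atTop ∧ ∀ ε, ε * ∑ k ∈ Finset.range (n ε), M k ≤ 1 := by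
  classical
  refine ⟨fun ε => Nat.findGreatest (fun m => ε * ∑ k ∈ Finset.range m, M k ≤ 1) ⌈ε⁻¹⌉₊,
    tendsto_atTop.2 fun K => ?_, fun ε => ?_⟩
  · have hK : ∀ᶠ ε in 𝓝[>] (0 : ℝ), K ≤ ⌈ε⁻¹⌉₊ :=
      (tendsto_nat_ceil_atTop.comp tendsto_inv_nhdsGT_zero).eventually_ge_atTop K
    have hM : ∀ᶠ ε in 𝓝[>] (0 : ℝ), ε * ∑ k ∈ Finset.range K, M k < 1 :=
      nhdsWithin_le_nhds ((continuous_mul_const (∑ k ∈ Finset.range K, M k)).tendsto' 0 0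
        (zero_mul _) |>.eventually_lt_const one_pos)
    filter_upwards [hK, hM] with ε h h' using Nat.le_findGreatest h h'.le
  · exact Nat.findGreatest_spec (P := fun m => ε * ∑ k ∈ Finset.range m, M k ≤ 1) (Nat.zero_le _)
      (by simp)

lemma exists_eventually_stripBdd (u : ℕ → BddEvolution ι) : ∃ M : ℕ → ℝ, (∀ k, 0 ≤ M k) ∧
    ∀ m (α : ι → ℕ) T, ∀ᶠ k in atTop, StripBdd T (M k) (symbolMonomial m α • u k) := by
  obtain ⟨e, he⟩ := exists_surjective_nat (ℕ × (ι → ℕ))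
  choose B hB0 hB using fun k i : ℕ =>
    (symbolMonomial (e i).1 (e i).2 • u k).exists_stripBdd (k : ℝ)
  refine ⟨fun k => ∑ i ∈ Finset.range (k + 1), B k i, fun k => Finset.sum_nonneg fun i _ => hB0 k i,
    fun m α T => ?_⟩
  obtain ⟨i, hi⟩ := he (m, α)
  filter_upwards [eventually_ge_atTop i, tendsto_natCast_atTop_atTop.eventually_ge_atTop T]
    with k hik hTk
  have hk := hB k i
  rw [hi] at hk
  exact (hk.mono_time hTk).mono
    (Finset.single_le_sum (fun i _ => hB0 k i) (Finset.mem_range_succ_iff.2 hik))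

lemma stripBdd_smul_partialSum_sub (hM0 : ∀ k, 0 ≤ M k) {P : Symbol ι} {T : ℝ} {K N n : ℕ}
    (hM : ∀ k ≥ K, StripBdd T (M k) (P • u k)) (hNK : N < K) (hKn : K ≤ n) {ε : ℝ}
    (hε : ε ∈ Ioo 0 1) (hsum : ε * ∑ k ∈ Finset.range n, M k ≤ 1) :
    StripBdd T (ε ^ (2 * N)) (P • (partialSum u n ε - partialSum u K ε)) := by
  intro t ht x
  have hε0 := hε.1
  have hterm : ∀ k ∈ Finset.Ico K n,
      |(P • ε ^ (2 * k) • u k : BddEvolution ι) t x| ≤ ε ^ (2 * N + 1) * M k := fun k hk => by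
    obtain ⟨hKk, -⟩ := Finset.mem_Ico.1 hk
    rw [smul_comm, BddEvolution.smul_apply, abs_mul, abs_of_pos (pow_pos hε0 _)]
    exact mul_le_mul (pow_le_pow_of_le_one hε0.le hε.2.le (by lia)) (hM k hKk t ht x)
      (abs_nonneg _) (by positivity)
  rw [partialSum_sub_partialSum u hKn, Finset.smul_sum, BddEvolution.sum_apply]
  calc |∑ k ∈ Finset.Ico K n, (P • ε ^ (2 * k) • u k : BddEvolution ι) t x|
      ≤ ∑ k ∈ Finset.Ico K n, ε ^ (2 * N + 1) * M k :=
        (Finset.abs_sum_le_sum_abs _ _).trans (Finset.sum_le_sum hterm)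
    _ ≤ ∑ k ∈ Finset.range n, ε ^ (2 * N + 1) * M k :=
        Finset.sum_le_sum_of_subset_of_nonneg
          (fun k hk => Finset.mem_range.2 (Finset.mem_Ico.1 hk).2)
          fun k _ _ => mul_nonneg (by positivity) (hM0 k)
    _ = ε ^ (2 * N) * (ε * ∑ k ∈ Finset.range n, M k) := by
        rw [← Finset.mul_sum, pow_succ, mul_assoc]
    _ ≤ ε ^ (2 * N) := mul_le_of_le_one_right (by positivity) hsum

/-- As in Borel's lemma, the series is cut off at an index that grows slowly as `ε → 0+`. -/
lemma exists_hasBddExpansion (u : ℕ → BddEvolution ι) : ∃ U, HasBddExpansion U u := by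
  obtain ⟨M, hM0, hM⟩ := exists_eventually_stripBdd u
  obtain ⟨n, hn, hsum⟩ := exists_tendsto_atTop_mul_sum_le_one M
  refine ⟨fun ε => partialSum u (n ε) ε, fun N => mem_bigO_of_symbolMonomial fun m α T => ?_⟩
  obtain ⟨K, hNK, hK⟩ := ((eventually_gt_atTop N).and
    (eventually_forall_ge_atTop.2 (hM m α T))).exists
  obtain ⟨C, hC⟩ := partialSum_sub_partialSum_mem_bigO u hNK.le (symbolMonomial m α) T
  refine ⟨1 + C, ?_⟩
  filter_upwards [hC, hn.eventually_ge_atTop K, Ioo_mem_nhdsGT one_pos] with ε h hKn hε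
  have htail := stripBdd_smul_partialSum_sub hM0 hK hNK hKn hε (hsum ε)
  rw [add_mul, one_mul, Pi.smul_apply, Pi.sub_apply, ← sub_add_sub_cancel _ (partialSum u K ε),
    smul_add]
  exact htail.add h

end Borel

lemma eq_zero_of_const_mem_supBigO_one {w : BddEvolution ι} (h : (fun _ => w) ∈ supBigO ι 1) :
    w = 0 := BddEvolution.ext fun t ht x => by
  obtain ⟨C, hC⟩ := h t
  have hlim : Tendsto (fun ε : ℝ => C * ε ^ 1) (𝓝[>] 0) (𝓝 0) :=
    (Continuous.tendsto' (by fun_prop) 0 0 (by simp)).mono_left nhdsWithin_le_nhds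
  have hle : |w t x| ≤ 0 := ge_of_tendsto hlim (hC.mono fun ε hε => hε t ⟨ht, le_rfl⟩ x)
  exact abs_nonpos_iff.1 hle

lemma eq_zero_of_pow_smul_mem_bigO {w : BddEvolution ι} {p q : ℕ} (hpq : p < q)
    (h : (fun ε => ε ^ p • w) ∈ bigO ι q) : w = 0 := by
  have hsup : (fun ε => ε ^ p • w) ∈ supBigO ι (1 + p) :=
    supBigO_antitone (by lia) (one_smul (Symbol ι) (fun ε : ℝ => ε ^ p • w) ▸ h 1)
  refine eq_zero_of_const_mem_supBigO_one
    ((mem_supBigO_congr ?_).1 (inv_pow_smul_mem_supBigO hsup))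
  filter_upwards [self_mem_nhdsWithin] with ε (hε : 0 < ε)
  rw [smul_smul, ← mul_pow, inv_mul_cancel₀ hε.ne', one_pow, one_smul]

namespace HasBddExpansion

variable {F G : ℝ → BddEvolution ι} {u v : ℕ → BddEvolution ι}

lemma trace (h : HasBddExpansion F u) :
    HasBddExpansion (fun ε => BddEvolution.trace (F ε)) fun k => BddEvolution.trace (u k) :=
  fun N => by
    have hN : (fun ε => BddEvolution.trace (F ε)) -
        partialSum (fun k => BddEvolution.trace (u k)) N =
        fun ε => BddEvolution.trace (F ε - partialSum u N ε) := funext fun ε => by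
      rw [Pi.sub_apply, map_sub, partialSum, partialSum, map_sum]
      simp only [LinearMap.map_smul_of_tower]
    rw [hN]
    exact trace_mem_bigO (h N)

lemma sub_mem_negligible (hF : HasBddExpansion F u) (hG : HasBddExpansion G u) :
    F - G ∈ withDerivs (negligible ι) :=
  mem_withDerivs_negligible.2 fun p => bigO_antitone (by lia) <|
    sub_sub_sub_cancel_right F G (partialSum u p) ▸ sub_mem (hF p) (hG p)

lemma sub_negligible (hF : HasBddExpansion F u) (hG : G ∈ withDerivs (negligible ι)) :
    HasBddExpansion (F - G) u := fun N =>
  sub_right_comm F (partialSum u N) G ▸ sub_mem (hF N) (mem_withDerivs_negligible.1 hG _)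

lemma mem_bigO_zero (hF : HasBddExpansion F u) : F ∈ bigO ι 0 := by
  simpa [partialSum, funext_iff, Pi.sub_def] using hF 0

lemma partialSum_smul_mem_negligible {b : ℕ → Symbol ι} {n : ℕ} (hF : HasBddExpansion F u)
    (hu : IsHierarchy b u) (hb : ∀ i ≥ n, b i = 0) :
    (fun ε => partialSum b n ε • F ε) ∈ withDerivs (negligible ι) :=
  mem_withDerivs_negligible.2 fun p => by
    have hsum := add_mem (partialSum_smul_mem_bigO b n (hF p))
      (hu.partialSum_smul_partialSum_mem_bigO hb p)
    refine bigO_antitone (by lia : p ≤ 2 * p) ((mem_bigO_congr (.of_eq ?_)).1 hsum)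
    exact funext fun ε => by
      rw [Pi.add_apply, Pi.sub_apply, smul_sub, sub_add_cancel]

lemma unique (hu : HasBddExpansion F u) (hv : HasBddExpansion F v) : u = v := by
  funext k
  induction k using Nat.strong_induction_on with
  | _ k ih =>
    have hmem : (fun ε => ε ^ (2 * k) • (u k - v k)) ∈ bigO ι (2 * (k + 1)) := by
      convert sub_mem (hv (k + 1)) (hu (k + 1)) using 1
      funext ε
      have hsum : partialSum u k ε = partialSum v k ε :=
        Finset.sum_congr rfl fun j hj => by rw [ih j (Finset.mem_range.1 hj)]
      simp only [Pi.sub_apply, sub_sub_sub_cancel_left]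
      rw [partialSum, partialSum, Finset.sum_range_succ, Finset.sum_range_succ, ← partialSum,
        ← partialSum, hsum, smul_sub, add_sub_add_left_eq_sub]
    exact sub_eq_zero.1 (eq_zero_of_pow_smul_mem_bigO (by lia) hmem)

end HasBddExpansion

section Regular

variable {D : ℝ} {b : ℕ → Symbol ι} {n p : ℕ} {d : ℝ → BddEvolution ι}

lemma heatSymbol_smul_mem_bigO (hb : b 0 = heatSymbol ι D) (hn : 1 ≤ n)
    (hd : ∀ᶠ ε in 𝓝[>] (0 : ℝ), partialSum b n ε • d ε = 0) (h : d ∈ bigO ι p) :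
    heatSymbol ι D • d ∈ bigO ι (p + 2) := by
  refine (mem_bigO_congr ?_).1 (neg_mem (partialSum_sub_smul_mem_bigO b hn h))
  filter_upwards [hd] with ε hε
  have hone : partialSum b 1 ε = heatSymbol ι D := by simp [partialSum, hb]
  rw [Pi.neg_apply, hone, sub_smul, hε, zero_sub, neg_neg, Pi.smul_apply]

lemma mem_bigO_of_heatSymbol_smul (hD : 0 < D)
    (h0 : ∀ᶠ ε in 𝓝[>] (0 : ℝ), BddEvolution.trace (d ε) = 0)
    (h : heatSymbol ι D • d ∈ bigO ι p) : d ∈ bigO ι p := by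
  intro P
  induction P using Polynomial.induction_on' with
  | add P Q hP hQ => rw [add_smul]; exact add_mem hP hQ
  | monomial m q =>
    rw [← Polynomial.C_mul_X_pow_eq_monomial]
    induction m generalizing q with
    | zero =>
      intro T
      obtain ⟨C, hC0, hC⟩ := exists_nonneg_of_mem_supBigO (h (Polynomial.C q)) T
      refine ⟨C * T, ?_⟩
      filter_upwards [hC, h0, self_mem_nhdsWithin] with ε hε hε0 (hpos : 0 < ε) t ht x
      rw [Pi.smul_apply, Pi.smul_apply, smul_comm, Symbol.C_smul] at hε
      rw [pow_zero, mul_one, Pi.smul_apply, Symbol.C_smul]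
      refine (BddEvolution.abs_le_of_stripBdd_heatSymbol_smul hD
        (by rw [map_smul, hε0, smul_zero]) hε ht x).trans ?_
      rw [mul_right_comm]
      have := ht.2
      gcongr
    | succ m ih =>
      have hsymbol : Polynomial.C q * ∂ₜ ^ (m + 1) = Polynomial.C q * ∂ₜ ^ m * heatSymbol ι D +
          D • (Polynomial.C (q * laplacian ι) * ∂ₜ ^ m) := by
        rw [heatSymbol, ← Polynomial.smul_C, Polynomial.C_mul]
        simp only [Algebra.smul_def]
        ring
      rw [hsymbol, add_smul, mul_smul, smul_assoc]
      exact add_mem (h _) (Submodule.smul_mem _ D (ih (q * laplacian ι)))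

lemma mem_negligible_of_partialSum_smul_eq_zero (hD : 0 < D) (hb : b 0 = heatSymbol ι D)
    (hn : 1 ≤ n) (hd : ∀ᶠ ε in 𝓝[>] (0 : ℝ), partialSum b n ε • d ε = 0)
    (h0 : ∀ᶠ ε in 𝓝[>] (0 : ℝ), BddEvolution.trace (d ε) = 0) (h : d ∈ bigO ι 0) :
    d ∈ withDerivs (negligible ι) := mem_withDerivs_negligible.2 fun p => by
  induction p with
  | zero => exact h
  | succ p ih =>
    exact bigO_antitone (by lia)
      (mem_bigO_of_heatSymbol_smul hD h0 (heatSymbol_smul_mem_bigO hb hn hd ih))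

end Regular

/-- The solution of the hierarchy for `regCoeff` with initial values `Φ`. -/
abbrev regHier (Φ : ℕ → BddEvolution (Fin 3)) : ℕ → BddEvolution (Fin 3) :=
  hier (D := 5 / 18) (by norm_num) regCoeff Φ

lemma exists_partialSum_regCoeff_smul_eq_zero {Φ : ℕ → BddEvolution (Fin 3)}
    {G : ℝ → BddEvolution (Fin 3)} (hΦ : ∀ k, (Polynomial.X : Symbol (Fin 3)) • Φ k = 0)
    (hG : ∀ ε, (Polynomial.X : Symbol (Fin 3)) • G ε = 0) (h : HasBddExpansion G Φ) :
    ∃ F : ℝ → BddEvolution (Fin 3),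
      (∀ ε > 0, partialSum regCoeff 6 ε • F ε = 0 ∧ BddEvolution.trace (F ε) = G ε) ∧
      HasBddExpansion F (regHier Φ) := by
  obtain ⟨U, hU⟩ := exists_hasBddExpansion (regHier Φ)
  have htrace : HasBddExpansion (fun ε => BddEvolution.trace (U ε)) Φ := by
    simpa only [trace_hier _ hΦ] using hU.trace
  set V : ℝ → BddEvolution (Fin 3) := U - ((fun ε => BddEvolution.trace (U ε)) - G) with hV
  have hVexp : HasBddExpansion V (regHier Φ) := hU.sub_negligible (htrace.sub_mem_negligible h)
  obtain ⟨w, hw, hwV⟩ := exists_partialSum_regCoeff_smul_eq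
    (hVexp.partialSum_smul_mem_negligible (isHierarchy_hier _ rfl hΦ)
      fun _ => regCoeff_of_six_le)
  refine ⟨V - w, fun ε hε => ⟨?_, ?_⟩, hVexp.sub_negligible hw⟩
  · rw [Pi.sub_apply, smul_sub, (hwV ε hε).2, sub_self]
  · simp only [hV, Pi.sub_apply, map_sub, (hwV ε hε).1, sub_zero,
      BddEvolution.trace_of_timeDeriv_smul_eq_zero (BddEvolution.timeDeriv_smul_trace (U ε)),
      BddEvolution.trace_of_timeDeriv_smul_eq_zero (hG ε), sub_sub_cancel]

section Translation

open BddEvolution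

variable {ε₀ : ℝ} {φ : ℕ → Space → ℝ} {g : ℝ → Space → ℝ} {f : ℝ → ℝ → Space → ℝ}
  {u : ℕ → ℝ → Space → ℝ} {Φ U : ℕ → BddEvolution (Fin 3)} {F G H : ℝ → BddEvolution (Fin 3)}

lemma uniformBigO_iff_mem_bigO {p : ℕ} (h : ∀ᶠ ε in 𝓝[>] (0 : ℝ), EqForPos (f ε) (F ε)) :
    UniformBigO f p ↔ F ∈ bigO (Fin 3) p := by
  have hmono (T : ℝ) (m : ℕ) (α : Fin 3 → ℕ) :
      (∃ C : ℝ, ∀ᶠ ε in 𝓝[>] (0 : ℝ), StripBdd T (C * ε ^ p) (mixedDeriv m α (f ε))) ↔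
        ∃ C : ℝ, ∀ᶠ ε in 𝓝[>] (0 : ℝ), StripBdd T (C * ε ^ p) (symbolMonomial m α • F ε) :=
    exists_congr fun C => eventually_congr <| h.mono fun ε hε =>
      (EqForPos.mixedDeriv (v := (F ε).1) hε m α).stripBdd_iff
  exact ⟨fun hf => mem_bigO_of_symbolMonomial fun m α T => (hmono T m α).1 (hf T m α),
    fun hF T m α => (hmono T m α).2 (hF (symbolMonomial m α) T)⟩

lemma EqForPos.sub_partialSum {f : ℝ → Space → ℝ} {F : BddEvolution (Fin 3)} (hf : EqForPos f F)
    (hu : ∀ k, EqForPos (u k) (U k)) (N : ℕ) (ε : ℝ) :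
    EqForPos (f - ∑ k ∈ Finset.range N, ε ^ (2 * k) • u k)
      (F - partialSum U N ε : BddEvolution (Fin 3)) :=
  hf.sub (EqForPos.sum_bddEvolution fun k _ => (hu k).smul _)

lemma hasBddExpansion_iff_succ :
    HasBddExpansion F U ↔ ∀ N, F - partialSum U (N + 1) ∈ bigO (Fin 3) (2 * (N + 1)) := by
  refine ⟨fun h N => h (N + 1), fun h N => ?_⟩
  have hadd := add_mem (bigO_antitone (by lia) (h N))
    (partialSum_sub_partialSum_mem_bigO U N.le_succ)
  rwa [sub_add_sub_cancel] at hadd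

lemma forall_uniformBigO_iff_hasBddExpansion
    (hf : ∀ᶠ ε in 𝓝[>] (0 : ℝ), EqForPos (f ε) (F ε)) (hu : ∀ k, EqForPos (u k) (U k)) :
    (∀ N, UniformBigO (fun ε => f ε - ∑ k ∈ Finset.range (N + 1), ε ^ (2 * k) • u k)
      (2 * (N + 1))) ↔ HasBddExpansion F U := by
  rw [hasBddExpansion_iff_succ]
  exact forall_congr' fun N => uniformBigO_iff_mem_bigO <| hf.mono fun ε hε =>
    hε.sub_partialSum hu (N + 1) ε

lemma HasDataExpansion.hasBddExpansion (h : HasDataExpansion g φ)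
    (hG : ∀ᶠ ε in 𝓝[>] (0 : ℝ), EqForPos (fun _ => g ε) (G ε))
    (hΦ : ∀ k, EqForPos (fun _ => φ k) (Φ k)) : HasBddExpansion G Φ := by
  refine (forall_uniformBigO_iff_hasBddExpansion hG hΦ).1 fun N T m α => ?_
  have hconst (ε : ℝ) : (fun _ => g ε) - ∑ k ∈ Finset.range (N + 1), ε ^ (2 * k) • (fun _ => φ k) =
      fun _ : ℝ => g ε - ∑ k ∈ Finset.range (N + 1), ε ^ (2 * k) • φ k := by
    funext t x
    simp
  simp only [hconst]
  cases m with
  | zero =>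
    obtain ⟨C, hC⟩ := h N α
    exact ⟨C, hC.mono fun ε hε t _ x => hε x⟩
  | succ m => exact ⟨0, .of_forall fun ε t _ x => by simp [mixedDeriv_succ_const]⟩

lemma sum_regCoeff_smul_eq_zero_iff (hu : ∀ k, EqForPos (u k) (U k)) (k : ℕ) :
    ∑ j ∈ Finset.range (k + 1), regCoeff (k - j) • U j = 0 ↔
      ∀ t > 0, ∀ x, dt (u k) t x =
        5 / 18 * lap (u k) t x - ∑ j ∈ Finset.range k, corr (k - j) (u j) t x := by
  have hcorr : EqForPos (∑ j ∈ Finset.range k, corr (k - j) (u j))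
      (∑ j ∈ Finset.range k, regCoeff (k - j) • U j : BddEvolution (Fin 3)) :=
    .sum_bddEvolution fun j hj => EqForPos.corr (v := (U j).1) (hu j)
      (Nat.sub_pos_of_lt (Finset.mem_range.1 hj))
  have hsum : EqForPos
      (∑ j ∈ Finset.range k, corr (k - j) (u j) + (dt (u k) - (5 / 18 : ℝ) • lap (u k)))
      (∑ j ∈ Finset.range (k + 1), regCoeff (k - j) • U j : BddEvolution (Fin 3)) := by
    rw [Finset.sum_range_succ, Nat.sub_self]
    exact hcorr.add (EqForPos.heat (v := (U k).1) (hu k))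
  have hzero : ∑ j ∈ Finset.range (k + 1), regCoeff (k - j) • U j = 0 ↔ EqForPos
      (∑ j ∈ Finset.range k, corr (k - j) (u j) + (dt (u k) - (5 / 18 : ℝ) • lap (u k)))
      (0 : BddEvolution (Fin 3)) :=
    ⟨fun h => h ▸ hsum, fun h => hsum.bddEvolution_unique h⟩
  rw [hzero]
  refine forall₂_congr fun t _ => forall_congr' fun x => ?_
  simp only [Pi.add_apply, Pi.sub_apply, Pi.smul_apply, Finset.sum_apply, smul_eq_mul,
    BddEvolution.zero_apply]
  constructor <;> intro h <;> linarith

lemma isHierarchy_regCoeff_iff (hu : ∀ k, EqForPos (u k) (U k)) :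
    IsHierarchy regCoeff U ↔ (∀ t > 0, ∀ x, dt (u 0) t x = 5 / 18 * lap (u 0) t x) ∧
      ∀ k ≥ 1, ∀ t > 0, ∀ x, dt (u k) t x =
        5 / 18 * lap (u k) t x - ∑ j ∈ Finset.range k, corr (k - j) (u j) t x := by
  rw [IsHierarchy, forall_congr' (sum_regCoeff_smul_eq_zero_iff hu), ← Nat.and_forall_add_one]
  simp only [Finset.range_zero, Finset.sum_empty, sub_zero]
  exact and_congr_right' ⟨fun h k hk => Nat.sub_add_cancel hk ▸ h (k - 1),
    fun h k => h (k + 1) (by lia)⟩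

lemma isHierarchy_regHier (hΦ : ∀ k, EqForPos (fun _ => φ k) (Φ k)) :
    IsHierarchy regCoeff (regHier Φ) :=
  isHierarchy_hier _ rfl (fun k => timeDeriv_smul_of_eqForPos_const (hΦ k))

lemma trace_regHier (hΦ : ∀ k, EqForPos (fun _ => φ k) (Φ k)) (k : ℕ) :
    trace (regHier Φ k) = Φ k :=
  trace_hier _ (fun j => timeDeriv_smul_of_eqForPos_const (hΦ j)) k

namespace SolvesHierarchy

lemma eqForPos_regHier (hu : SolvesHierarchy φ u) (hΦ : ∀ k, EqForPos (fun _ => φ k) (Φ k))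
    (k : ℕ) : EqForPos (u k) (regHier Φ k) := by
  choose U hU using fun k => (hu.smooth k).exists_eqForPos
  have htrace (k : ℕ) : trace (U k) = trace (regHier Φ k) := by
    have htraceU := eqForPos_trace_of_continuousOn (hu.smooth k).continuousOn (hU k)
    rw [funext (hu.initial k)] at htraceU
    rw [trace_regHier hΦ, htraceU.bddEvolution_unique (hΦ k)]
  have hUeq : U = regHier Φ :=
    IsHierarchy.unique (by norm_num : (0 : ℝ) < 5 / 18) rfl
      ((isHierarchy_regCoeff_iff hU).2 ⟨hu.leading, hu.higher⟩) (isHierarchy_regHier hΦ) htrace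
  exact hUeq ▸ hU k

lemma of_eqForPos_regHier (hu : ∀ k, SmoothBdd (u k)) (hΦ : ∀ k, EqForPos (fun _ => φ k) (Φ k))
    (h : ∀ k, EqForPos (u k) (regHier Φ k)) : SolvesHierarchy φ u where
  smooth := hu
  initial k x := by
    have htrace := eqForPos_trace_of_continuousOn (hu k).continuousOn (h k) 1 one_pos x
    rwa [trace_regHier hΦ, ← hΦ k 1 one_pos x] at htrace
  leading := ((isHierarchy_regCoeff_iff h).1 (isHierarchy_regHier hΦ)).1
  higher := ((isHierarchy_regCoeff_iff h).1 (isHierarchy_regHier hΦ)).2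

lemma extend_regHier (hΦ : ∀ k, EqForPos (fun _ => φ k) (Φ k)) :
    SolvesHierarchy φ fun k => (regHier Φ k).extend (φ k) :=
  of_eqForPos_regHier (fun k => smoothBdd_extend ((trace_regHier hΦ k).symm ▸ hΦ k)) hΦ
    fun _ => eqForPos_extend _ _

lemma eq_extend_regHier (hu : SolvesHierarchy φ u) (hΦ : ∀ k, EqForPos (fun _ => φ k) (Φ k))
    (k : ℕ) {t : ℝ} (ht : 0 ≤ t) (x : Space) : u k t x = (regHier Φ k).extend (φ k) t x := by
  rcases ht.eq_or_lt with rfl | ht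
  · rw [hu.initial, extend_zero]
  · rw [hu.eqForPos_regHier hΦ k t ht, eqForPos_extend _ _ t ht]

end SolvesHierarchy

namespace IsRegularSolution

lemma extend (hG : ∀ ε ∈ Ioo 0 ε₀, EqForPos (fun _ => g ε) (G ε))
    (hF : ∀ ε > 0, partialSum regCoeff 6 ε • F ε = 0 ∧ trace (F ε) = G ε)
    (hF0 : F ∈ bigO (Fin 3) 0) : IsRegularSolution ε₀ g fun ε => (F ε).extend (g ε) where
  smooth ε hε := smoothBdd_extend ((hF ε hε.1).2.symm ▸ hG ε hε)
  equation ε hε t ht x :=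
    (EqForPos.regOp (v := (F ε).1) ((F ε).eqForPos_extend (g ε)) ε t ht x).trans
      (congrArg (fun v : BddEvolution (Fin 3) => v t x) (hF ε hε.1).1)
  initial _ _ _ := extend_zero _ _ _
  regular := (uniformBigO_iff_mem_bigO (.of_forall fun _ => eqForPos_extend _ _)).2 hF0

lemma hasBddExpansion (hf : IsRegularSolution ε₀ g f) (hε₀ : 0 < ε₀)
    (hF : ∀ ε ∈ Ioo 0 ε₀, EqForPos (f ε) (F ε))
    (hG : ∀ ε ∈ Ioo 0 ε₀, EqForPos (fun _ => g ε) (G ε))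
    (hH : ∀ ε > 0, partialSum regCoeff 6 ε • H ε = 0 ∧ trace (H ε) = G ε)
    (hHU : HasBddExpansion H U) : HasBddExpansion F U := by
  have hev : ∀ᶠ ε in 𝓝[>] (0 : ℝ), ε ∈ Ioo 0 ε₀ := Ioo_mem_nhdsGT hε₀
  have hF0 : F ∈ bigO (Fin 3) 0 := (uniformBigO_iff_mem_bigO (hev.mono hF)).1 hf.regular
  have hsmul : ∀ᶠ ε in 𝓝[>] (0 : ℝ), partialSum regCoeff 6 ε • (H - F) ε = 0 := by
    filter_upwards [hev] with ε hε
    have hFε : partialSum regCoeff 6 ε • F ε = 0 := BddEvolution.ext fun t ht x =>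
      (EqForPos.regOp (v := (F ε).1) (hF ε hε) ε t ht x).symm.trans (hf.equation ε hε t ht x)
    rw [Pi.sub_apply, smul_sub, (hH ε hε.1).1, hFε, sub_zero]
  have htrace : ∀ᶠ ε in 𝓝[>] (0 : ℝ), trace ((H - F) ε) = 0 := by
    filter_upwards [hev] with ε hε
    have htraceF := eqForPos_trace_of_continuousOn (hf.smooth ε hε).continuousOn (hF ε hε)
    rw [funext (hf.initial ε hε)] at htraceF
    rw [Pi.sub_apply, map_sub, (hH ε hε.1).2, htraceF.bddEvolution_unique (hG ε hε), sub_self]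
  have hdiff := mem_negligible_of_partialSum_smul_eq_zero (by norm_num : (0 : ℝ) < 5 / 18) rfl
    (by norm_num) hsmul htrace (sub_mem hHU.mem_bigO_zero hF0)
  simpa only [sub_sub_cancel] using hHU.sub_negligible hdiff

theorem hasExpansion_iff (hf : IsRegularSolution ε₀ g f) (hε₀ : 0 < ε₀)
    (hΦ : ∀ k, EqForPos (fun _ => φ k) (Φ k))
    (hG : ∀ ε ∈ Ioo 0 ε₀, EqForPos (fun _ => g ε) (G ε))
    (hH : ∀ ε > 0, partialSum regCoeff 6 ε • H ε = 0 ∧ trace (H ε) = G ε)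
    (hHΦ : HasBddExpansion H (regHier Φ)) : HasExpansion f u ↔ SolvesHierarchy φ u := by
  choose! F hF using fun ε (hε : ε ∈ Ioo 0 ε₀) => (hf.smooth ε hε).exists_eqForPos
  have hF' : ∀ᶠ ε in 𝓝[>] (0 : ℝ), EqForPos (f ε) (F ε) :=
    mem_of_superset (Ioo_mem_nhdsGT hε₀) hF
  have hFΦ : HasBddExpansion F (regHier Φ) := hf.hasBddExpansion hε₀ hF hG hH hHΦ
  constructor
  · intro hu
    choose U hU using fun k => (hu.coeff k).exists_eqForPos
    have hFU : HasBddExpansion F U :=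
      (forall_uniformBigO_iff_hasBddExpansion hF' hU).1 hu.remainder
    exact .of_eqForPos_regHier hu.coeff hΦ (hFU.unique hFΦ ▸ hU)
  · intro hu
    exact ⟨hu.smooth,
      (forall_uniformBigO_iff_hasBddExpansion hF' (hu.eqForPos_regHier hΦ)).2 hFΦ⟩

end IsRegularSolution

lemma SmoothBddData.exists_eqForPos_trace {φ : Space → ℝ} (hφ : SmoothBddData φ) :
    ∃ v : BddEvolution (Fin 3), EqForPos (fun _ => φ) (trace v) := by
  obtain ⟨v, hv⟩ := hφ.smoothBdd_const.exists_eqForPos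
  exact ⟨v, (trace_of_timeDeriv_smul_eq_zero (timeDeriv_smul_of_eqForPos_const hv)).symm ▸ hv⟩

end Translation

end RandomMotion

end

open RandomMotion

theorem mainTheorem3 (ε₀ : ℝ) (hε₀ : 0 < ε₀)
    (φ : ℕ → RandomMotion.Space → ℝ) (hφ : ∀ k, RandomMotion.SmoothBddData (φ k))
    (g : ℝ → RandomMotion.Space → ℝ) (hg : ∀ ε ∈ Set.Ioo 0 ε₀, RandomMotion.SmoothBddData (g ε))
    (hgφ : RandomMotion.HasDataExpansion g φ) :
    (∃ u : ℕ → ℝ → RandomMotion.Space → ℝ, RandomMotion.SolvesHierarchy φ u ∧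
      ∀ u' : ℕ → ℝ → RandomMotion.Space → ℝ, RandomMotion.SolvesHierarchy φ u' →
        ∀ k, ∀ t ≥ 0, ∀ x, u' k t x = u k t x) ∧
    (∃ f : ℝ → ℝ → RandomMotion.Space → ℝ, RandomMotion.IsRegularSolution ε₀ g f) ∧
    (∀ f : ℝ → ℝ → RandomMotion.Space → ℝ, RandomMotion.IsRegularSolution ε₀ g f →
      ∀ u : ℕ → ℝ → RandomMotion.Space → ℝ,
        RandomMotion.HasExpansion f u ↔ RandomMotion.SolvesHierarchy φ u) := by
  choose Φ hΦ using fun k => (hφ k).smoothBdd_const.exists_eqForPos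
  choose! G hG using fun ε (hε : ε ∈ Ioo 0 ε₀) => (hg ε hε).exists_eqForPos_trace
  have hGΦ : HasBddExpansion (fun ε => BddEvolution.trace (G ε)) Φ :=
    hgφ.hasBddExpansion (mem_of_superset (Ioo_mem_nhdsGT hε₀) hG) hΦ
  obtain ⟨F, hF, hFΦ⟩ := exists_partialSum_regCoeff_smul_eq_zero
    (fun k => timeDeriv_smul_of_eqForPos_const (hΦ k))
    (fun ε => BddEvolution.timeDeriv_smul_trace (G ε)) hGΦ
  exact ⟨⟨_, .extend_regHier hΦ, fun u' hu' k t ht x => hu'.eq_extend_regHier hΦ k ht x⟩,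
    ⟨_, .extend hG hF hFΦ.mem_bigO_zero⟩,
    fun f hf u => hf.hasExpansion_iff hε₀ hΦ hG hF hFΦ⟩
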